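/- Let $d\ge 1$, write points of $\mathbb R^{1+2d}$ as $(t,x,v)$ with $t\in\mathbb R$, $x,v\in\mathbb R^d$, and let $$p\in\Bigl(2-\frac{2}{3d+2},\,2+\frac2d\Bigr),\qquad q:=p\,\frac{4d+2}{d(p+2)},\qquad r:=p\,\frac{4d+2}{p(3d+2)-2d}.$$ Let $0<\lambda,\Lambda<\infty$. Then there is a constant $C=C(p,d,\lambda,\Lambda)>0$ such that the following holds. Let $A:\mathbb R^{1+2d}\times\mathbb R\times\mathbb R^d\to\mathbb R^d$ be a Carathéodory vector field ($A(\cdot,\eta,\xi)$ is measurable for every $(\eta,\xi)$, and $A(t,x,v,\cdot,\cdot)$ is continuous for a.e. $(t,x,v)$) such that, for a.e. $(t,x,v)$ and all $\eta\in\mathbb R$, $\xi\in\mathbb R^d$, $$A(t,x,v,\eta,\xi)\cdot\xi\ge\lambda|\xi|^p,\qquad |A(t,x,v,\eta,\xi)|\le\Lambda|\xi|^{p-1}.$$ For $\theta,R>0$ and a fixed $(t_0,x_0,v_0)\in\mathbb R^{1+2d}$ set $$Q_{\theta,R}:=\bigl\{(t,x,v):\ t\in[t_0-\theta R^p,t_0),\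 |x-x_0-(t-t_0)v|<\theta R^{1+p},\ |v-v_0|<R\bigr\}.$$ Let $\theta>0$, $0<R_1<R_2$, and let $f\ge0$ be a weak subsolution in $Q_{\theta,R_2}$ of $$(\partial_t+v\cdot\nabla_x)f-\nabla_v\cdot A(t,x,v,f,\nabla_vf)=0$$ with $\nabla_v f\in L^p(Q_{\theta,R_2})$ and $f\in L^p(Q_{\theta,R_2})\cap L^2(Q_{\theta,R_2})$. Here $f$ is a weak subsolution in $Q_{\theta,R_2}$ if, on the interior $\Omega$ of $Q_{\theta,R_2}$, one has $f\in L^\infty_tL^2_{x,v}\cap L^p$, the distributional gradient $\nabla_v f$ belongs to $L^p$, and $$\int_\Omega\bigl(-f\,(\partial_t+v\cdot\nabla_x)\varphi+A(t,x,v,f,\nabla_vf)\cdot\nabla_v\varphi\bigr)\,\mathrm d(t,x,v)\le0\qquad\text{for all } 0\le\varphi\in C_c^\infty(\Omega).$$ Define $$\Gamma_t:=\frac1{\theta(R_2^p-R_1^p)},\qquad \Gamma_v:=\frac{R_2^p}{R_2^{1+p}-R_1^{1+p}}+\frac1{R_2-R_1}.$$ Then $f\in L^q(Q_{\theta,R_1})$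 and $$\begin{aligned}\|f\|_{L^q(Q_{\theta,R_1})}\le C\Bigl(&\|\nabla_vf\|_{L^p(Q_{\theta,R_2})}+\bigl(1+\Gamma_v|Q_{\theta,R_2}|^{\frac1r-\frac{p-1}p}\bigr)\|\nabla_vf\|_{L^p(Q_{\theta,R_2})}^{p-1}\\&+\Gamma_v\|f\|_{L^p(Q_{\theta,R_2})}+\Gamma_t|Q_{\theta,R_2}|^{\frac1r-\frac1p}\|f\|_{L^p(Q_{\theta,R_2})}\Bigr),\end{aligned}$$ and, if $p\ge2$, also $$\begin{aligned}\|f\|_{L^q(Q_{\theta,R_1})}\le C\Bigl(&\|\nabla_vf\|_{L^p(Q_{\theta,R_2})}+\bigl(1+\Gamma_v|Q_{\theta,R_2}|^{\frac1r-\frac{p-1}p}\bigr)\|\nabla_vf\|_{L^p(Q_{\theta,R_2})}^{p-1}\\&+\Gamma_v\|f\|_{L^p(Q_{\theta,R_2})}+\Gamma_t|Q_{\theta,R_2}|^{\frac1r-\frac12}\|f\|_{L^2(Q_{\theta,R_2})}\Bigr).\end{aligned}$$ -/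

import Mathlib

open MeasureTheory
open scoped ContDiff

/-- The space `ℝ^d` of positions or of velocities, with its Euclidean norm. -/
abbrev Space (d : ℕ) : Type := EuclideanSpace ℝ (Fin d)

/-- Phase space-time `ℝ^{1+2d}`; its points are `z = (t, x, v)`. -/
abbrev Phase (d : ℕ) : Type := ℝ × Space d × Space d

/-- The velocity gradient `∇_v φ` at `z = (t, x, v)`. -/
noncomputable def gradV {d : ℕ} (φ : Phase d → ℝ) (z : Phase d) : Space d :=
  gradient (fun w : Space d => φ (z.1, z.2.1, w)) z.2.2

/-- The transport derivative `(∂_t + v · ∇_x) φ` at `z = (t, x, v)`. -/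
noncomputable def transport {d : ℕ} (φ : Phase d → ℝ) (z : Phase d) : ℝ :=
  fderiv ℝ φ z (1, z.2.2, 0)

/-- `φ ∈ C_c^∞(Ω)`. -/
structure IsTestFunction {d : ℕ} (Ω : Set (Phase d)) (φ : Phase d → ℝ) : Prop where
  smooth : ContDiff ℝ ∞ φ
  compact : HasCompactSupport φ
  support_subset : tsupport φ ⊆ Ω

/-- `G` is the weak (distributional) velocity gradient `∇_v f` on the open set `Ω`. -/
structure HasWeakGradV {d : ℕ} (Ω : Set (Phase d)) (f : Phase d → ℝ)
    (G : Phase d → Space d) : Prop where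
  locInt : LocallyIntegrableOn f Ω
  locInt_grad : LocallyIntegrableOn G Ω
  integral_eq : ∀ φ : Phase d → ℝ, IsTestFunction Ω φ →
    ∫ z in Ω, f z • gradV φ z = - ∫ z in Ω, φ z • G z

/-- `f ∈ L^∞_t L^2_{x,v}(Ω)`: the `L^2` norms of `f(t, ·)` over the time slices of `Ω` are
essentially bounded in `t`. (Joint measurability of `f` is part of the other conditions in which
this one is used.) -/
def BoundedSliceL2 {d : ℕ} (Ω : Set (Phase d)) (f : Phase d → ℝ) : Prop :=
  ∃ M : NNReal, ∀ᵐ t : ℝ,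
    eLpNorm (fun y : Space d × Space d => f (t, y)) 2
      (volume.restrict {y : Space d × Space d | (t, y) ∈ Ω}) ≤ M

/-- A Carathéodory vector field `A = A(z, η, ξ)`: (Lebesgue) measurable in `z = (t, x, v)` for
every `(η, ξ)`, and continuous in `(η, ξ)` for almost every `z`. -/
structure IsCaratheodory {d : ℕ} (A : Phase d → ℝ → Space d → Space d) : Prop where
  measurable : ∀ (η : ℝ) (ξ : Space d), AEMeasurable (fun z => A z η ξ) volume
  continuous : ∀ᵐ z : Phase d, Continuous (fun y : ℝ × Space d => A z y.1 y.2)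

/-- The `p`-growth bounds `A(z, η, ξ) · ξ ≥ lam |ξ|^p` and `|A(z, η, ξ)| ≤ Lam |ξ|^{p-1}`. -/
def HasPGrowth {d : ℕ} (p lam Lam : ℝ) (A : Phase d → ℝ → Space d → Space d) : Prop :=
  ∀ᵐ z : Phase d, ∀ (η : ℝ) (ξ : Space d),
    lam * ‖ξ‖ ^ p ≤ inner ℝ (A z η ξ) ξ ∧ ‖A z η ξ‖ ≤ Lam * ‖ξ‖ ^ (p - 1)

/-- `f`, with weak velocity gradient `G = ∇_v f`, is a weak subsolution of
`(∂_t + v · ∇_x) f - ∇_v · A(t, x, v, f, ∇_v f) = 0` on the open set `Ω`. -/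
structure IsWeakSubsolution {d : ℕ} (p : ℝ) (A : Phase d → ℝ → Space d → Space d)
    (Ω : Set (Phase d)) (f : Phase d → ℝ) (G : Phase d → Space d) : Prop where
  boundedSliceL2 : BoundedSliceL2 Ω f
  memLp : MemLp f (ENNReal.ofReal p) (volume.restrict Ω)
  memLp_grad : MemLp G (ENNReal.ofReal p) (volume.restrict Ω)
  hasWeakGradV : HasWeakGradV Ω f G
  weak_ineq : ∀ φ : Phase d → ℝ, IsTestFunction Ω φ → (∀ z, 0 ≤ φ z) →
    ∫ z in Ω, (- f z * transport φ z + inner ℝ (A z (f z) (G z)) (gradV φ z)) ≤ 0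

/-- The backward kinetic `p`-cylinder `Q_{θ,R}(z₀)` centred at `z₀ = (t₀, x₀, v₀)`. -/
def kineticCylinder {d : ℕ} (p θ R : ℝ) (z₀ : Phase d) : Set (Phase d) :=
  {z | z.1 ∈ Set.Ico (z₀.1 - θ * R ^ p) z₀.1 ∧
    z.2.1 - z₀.2.1 - (z.1 - z₀.1) • z.2.2 ∈ Metric.ball (0 : Space d) (θ * R ^ (1 + p)) ∧
    z.2.2 - z₀.2.2 ∈ Metric.ball (0 : Space d) R}

/-- The norm of `L^s(Q)` with respect to Lebesgue measure (for functions in `L^s(Q)`). -/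
noncomputable def normLpOn {d : ℕ} {E : Type*} [NormedAddCommGroup E] (s : ℝ)
    (Q : Set (Phase d)) (g : Phase d → E) : ℝ :=
  (eLpNorm g (ENNReal.ofReal s) (volume.restrict Q)).toReal

/-- The cost `Γ_t` of the cutoff in time. -/
noncomputable def gammaT (p θ R₁ R₂ : ℝ) : ℝ := 1 / (θ * (R₂ ^ p - R₁ ^ p))

/-- The cost `Γ_v` of the cutoff in velocity. -/
noncomputable def gammaV (p R₁ R₂ : ℝ) : ℝ :=
  R₂ ^ p / (R₂ ^ (1 + p) - R₁ ^ (1 + p)) + 1 / (R₂ - R₁)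

/-! The proof is a representation formula followed by fractional integration. Fix a base point `z =
(t, x, v)` and reach points of its past at time `t - s` by displacements of size `s ^ (1 + κ)` in
position and `s ^ κ` in velocity (`kinShift`), with rescaled coordinates `(y, u)`. The velocity
coordinate is sheared so that `u = 0` describes curves that solve `x' = v` exactly. In these
coordinates take the kernel `k = ζ(s) s ^ (-d (1 + 2κ)) exp(-(|y|² + |u|²)/2)`, where `ζ` vanishes
for `s ≤ ε` and equals `1` for `s ≥ 2ε`.

The algebraic heart is `transport_kinKernel`: the transport derivative of `k` is minus the kernel
with `ζ'` in place of `ζ`, minus a velocity divergence `div_v J`. The `ζ'` kernel averages at scale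
`ε`. Testing the subsolution with `φ k ≥ 0`, where `φ` is a cutoff, and integrating `div_v J` by
parts onto `∇_v f` (`IsWeakSubsolution.integral_kinKernel_le`) therefore bounds the average of `f φ`
near `z` by integrals of `|∇_v f| |J|`, `|A| |∇_v k|` and cutoff errors against `k` and `J`. The
kernels are bounded uniformly in `ε` (`IsWeakSubsolution.average_le`), and letting `ε → 0` turns
averages into values (`ae_enorm_le_of_average_le`).

Up to Gaussian factors `J`, `∇_v k` and `k` have sizes `s ^ (β - 1 - d (1 + 2κ))` with `β = κ`, `1 -
κ` and `1`. They are fractional integrals of order `β` in homogeneous dimension `D = 1 + d (1 +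
2κ)`, and map `L^P` to `L^Q` when `1/P - 1/Q = β/D` (`exists_lintegral_fracOp_le`). This rests on an
abstract Hardy–Littlewood–Sobolev argument (`lintegral_rpow_le_of_split`) that needs no maximal
function.

The source `∇_v f` lies in `L^p`, while `A`, of size `|∇_v f| ^ (p - 1)`, lies in the dual space
`L^{p'}`. Requiring both terms to land in the same `L^q` fixes `κ` and `q`; the error of order `1`
then needs data in `L^r`. The range of `p` is exactly `0 < κ < 1`, which also gives `r < p` and `r <
p'` (`kinetic_exponents`). Hölder on the finite-volume cylinder supplies the powers of `|Q_{θ,R₂}|`.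
-/

/-! ### Layer-cake formula and an abstract Hardy–Littlewood–Sobolev inequality -/

lemma lintegral_Ioo_rpow {c e : ℝ} (hc : 0 < c) (he : 0 < e) :
    ∫⁻ μ in Set.Ioo (0 : ℝ) c, ENNReal.ofReal (μ ^ (e - 1)) = ENNReal.ofReal (c ^ e / e) := by
  have hint : IntervalIntegrable (fun μ : ℝ => μ ^ (e - 1)) volume 0 c :=
    intervalIntegral.intervalIntegrable_rpow' (by linarith)
  rw [setLIntegral_congr Ioo_ae_eq_Ioc, ← ofReal_integral_eq_lintegral_ofReal]
  · rw [← intervalIntegral.integral_of_le hc.le, integral_rpow (Or.inl (by linarith))]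
    simp [Real.zero_rpow he.ne']
  · exact (intervalIntegrable_iff_integrableOn_Ioc_of_le hc.le).1 hint
  · filter_upwards [ae_restrict_mem measurableSet_Ioc] with x hx
    exact Real.rpow_nonneg hx.1.le _

lemma lintegral_Ioi_indicator_rpow (x : ENNReal) {e : ℝ} (he : 0 < e) :
    ∫⁻ μ in Set.Ioi (0 : ℝ), {μ : ℝ | ENNReal.ofReal μ < x}.indicator
      (fun μ => ENNReal.ofReal (μ ^ (e - 1))) μ = x ^ e / ENNReal.ofReal e := by
  have key : ∀ c : ℝ, 0 < c → ∫⁻ μ in Set.Ioi (0 : ℝ),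
      {μ : ℝ | ENNReal.ofReal μ < ENNReal.ofReal c}.indicator
      (fun μ => ENNReal.ofReal (μ ^ (e - 1))) μ = ENNReal.ofReal c ^ e / ENNReal.ofReal e := by
    intro c hc
    have hm : MeasurableSet {μ : ℝ | ENNReal.ofReal μ < ENNReal.ofReal c} :=
      measurableSet_lt ENNReal.measurable_ofReal measurable_const
    rw [lintegral_indicator hm, Measure.restrict_restrict hm]
    have : {μ : ℝ | ENNReal.ofReal μ < ENNReal.ofReal c} ∩ Set.Ioi 0 = Set.Ioo 0 c := by
      ext μ
      simp [ENNReal.ofReal_lt_ofReal_iff hc, and_comm]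
    rw [this, lintegral_Ioo_rpow hc he, ENNReal.ofReal_div_of_pos he,
      ENNReal.ofReal_rpow_of_pos hc]
  rcases eq_or_ne x 0 with rfl | hx0
  · simp [he]
  by_cases hx : x = ⊤
  · subst hx
    rw [ENNReal.top_rpow_of_pos he, ENNReal.top_div_of_ne_top ENNReal.ofReal_ne_top]
    refine ENNReal.eq_top_of_forall_nnreal_le fun n => ?_
    -- Chosen so that `c ^ e / e = n + 1`: truncating at height `c` already makes the integral
    -- exceed `n`.
    set c : ℝ := ((n + 1) * e) ^ (1 / e) with hc
    have hc0 : 0 < c := by positivity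
    have h1 : ENNReal.ofReal c ^ e / ENNReal.ofReal e = ENNReal.ofReal (n + 1) := by
      rw [ENNReal.ofReal_rpow_of_pos hc0, ← ENNReal.ofReal_div_of_pos he, hc,
        ← Real.rpow_mul (by positivity)]
      congr 1
      field_simp
      simp
    calc (n : ENNReal) ≤ ENNReal.ofReal (n + 1) := by
          rw [← ENNReal.ofReal_coe_nnreal]
          exact ENNReal.ofReal_le_ofReal (by linarith)
      _ = _ := h1.symm
      _ = _ := (key c hc0).symm
      _ ≤ _ := by
          refine lintegral_mono fun μ => ?_
          refine Set.indicator_le_indicator_of_subset ?_ (fun _ => zero_le) μ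
          intro μ _
          exact ENNReal.ofReal_lt_top
  · have := key x.toReal (ENNReal.toReal_pos hx0 hx)
    rwa [ENNReal.ofReal_toReal hx] at this

/-- Tonelli applied to the one-point formula `lintegral_Ioi_indicator_rpow`, which is valid at the
value `⊤` too, so `h` need not be finite. -/
lemma lintegral_rpow_eq_lintegral_lt {Z : Type*} [MeasurableSpace Z] {μ : Measure Z} [SFinite μ]
    {h : Z → ENNReal} (hh : Measurable h) {Q : ℝ} (hQ : 0 < Q) :
    ∫⁻ z, h z ^ Q ∂μ = ENNReal.ofReal Q * ∫⁻ s in Set.Ioi (0 : ℝ),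
      ENNReal.ofReal (s ^ (Q - 1)) * μ {z | ENNReal.ofReal s < h z} := by
  have h1 : ∀ z, h z ^ Q = ENNReal.ofReal Q * ∫⁻ s in Set.Ioi (0 : ℝ),
      {s : ℝ | ENNReal.ofReal s < h z}.indicator (fun s => ENNReal.ofReal (s ^ (Q - 1))) s := by
    intro z
    rw [lintegral_Ioi_indicator_rpow _ hQ, ENNReal.mul_div_cancel (by simpa using hQ)
      ENNReal.ofReal_ne_top]
  have hset : MeasurableSet {a : Z × ℝ | ENNReal.ofReal a.2 < h a.1} :=
    measurableSet_lt (by fun_prop) (by fun_prop)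
  have hm : Measurable (Function.uncurry fun (z : Z) (s : ℝ) =>
      {s : ℝ | ENNReal.ofReal s < h z}.indicator (fun s => ENNReal.ofReal (s ^ (Q - 1))) s) :=
    (Measurable.indicator (by fun_prop : Measurable fun a : Z × ℝ =>
      ENNReal.ofReal (a.2 ^ (Q - 1))) hset)
  simp_rw [h1]
  rw [lintegral_const_mul _ (by exact hm.lintegral_prod_right'), lintegral_lintegral_swap hm.aemeasurable]
  congr 1
  refine lintegral_congr fun s => ?_
  have : ∀ z, {s : ℝ | ENNReal.ofReal s < h z}.indicator
      (fun s => ENNReal.ofReal (s ^ (Q - 1))) s =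
      {z | ENNReal.ofReal s < h z}.indicator (fun _ => ENNReal.ofReal (s ^ (Q - 1))) z := by
    intro z
    simp [Set.indicator]
  simp_rw [this]
  rw [lintegral_indicator_const (measurableSet_lt measurable_const hh)]

/-- Weak-type level set bound behind the Hardy–Littlewood–Sobolev inequality. -/
lemma meas_lt_le_of_split {Z : Type*} [MeasurableSpace Z] {μ : Measure Z}
    {h g : Z → ENNReal} (hg : Measurable g)
    {I : (Z → ENNReal) → Z → ENNReal} {s G c : ℝ} (hs : 0 < s)
    (hGc : G * c = s / 4)
    (hsplit : ∀ z, h z ≤ I g z + ENNReal.ofReal (s / 2))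
    (hIm : ∀ g, Measurable g → Measurable (I g))
    (hadd : ∀ g₁ g₂ z, Measurable g₁ → Measurable g₂ → I (g₁ + g₂) z ≤ I g₁ z + I g₂ z)
    (hbdd : ∀ g z, (∀ z, g z ≤ ENNReal.ofReal G) → I g z ≤ ENNReal.ofReal (G * c))
    (hL1 : ∀ g, Measurable g → ∫⁻ z, I g z ∂μ ≤ ENNReal.ofReal c * ∫⁻ z, g z ∂μ) :
    μ {z | ENNReal.ofReal s < h z} ≤ ENNReal.ofReal (4 * c / s) *
      ∫⁻ z, {z | ENNReal.ofReal G < g z}.indicator g z ∂μ := by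
  have hset : MeasurableSet {z | ENNReal.ofReal G < g z} := measurableSet_lt measurable_const hg
  set gb := {z | ENNReal.ofReal G < g z}.indicator g with hgb
  set gs := {z | ENNReal.ofReal G < g z}ᶜ.indicator g with hgs
  have hgbm : Measurable gb := hg.indicator hset
  have hgsm : Measurable gs := hg.indicator hset.compl
  have hsum : gs + gb = g := Set.indicator_compl_add_self _ _
  -- Of the total `s`, the remainder accounts for at most `s / 2` and the part of `g` below height
  -- `G` for at most `s / 4` by the `L^∞` bound. The tall part must supply the rest, and Chebyshev
  -- with the `L^1` bound controls it.
  have hsub : {z | ENNReal.ofReal s < h z} ⊆ {z | ENNReal.ofReal (s / 4) ≤ I gb z} := by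
    intro z hz
    by_contra hcon
    simp only [Set.mem_ofPred_eq, not_le] at hz hcon
    have h1 : I gs z ≤ ENNReal.ofReal (s / 4) := by
      rw [← hGc]
      refine hbdd _ _ fun z => ?_
      by_cases hz : ENNReal.ofReal G < g z
      · simp [hgs, hz]
      · rw [hgs, Set.indicator_of_mem (by exact hz)]
        exact not_lt.1 hz
    have h2 := hadd gs gb z hgsm hgbm
    rw [hsum] at h2
    have : h z ≤ ENNReal.ofReal s := by
      calc h z ≤ I g z + ENNReal.ofReal (s / 2) := hsplit z
        _ ≤ (ENNReal.ofReal (s / 4) + ENNReal.ofReal (s / 4)) + ENNReal.ofReal (s / 2) := by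
          gcongr
          exact h2.trans (add_le_add h1 hcon.le)
        _ = ENNReal.ofReal s := by
          rw [← ENNReal.ofReal_add (by positivity) (by positivity),
            ← ENNReal.ofReal_add (by positivity) (by positivity)]
          congr 1; ring
    exact absurd hz (not_lt.2 this)
  have h3 := mul_meas_ge_le_lintegral (μ := μ) (hIm gb hgbm) (ENNReal.ofReal (s / 4))
  have h4 : ENNReal.ofReal (4 * c / s) = (ENNReal.ofReal (s / 4))⁻¹ * ENNReal.ofReal c := by
    rw [← ENNReal.ofReal_inv_of_pos (by positivity), ← ENNReal.ofReal_mul (by positivity)]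
    congr 1; field_simp
  have hne : ENNReal.ofReal (s / 4) ≠ 0 := by simpa using hs
  calc _ ≤ μ {z | ENNReal.ofReal (s / 4) ≤ I gb z} := measure_mono hsub
    _ = (ENNReal.ofReal (s / 4))⁻¹ * (ENNReal.ofReal (s / 4) *
        μ {z | ENNReal.ofReal (s / 4) ≤ I gb z}) := by
      rw [← mul_assoc, ENNReal.inv_mul_cancel hne ENNReal.ofReal_ne_top, one_mul]
    _ ≤ (ENNReal.ofReal (s / 4))⁻¹ * (ENNReal.ofReal c * ∫⁻ z, gb z ∂μ) := by
      gcongr (ENNReal.ofReal (s / 4))⁻¹ * ?_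
      exact h3.trans (hL1 _ hgbm)
    _ = _ := by rw [h4, mul_assoc]

/-- Hardy–Littlewood–Sobolev inequality for an operator with values `h` which splits, at each
scale `ε`, into a part `I ε` of norm `≤ C ε ^ α` on `L^1` and `L^∞`, and a remainder which is
pointwise at most `C ε ^ (-1 / Q)` times the `L^P` norm. -/
theorem lintegral_rpow_le_of_split {P Q α C : ℝ} (hP : 1 < P) (hPQ : P < Q)
    (hα : α = 1 / P - 1 / Q) (hC : 0 < C) :
    ∃ K : ℝ, 0 < K ∧ ∀ {Z : Type} [MeasurableSpace Z] (μ : Measure Z) [SFinite μ]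
      (h g : Z → ENNReal) (_ : Measurable h) (_ : Measurable g) (N : ℝ) (_ : 0 < N)
      (_ : ∫⁻ z, g z ^ P ∂μ ≤ ENNReal.ofReal (N ^ P))
      (I : ℝ → (Z → ENNReal) → Z → ENNReal)
      (_ : ∀ ε, 0 < ε → ∀ z, h z ≤ I ε g z + ENNReal.ofReal (C * ε ^ (-(1 / Q)) * N))
      (_ : ∀ ε, 0 < ε → ∀ g, Measurable g → Measurable (I ε g))
      (_ : ∀ ε, 0 < ε → ∀ g₁ g₂ z, Measurable g₁ → Measurable g₂ →
        I ε (g₁ + g₂) z ≤ I ε g₁ z + I ε g₂ z)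
      (_ : ∀ ε, 0 < ε → ∀ G, 0 < G → ∀ g z, (∀ z, g z ≤ ENNReal.ofReal G) →
        I ε g z ≤ ENNReal.ofReal (G * (C * ε ^ α)))
      (_ : ∀ ε, 0 < ε → ∀ g, Measurable g →
        ∫⁻ z, I ε g z ∂μ ≤ ENNReal.ofReal (C * ε ^ α) * ∫⁻ z, g z ∂μ),
      ∫⁻ z, h z ^ Q ∂μ ≤ ENNReal.ofReal (K * N ^ Q) := by
  have hP0 : 0 < P := by linarith
  have hQ0 : 0 < Q := by linarith
  have hαQ : α * Q = Q / P - 1 := by rw [hα]; field_simp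
  -- The layer-cake weight `s ^ (Q - 1)` times the level set factor `s ^ (-α Q - 1)` is `s ^ (e -
  -- 1)`. The identity `P / Q * e = P - 1` is what finally produces `g ^ P`.
  set e : ℝ := Q - 1 - α * Q with he
  have heq : e = Q / P * (P - 1) := by rw [he, hαQ]; field_simp; ring
  have he0 : 0 < e := by rw [heq]; have : 0 < P - 1 := by linarith
                         positivity
  refine ⟨Q * (4 * C * (2 * C) ^ (α * Q)) * ((2 * C) ^ (α * Q) * (4 * C)) ^ (P - 1) / e,
    by positivity, ?_⟩
  intro Z _ μ _ h g hh hg N hN hgN I hsplit hIm hadd hbdd hL1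
  -- Makes `κ * s ^ (Q / P)` the height at which `g` must be cut for its lower part to contribute
  -- exactly `s / 4`.
  set κ : ℝ := ((2 * C * N) ^ (α * Q) * (4 * C))⁻¹ with hκ
  have hκ0 : 0 < κ := by positivity
  have hlevel : ∀ s : ℝ, 0 < s → μ {z | ENNReal.ofReal s < h z} ≤
      ENNReal.ofReal (4 * C * (2 * C * N) ^ (α * Q) * s ^ (-(α * Q) - 1)) *
      ∫⁻ z, {z | ENNReal.ofReal (κ * s ^ (Q / P)) < g z}.indicator g z ∂μ := by
    intro s hs
    -- The scale depends on the level: it makes the remainder equal to `s / 2`.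
    set ε : ℝ := (2 * C * N / s) ^ Q with hε
    have hε0 : 0 < ε := by positivity
    have h1 : C * ε ^ (-(1 / Q)) * N = s / 2 := by
      rw [hε, ← Real.rpow_mul (by positivity)]
      have : Q * -(1 / Q) = -1 := by field_simp
      rw [this, Real.rpow_neg_one]
      field_simp
    have h2 : ε ^ α = (2 * C * N) ^ (α * Q) * s ^ (-(α * Q)) := by
      rw [hε, ← Real.rpow_mul (by positivity), Real.div_rpow (by positivity) hs.le, mul_comm Q,
        Real.rpow_neg hs.le]
      rfl
    have h3 : κ * s ^ (Q / P) * (C * ε ^ α) = s / 4 := by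
      have : Q / P = 1 + α * Q := by rw [hαQ]; ring
      rw [h2, this, Real.rpow_add hs, Real.rpow_one, hκ, Real.rpow_neg hs.le]
      field_simp
    have := meas_lt_le_of_split (μ := μ) hg hs (G := κ * s ^ (Q / P)) (c := C * ε ^ α)
      h3 (by simpa only [h1] using hsplit ε hε0) (hIm ε hε0) (hadd ε hε0)
      (hbdd ε hε0 _ (by positivity)) (hL1 ε hε0)
    refine this.trans (le_of_eq ?_)
    congr 2
    rw [h2, Real.rpow_sub hs, Real.rpow_one]
    ring
  have hm : Measurable (Function.uncurry fun (s : ℝ) (z : Z) =>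
      ENNReal.ofReal (s ^ (e - 1)) *
        {z | ENNReal.ofReal (κ * s ^ (Q / P)) < g z}.indicator g z) := by
    refine Measurable.mul (by fun_prop) ?_
    exact (Measurable.indicator (by fun_prop : Measurable fun a : ℝ × Z => g a.2)
      (measurableSet_lt (by fun_prop) (by fun_prop) :
        MeasurableSet {a : ℝ × Z | ENNReal.ofReal (κ * a.1 ^ (Q / P)) < g a.2}))
  -- After Tonelli, only levels `s` with `κ s ^ (Q / P) < g z` contribute at `z`. They form an
  -- interval ending at `(g z / κ) ^ (P / Q)`, so the one-point formula applies with exponent `e`.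
  have hinner : ∀ z, ∫⁻ s in Set.Ioi (0 : ℝ), ENNReal.ofReal (s ^ (e - 1)) *
        {z | ENNReal.ofReal (κ * s ^ (Q / P)) < g z}.indicator g z ≤
      ENNReal.ofReal (κ⁻¹ ^ (P - 1) / e) * g z ^ P := by
    intro z
    have h1 : ∀ s ∈ Set.Ioi (0 : ℝ), ENNReal.ofReal (s ^ (e - 1)) *
        {z | ENNReal.ofReal (κ * s ^ (Q / P)) < g z}.indicator g z =
        g z * {s : ℝ | ENNReal.ofReal s < (ENNReal.ofReal κ⁻¹ * g z) ^ (P / Q)}.indicator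
          (fun s => ENNReal.ofReal (s ^ (e - 1))) s := by
      intro s hs
      have hs : 0 < s := hs
      have : ENNReal.ofReal (κ * s ^ (Q / P)) < g z ↔
          ENNReal.ofReal s < (ENNReal.ofReal κ⁻¹ * g z) ^ (P / Q) := by
        have hQP : (0 : ℝ) < Q / P := by positivity
        have hid : ((ENNReal.ofReal κ⁻¹ * g z) ^ (P / Q)) ^ (Q / P) =
            ENNReal.ofReal κ⁻¹ * g z := by
          rw [← ENNReal.rpow_mul]
          have : P / Q * (Q / P) = 1 := by field_simp
          rw [this, ENNReal.rpow_one]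
        rw [← ENNReal.rpow_lt_rpow_iff hQP (x := ENNReal.ofReal s), hid, ENNReal.ofReal_rpow_of_pos hs,
          ENNReal.ofReal_mul hκ0.le, ENNReal.ofReal_inv_of_pos hκ0]
        rw [mul_comm _ (g z), ← div_eq_mul_inv,
          ENNReal.lt_div_iff_mul_lt (Or.inl (by simpa using hκ0)) (Or.inl ENNReal.ofReal_ne_top),
          mul_comm]
      by_cases hc : ENNReal.ofReal (κ * s ^ (Q / P)) < g z
      · rw [Set.indicator_of_mem (by exact hc), Set.indicator_of_mem (by exact this.1 hc), mul_comm]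
      · rw [Set.indicator_of_notMem (by exact hc),
          Set.indicator_of_notMem (by exact fun h => hc (this.2 h)), mul_zero, mul_zero]
    rw [setLIntegral_congr_fun measurableSet_Ioi h1, lintegral_const_mul _ (by
        refine Measurable.indicator (by fun_prop) ?_
        exact measurableSet_lt (by fun_prop) measurable_const),
      lintegral_Ioi_indicator_rpow _ he0, ← ENNReal.rpow_mul]
    have hexp : P / Q * e = P - 1 := by rw [heq]; field_simp
    rw [hexp, ENNReal.mul_rpow_of_nonneg _ _ (by linarith), ENNReal.ofReal_rpow_of_pos
      (by positivity), ENNReal.ofReal_div_of_pos he0]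
    have : g z ^ P = g z * g z ^ (P - 1) := by
      have := ENNReal.rpow_add_of_nonneg (x := g z) 1 (P - 1) zero_le_one (by linarith)
      rwa [ENNReal.rpow_one, add_sub_cancel] at this
    rw [this]
    simp only [div_eq_mul_inv]
    refine le_of_eq ?_
    ring
  rw [lintegral_rpow_eq_lintegral_lt hh hQ0]
  set A : ℝ := 4 * C * (2 * C * N) ^ (α * Q) with hA
  have hA0 : 0 < A := by positivity
  calc _ ≤ ENNReal.ofReal Q * ∫⁻ s in Set.Ioi (0 : ℝ), ENNReal.ofReal A *
        ∫⁻ z, ENNReal.ofReal (s ^ (e - 1)) *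
        {z | ENNReal.ofReal (κ * s ^ (Q / P)) < g z}.indicator g z ∂μ := by
        gcongr ENNReal.ofReal Q * ?_
        refine setLIntegral_mono' measurableSet_Ioi fun s hs => ?_
        have hs : 0 < s := hs
        have hgi : Measurable ({z | ENNReal.ofReal (κ * s ^ (Q / P)) < g z}.indicator g) :=
          hg.indicator (measurableSet_lt measurable_const hg)
        refine (mul_le_mul_right (hlevel s hs) _).trans (le_of_eq ?_)
        rw [lintegral_const_mul _ hgi, ← mul_assoc, ← mul_assoc,
          ← ENNReal.ofReal_mul (by positivity), ← ENNReal.ofReal_mul (by positivity)]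
        congr 2
        have : e - 1 = (Q - 1) + (-(α * Q) - 1) := by rw [he]; ring
        rw [this, Real.rpow_add hs]
        ring
    _ = ENNReal.ofReal Q * (ENNReal.ofReal A * ∫⁻ z, (∫⁻ s in Set.Ioi (0 : ℝ),
        ENNReal.ofReal (s ^ (e - 1)) *
        {z | ENNReal.ofReal (κ * s ^ (Q / P)) < g z}.indicator g z) ∂μ) := by
        rw [lintegral_const_mul _ (by exact hm.lintegral_prod_right'), lintegral_lintegral_swap hm.aemeasurable]
    _ ≤ ENNReal.ofReal Q * (ENNReal.ofReal A *
        (ENNReal.ofReal (κ⁻¹ ^ (P - 1) / e) * ENNReal.ofReal (N ^ P))) := by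
        gcongr
        refine (lintegral_mono hinner).trans ?_
        rw [lintegral_const_mul _ (by fun_prop)]
        gcongr
    _ = _ := by
        rw [← ENNReal.ofReal_mul (by positivity), ← ENNReal.ofReal_mul (by positivity),
          ← ENNReal.ofReal_mul (by positivity)]
        congr 1
        have h2 : (2 * C * N) ^ (α * Q) = (2 * C) ^ (α * Q) * N ^ (α * Q) :=
          Real.mul_rpow (by positivity) hN.le
        have h3 : κ⁻¹ = (2 * C) ^ (α * Q) * (4 * C) * N ^ (α * Q) := by
          rw [hκ, inv_inv, h2]; ring
        have h4 : N ^ Q = N ^ (α * Q) * (N ^ (α * Q)) ^ (P - 1) * N ^ P := by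
          rw [← Real.rpow_mul hN.le, ← Real.rpow_add hN, ← Real.rpow_add hN, hαQ]
          congr 1; field_simp; ring
        rw [h3, hA, h2, h4, Real.mul_rpow (x := (2 * C) ^ (α * Q) * (4 * C)) (y := N ^ (α * Q))
            (by positivity) (by positivity)]
        ring

/-! ### Kinetic displacements and their changes of variables -/

/-- The point reached from `z` going back by a time `s`, with the displacements `y` and
`u - (1 + κ) y` in position and velocity, at the scales `s ^ (1 + κ)` and `s ^ κ`. -/
noncomputable def kinShift {d : ℕ} (κ : ℝ) (z : Phase d) (s : ℝ) (a : Space d × Space d) :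
    Phase d :=
  (z.1 - s, z.2.1 - s • z.2.2 + s ^ (1 + κ) • a.1, z.2.2 + s ^ κ • (a.2 - (1 + κ) • a.1))

lemma measurable_kinShift {d : ℕ} (κ : ℝ) :
    Measurable fun b : Phase d × ℝ × Space d × Space d => kinShift κ b.1 b.2.1 b.2.2 := by
  unfold kinShift
  fun_prop

/-- With `s` and `a` fixed, the map translates `(t, x)` by an amount depending only on `v`, and `v`
by a constant, so it preserves Lebesgue measure. This gives the `L^1` bounds below and the
convergence of averages. -/
lemma lintegral_kinShift {d : ℕ} (κ s : ℝ) (a : Space d × Space d) {g : Phase d → ENNReal}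
    (hg : Measurable g) : ∫⁻ z, g (kinShift κ z s a) = ∫⁻ z, g z := by
  have hm : Measurable fun z : Phase d => g (kinShift κ z s a) :=
    hg.comp ((measurable_kinShift κ).comp (by fun_prop :
      Measurable fun z : Phase d => (z, s, a)))
  have h1 : ∀ g : Phase d → ENNReal, Measurable g →
      ∫⁻ z, g z = ∫⁻ v, ∫⁻ x, ∫⁻ t, g (t, x, v) := by
    intro g hg
    rw [Measure.volume_eq_prod, lintegral_prod_symm _ hg.aemeasurable, Measure.volume_eq_prod,
      lintegral_prod_symm _ (by exact (hg.lintegral_prod_left').aemeasurable)]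
  rw [h1 _ hm, h1 _ hg]
  simp only [kinShift]
  have h2 : ∀ v : Space d, ∫⁻ x : Space d, ∫⁻ t : ℝ,
      g (t - s, x - s • v + s ^ (1 + κ) • a.1, v + s ^ κ • (a.2 - (1 + κ) • a.1)) =
      ∫⁻ x : Space d, ∫⁻ t : ℝ, g (t, x, v + s ^ κ • (a.2 - (1 + κ) • a.1)) := by
    intro v
    have h3 : ∀ x : Space d, ∫⁻ t : ℝ,
      g (t - s, x - s • v + s ^ (1 + κ) • a.1, v + s ^ κ • (a.2 - (1 + κ) • a.1)) =
      ∫⁻ t : ℝ, g (t, x + (- s • v + s ^ (1 + κ) • a.1), v + s ^ κ • (a.2 - (1 + κ) • a.1)) := by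
      intro x
      rw [← lintegral_sub_right_eq_self (fun t : ℝ => g (t, _, _)) s]
      refine lintegral_congr fun t => ?_
      congr 3
      module
    simp_rw [h3]
    exact lintegral_add_right_eq_self
      (fun x => ∫⁻ t : ℝ, g (t, x, v + s ^ κ • (a.2 - (1 + κ) • a.1))) _
  simp_rw [h2]
  exact lintegral_add_right_eq_self (fun v => ∫⁻ x : Space d, ∫⁻ t : ℝ, g (t, x, v)) _

lemma lintegral_comp_add_smul {d : ℕ} (b : Space d) {c : ℝ} (hc : 0 < c) {g : Space d → ENNReal}
    (hg : Measurable g) :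
    ENNReal.ofReal (c ^ d) * ∫⁻ y, g (b + c • y) = ∫⁻ y, g y := by
  have h1 : ∫⁻ y, g y = ∫⁻ y, g (b + y) := (lintegral_add_left_eq_self g b).symm
  have h2 : ∫⁻ y, g (b + c • y) = ∫⁻ y, g (b + y) ∂(Measure.map (fun x : Space d => c • x) volume) := by
    rw [lintegral_map (by fun_prop) (by fun_prop)]
  rw [h2, Measure.map_addHaar_smul _ hc.ne', lintegral_smul_measure, h1, smul_eq_mul, ← mul_assoc,
    ← ENNReal.ofReal_mul (by positivity), finrank_euclideanSpace, Fintype.card_fin,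
    abs_of_pos (by positivity), mul_inv_cancel₀ (by positivity), ENNReal.ofReal_one, one_mul]

/-- At fixed `z` and `s` the displacement is triangular in `(y, u)`: the shear does not affect the
Jacobian, which is `s ^ (d (1 + κ))` from position times `s ^ (d κ)` from velocity. -/
lemma lintegral_slice_kinShift {d : ℕ} (κ : ℝ) (z : Phase d) {s : ℝ} (hs : 0 < s)
    {g : Phase d → ENNReal} (hg : Measurable g) :
    ENNReal.ofReal (s ^ ((d : ℝ) * (1 + 2 * κ))) * ∫⁻ a, g (kinShift κ z s a) =
      ∫⁻ b : Space d × Space d, g (z.1 - s, b) := by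
  have hm : Measurable fun a => g (kinShift κ z s a) :=
    hg.comp ((measurable_kinShift κ).comp (by fun_prop :
      Measurable fun a : Space d × Space d => (z, s, a)))
  rw [Measure.volume_eq_prod, lintegral_prod _ hm.aemeasurable,
    lintegral_prod _ (by fun_prop)]
  have h1 : ∀ y : Space d, ENNReal.ofReal ((s ^ κ) ^ d) *
      ∫⁻ u : Space d, g (kinShift κ z s (y, u)) =
      ∫⁻ w : Space d, g (z.1 - s, z.2.1 - s • z.2.2 + s ^ (1 + κ) • y, w) := by
    intro y
    rw [← lintegral_comp_add_smul (z.2.2 - s ^ κ • (1 + κ) • y) (c := s ^ κ) (by positivity)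
      (g := fun w => g (z.1 - s, z.2.1 - s • z.2.2 + s ^ (1 + κ) • y, w)) (by fun_prop)]
    congr 1
    refine lintegral_congr fun u => ?_
    simp only [kinShift]
    congr 3
    module
  have h2 : ENNReal.ofReal (s ^ ((d : ℝ) * (1 + 2 * κ))) =
      ENNReal.ofReal ((s ^ (1 + κ)) ^ d) * ENNReal.ofReal ((s ^ κ) ^ d) := by
    rw [← ENNReal.ofReal_mul (by positivity), ← mul_pow, ← Real.rpow_add hs, ← Real.rpow_natCast,
      ← Real.rpow_mul hs.le]
    congr 2; ring
  rw [h2, mul_assoc, ← lintegral_const_mul _ (by exact hm.lintegral_prod_right')]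
  simp_rw [h1]
  exact lintegral_comp_add_smul (z.2.1 - s • z.2.2) (c := s ^ (1 + κ)) (by positivity)
    (g := fun x => ∫⁻ w : Space d, g (z.1 - s, x, w)) (by fun_prop)

/-- Change of variables from a point in the past of `z` to its displacement from `z`. -/
lemma lintegral_past_eq {d : ℕ} (κ : ℝ) (z : Phase d) {g : Phase d → ENNReal}
    (hg : Measurable g) :
    ∫⁻ z' in {z' : Phase d | z'.1 < z.1}, g z' = ∫⁻ s in Set.Ioi (0 : ℝ),
      ENNReal.ofReal (s ^ ((d : ℝ) * (1 + 2 * κ))) * ∫⁻ a, g (kinShift κ z s a) := by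
  rw [setLIntegral_congr_fun measurableSet_Ioi
    (fun s hs => lintegral_slice_kinShift κ z (Set.mem_Ioi.1 hs) hg)]
  have hset : {z' : Phase d | z'.1 < z.1} = Set.Iio z.1 ×ˢ Set.univ := by
    ext; simp
  rw [hset, Measure.volume_eq_prod, ← Measure.prod_restrict, Measure.restrict_univ,
    lintegral_prod _ (by fun_prop)]
  have h3 := lintegral_sub_left_eq_self (μ := (volume : Measure ℝ))
    ((Set.Iio z.1).indicator fun t => ∫⁻ b : Space d × Space d, g (t, b)) z.1
  rw [lintegral_indicator measurableSet_Iio] at h3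
  rw [← h3, ← lintegral_indicator measurableSet_Ioi]
  refine lintegral_congr fun s => ?_
  simp [Set.indicator]

/-! ### Kinetic fractional integration from `L^P` to `L^Q` -/

/-- Fractional integration along the rescaled displacements of `kinShift`. -/
noncomputable def fracOp {d : ℕ} (κ β : ℝ) (w : Space d × Space d → ENNReal)
    (g : Phase d → ENNReal) (S : Set ℝ) (z : Phase d) : ENNReal :=
  ∫⁻ s in S, ENNReal.ofReal (s ^ (β - 1)) * ∫⁻ a, g (kinShift κ z s a) * w a

section fracOp
variable {d : ℕ} {κ β : ℝ} {w : Space d × Space d → ENNReal} {g : Phase d → ENNReal} {S : Set ℝ}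

lemma measurable_fracOp_aux (hw : Measurable w) (hg : Measurable g) :
    Measurable fun b : (Phase d × ℝ) × Space d × Space d =>
      g (kinShift κ b.1.1 b.1.2 b.2) * w b.2 :=
  (hg.comp ((measurable_kinShift κ).comp (by fun_prop :
    Measurable fun b : (Phase d × ℝ) × Space d × Space d => (b.1.1, b.1.2, b.2)))).mul (by fun_prop)

lemma measurable_fracOp_aux' (hw : Measurable w) (hg : Measurable g) :
    Measurable fun b : Phase d × ℝ => ENNReal.ofReal (b.2 ^ (β - 1)) *
      ∫⁻ a, g (kinShift κ b.1 b.2 a) * w a :=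
  (by fun_prop : Measurable fun b : Phase d × ℝ => ENNReal.ofReal (b.2 ^ (β - 1))).mul
    (measurable_fracOp_aux hw hg).lintegral_prod_right'

lemma measurable_fracOp (hw : Measurable w) (hg : Measurable g) :
    Measurable (fracOp κ β w g S) :=
  (measurable_fracOp_aux' hw hg).lintegral_prod_right'

lemma fracOp_add_le (hw : Measurable w) {g₁ g₂ : Phase d → ENNReal} (hg₁ : Measurable g₁)
    (z : Phase d) :
    fracOp κ β w (g₁ + g₂) S z ≤ fracOp κ β w g₁ S z + fracOp κ β w g₂ S z := by
  unfold fracOp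
  rw [← lintegral_add_left (by
    exact (measurable_fracOp_aux' hw hg₁).comp (measurable_const.prodMk measurable_id))]
  refine lintegral_mono fun s => ?_
  rw [← mul_add, ← lintegral_add_left (by
    exact (measurable_fracOp_aux hw hg₁).comp
      (by fun_prop : Measurable fun a : Space d × Space d => ((z, s), a)))]
  simp [add_mul]

lemma lintegral_Ioc_rpow {ρ : ℝ} (hρ : 0 < ρ) (hβ : 0 < β) :
    ∫⁻ s in Set.Ioc 0 ρ, ENNReal.ofReal (s ^ (β - 1)) = ENNReal.ofReal (ρ ^ β / β) := by
  rw [← setLIntegral_congr Ioo_ae_eq_Ioc, lintegral_Ioo_rpow hρ hβ]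

lemma fracOp_Ioc_le_of_le {W G ρ : ℝ} (hW : ∫⁻ a, w a ≤ ENNReal.ofReal W) (hw : Measurable w)
    (hG : 0 ≤ G) (hβ : 0 < β) (hρ : 0 < ρ) (hgG : ∀ z, g z ≤ ENNReal.ofReal G) (z : Phase d) :
    fracOp κ β w g (Set.Ioc 0 ρ) z ≤ ENNReal.ofReal (G * (W / β * ρ ^ β)) := by
  unfold fracOp
  calc _ ≤ ∫⁻ s in Set.Ioc 0 ρ, ENNReal.ofReal (s ^ (β - 1)) *
        (ENNReal.ofReal G * ENNReal.ofReal W) := by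
        refine lintegral_mono fun s => ?_
        gcongr
        calc _ ≤ ∫⁻ a, ENNReal.ofReal G * w a := by
              refine lintegral_mono fun a => ?_
              gcongr
              exact hgG _
          _ ≤ _ := by rw [lintegral_const_mul _ hw]; gcongr
    _ = _ := by
      rw [lintegral_mul_const _ (by fun_prop), lintegral_Ioc_rpow hρ hβ,
        ← ENNReal.ofReal_mul hG, ← ENNReal.ofReal_mul (by positivity)]
      congr 1; field_simp

/-- The near part is a superposition of measure-preserving displacements, so its `L^1` norm is at
most the total weight `W ∫_0^ρ s ^ (β - 1) ds`. The same constant serves on `L^∞` in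
`fracOp_Ioc_le_of_le`. -/
lemma lintegral_fracOp_Ioc_le {W ρ : ℝ} (hW : ∫⁻ a, w a ≤ ENNReal.ofReal W) (hw : Measurable w)
    (hβ : 0 < β) (hρ : 0 < ρ) (hg : Measurable g) :
    ∫⁻ z, fracOp κ β w g (Set.Ioc 0 ρ) z ≤ ENNReal.ofReal (W / β * ρ ^ β) * ∫⁻ z, g z := by
  unfold fracOp
  rw [lintegral_lintegral_swap (measurable_fracOp_aux' hw hg).aemeasurable]
  have h1 : ∀ s : ℝ, ∫⁻ z, ENNReal.ofReal (s ^ (β - 1)) * ∫⁻ a, g (kinShift κ z s a) * w a ≤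
      ENNReal.ofReal (s ^ (β - 1)) * (ENNReal.ofReal W * ∫⁻ z, g z) := by
    intro s
    have hms : Measurable fun b : Phase d × Space d × Space d =>
        g (kinShift κ b.1 s b.2) * w b.2 :=
      (measurable_fracOp_aux hw hg).comp
        (by fun_prop : Measurable fun b : Phase d × Space d × Space d => ((b.1, s), b.2))
    rw [lintegral_const_mul _ (by exact hms.lintegral_prod_right'),
      lintegral_lintegral_swap hms.aemeasurable]
    gcongr
    calc _ = ∫⁻ a, (∫⁻ z, g z) * w a := by
          refine lintegral_congr fun a => ?_
          rw [lintegral_mul_const _ (by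
            exact hg.comp ((measurable_kinShift κ).comp (by fun_prop :
              Measurable fun z : Phase d => (z, s, a)))), lintegral_kinShift κ s a hg]
      _ ≤ _ := by rw [lintegral_const_mul _ hw, mul_comm]; gcongr
  calc _ ≤ ∫⁻ s in Set.Ioc 0 ρ, ENNReal.ofReal (s ^ (β - 1)) * (ENNReal.ofReal W * ∫⁻ z, g z) :=
        lintegral_mono h1
    _ = _ := by
      rw [lintegral_mul_const _ (by fun_prop), lintegral_Ioc_rpow hρ hβ, ← mul_assoc,
        ← ENNReal.ofReal_mul (by positivity)]
      congr 2; field_simp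

lemma lintegral_Ioi_rpow_neg {e ρ : ℝ} (he : 0 < e) (hρ : 0 < ρ) :
    ∫⁻ s in Set.Ioi ρ, ENNReal.ofReal (s ^ (-e - 1)) = ENNReal.ofReal (ρ ^ (-e) / e) := by
  rw [← ofReal_integral_eq_lintegral_ofReal (integrableOn_Ioi_rpow_of_lt (by linarith) hρ),
    integral_Ioi_rpow_of_lt (by linarith) hρ]
  · congr 1
    rw [sub_add_cancel, neg_div_neg_eq]
  · filter_upwards [ae_restrict_mem measurableSet_Ioi] with s hs
    exact Real.rpow_nonneg (hρ.trans hs).le _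

/-- The factor `s ^ (D' / P)` is the `P`-th root of the Jacobian: with it the left side is an
integral of `g ^ P` over part of the past of `z`. -/
lemma lintegral_Ioi_kinShift_rpow_le {P D' ρ : ℝ} (hP0 : 0 < P) (hD' : D' = d * (1 + 2 * κ))
    (hg : Measurable g) (hρ : 0 < ρ) (z : Phase d) :
    ∫⁻ b, (g (kinShift κ z b.1 b.2) * ENNReal.ofReal (b.1 ^ (D' / P))) ^ P
      ∂(((volume : Measure ℝ).restrict (Set.Ioi ρ)).prod (volume : Measure (Space d × Space d))) ≤
      ∫⁻ z, g z ^ P := by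
  have hgk : Measurable fun b : ℝ × Space d × Space d => g (kinShift κ z b.1 b.2) :=
    hg.comp ((measurable_kinShift κ).comp (by fun_prop :
      Measurable fun b : ℝ × Space d × Space d => (z, b)))
  have hFm : Measurable fun b : ℝ × Space d × Space d =>
      g (kinShift κ z b.1 b.2) * ENNReal.ofReal (b.1 ^ (D' / P)) := hgk.mul (by fun_prop)
  rw [lintegral_prod _ (hFm.pow_const P).aemeasurable]
  calc _ = ∫⁻ s in Set.Ioi ρ, ENNReal.ofReal (s ^ D') * ∫⁻ a, g (kinShift κ z s a) ^ P := by
        refine setLIntegral_congr_fun measurableSet_Ioi fun s hs => ?_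
        have hs : 0 < s := hρ.trans hs
        rw [← lintegral_const_mul _ (by
          exact (hgk.comp (by fun_prop : Measurable fun a : Space d × Space d =>
            (s, a))).pow_const P)]
        refine lintegral_congr fun a => ?_
        rw [ENNReal.mul_rpow_of_nonneg _ _ hP0.le, ENNReal.ofReal_rpow_of_pos (by positivity),
          ← Real.rpow_mul hs.le, div_mul_cancel₀ _ hP0.ne', mul_comm]
    _ ≤ ∫⁻ s in Set.Ioi 0, ENNReal.ofReal (s ^ D') * ∫⁻ a, g (kinShift κ z s a) ^ P :=
        lintegral_mono_set (Set.Ioi_subset_Ioi hρ.le)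
    _ = ∫⁻ z' in {z' : Phase d | z'.1 < z.1}, g z' ^ P := by
        rw [hD']
        exact (lintegral_past_eq κ z (g := fun z' => g z' ^ P) (hg.pow_const P)).symm
    _ ≤ _ := setLIntegral_le_lintegral _ _

lemma lintegral_Ioi_weight_rpow_le {P' W γ e ρ : ℝ} (hP'0 : 0 < P') (he : 0 < e)
    (hγ : γ * P' = -e - 1) (hW : ∫⁻ a, w a ^ P' ≤ ENNReal.ofReal W) (hw : Measurable w)
    (hρ : 0 < ρ) :
    ∫⁻ b, (ENNReal.ofReal (b.1 ^ γ) * w b.2) ^ P'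
      ∂(((volume : Measure ℝ).restrict (Set.Ioi ρ)).prod (volume : Measure (Space d × Space d))) ≤
      ENNReal.ofReal (W / e * ρ ^ (-e)) := by
  rw [lintegral_prod _ (((by fun_prop : Measurable fun b : ℝ × Space d × Space d =>
    ENNReal.ofReal (b.1 ^ γ) * w b.2)).pow_const P').aemeasurable]
  calc _ = ∫⁻ s in Set.Ioi ρ, ENNReal.ofReal (s ^ (-e - 1)) * ∫⁻ a, w a ^ P' := by
        refine setLIntegral_congr_fun measurableSet_Ioi fun s hs => ?_
        have hs : 0 < s := hρ.trans hs
        rw [← lintegral_const_mul _ (hw.pow_const P')]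
        refine lintegral_congr fun a => ?_
        rw [ENNReal.mul_rpow_of_nonneg _ _ hP'0.le, ENNReal.ofReal_rpow_of_pos (by positivity),
          ← Real.rpow_mul hs.le, hγ]
    _ = ENNReal.ofReal (ρ ^ (-e) / e) * ∫⁻ a, w a ^ P' := by
        rw [lintegral_mul_const _ (by fun_prop), lintegral_Ioi_rpow_neg he hρ]
    _ ≤ ENNReal.ofReal (ρ ^ (-e) / e) * ENNReal.ofReal W := by gcongr
    _ = _ := by
        rw [← ENNReal.ofReal_mul (by positivity)]
        congr 1; field_simp

/-- Hölder in `(s, a)`: the Jacobian root is attached to `g`, and its inverse to the weight. The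
relation between `P`, `Q`, `β` and `D` makes the leftover power of `s` integrable at infinity. -/
lemma fracOp_Ioi_le {P Q P' D W N ρ : ℝ} (hPP : P.HolderConjugate P')
    (hQ : 0 < Q) (hD : D = 1 + d * (1 + 2 * κ)) (hD0 : 0 < D) (hPQ : 1 / P - 1 / Q = β / D)
    (hW : ∫⁻ a, w a ^ P' ≤ ENNReal.ofReal W) (hW0 : 0 ≤ W) (hw : Measurable w) (hg : Measurable g)
    (hN : 0 ≤ N) (hgN : ∫⁻ z, g z ^ P ≤ ENNReal.ofReal (N ^ P)) (hρ : 0 < ρ) (z : Phase d) :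
    fracOp κ β w g (Set.Ioi ρ) z ≤
      ENNReal.ofReal ((W / (D / Q * P')) ^ (1 / P') * ρ ^ (-(D / Q)) * N) := by
  have hP0 := hPP.pos
  have hP'0 := hPP.symm.pos
  obtain ⟨D', hD'⟩ : ∃ D' : ℝ, D' = d * (1 + 2 * κ) := ⟨_, rfl⟩
  set F : ℝ × Space d × Space d → ENNReal := fun b =>
    g (kinShift κ z b.1 b.2) * ENNReal.ofReal (b.1 ^ (D' / P)) with hF
  set H : ℝ × Space d × Space d → ENNReal := fun b =>
    ENNReal.ofReal (b.1 ^ (β - 1 - D' / P)) * w b.2 with hH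
  have hgk : Measurable fun b : ℝ × Space d × Space d => g (kinShift κ z b.1 b.2) :=
    hg.comp ((measurable_kinShift κ).comp (by fun_prop :
      Measurable fun b : ℝ × Space d × Space d => (z, b)))
  have hFm : Measurable F := hgk.mul (by fun_prop)
  have hHm : Measurable H := by fun_prop
  set ν : Measure (ℝ × Space d × Space d) :=
    ((volume : Measure ℝ).restrict (Set.Ioi ρ)).prod (volume : Measure (Space d × Space d)) with hν
  have h1 : fracOp κ β w g (Set.Ioi ρ) z = ∫⁻ b, (F * H) b ∂ν := by
    unfold fracOp
    rw [hν, lintegral_prod _ (hFm.mul hHm).aemeasurable]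
    refine setLIntegral_congr_fun measurableSet_Ioi fun s hs => ?_
    have hs : 0 < s := hρ.trans hs
    rw [← lintegral_const_mul _ (by
      exact (hgk.comp (by fun_prop : Measurable fun a : Space d × Space d => (s, a))).mul hw)]
    refine lintegral_congr fun a => ?_
    simp only [hF, hH, Pi.mul_apply]
    have : ENNReal.ofReal (s ^ (β - 1)) = ENNReal.ofReal (s ^ (D' / P)) *
        ENNReal.ofReal (s ^ (β - 1 - D' / P)) := by
      rw [← ENNReal.ofReal_mul (by positivity), ← Real.rpow_add hs]
      congr 2; ring
    rw [this]; ring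
  have h2 : ∫⁻ b, F b ^ P ∂ν ≤ ENNReal.ofReal (N ^ P) :=
    (lintegral_Ioi_kinShift_rpow_le hP0 hD' hg hρ z).trans hgN
  have hDQ : 0 < D / Q * P' := by positivity
  -- Substituting `β = D / P - D / Q` and `D' = D - 1` leaves `(-D / Q - (1 - 1 / P)) P'`, and `(1 -
  -- 1 / P) P' = 1`.
  have hexp : (β - 1 - D' / P) * P' = -(D / Q * P') - 1 := by
    have hβ : β = D / P - D / Q := by
      have := hPQ.symm
      rw [div_eq_iff hD0.ne'] at this
      rw [this]; ring
    have h4 : D' = D - 1 := by rw [hD, hD']; ring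
    have h5 : P' = P / (P - 1) := hPP.conjugate_eq
    have h6 : P - 1 ≠ 0 := hPP.sub_one_ne_zero
    rw [hβ, h4, h5]
    field_simp
    ring
  have h3 : ∫⁻ b, H b ^ P' ∂ν ≤ ENNReal.ofReal (W / (D / Q * P') * ρ ^ (-(D / Q * P'))) :=
    lintegral_Ioi_weight_rpow_le hP'0 hDQ hexp hW hw hρ
  rw [h1]
  refine (ENNReal.lintegral_mul_le_Lp_mul_Lq ν hPP hFm.aemeasurable hHm.aemeasurable).trans ?_
  calc _ ≤ ENNReal.ofReal (N ^ P) ^ (1 / P) *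
        ENNReal.ofReal (W / (D / Q * P') * ρ ^ (-(D / Q * P'))) ^ (1 / P') := by gcongr
    _ = _ := by
      rw [ENNReal.ofReal_rpow_of_nonneg (by positivity) (by positivity),
        ENNReal.ofReal_rpow_of_nonneg (by positivity) (by positivity),
        ← ENNReal.ofReal_mul (by positivity), Real.mul_rpow (by positivity) (by positivity),
        ← Real.rpow_mul hN, ← Real.rpow_mul hρ.le]
      congr 1
      have e1 : P * (1 / P) = 1 := by field_simp
      have e2 : -(D / Q * P') * (1 / P') = -(D / Q) := by field_simp
      rw [e1, e2, Real.rpow_one]; ring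

/-- Kinetic fractional integration maps `L^P` to `L^Q`. -/
theorem exists_lintegral_fracOp_le {P Q P' D : ℝ} (hPP : P.HolderConjugate P') (hPQ' : P < Q)
    (hD : D = 1 + d * (1 + 2 * κ)) (hD0 : 0 < D) (hβ : 0 < β) (hPQ : 1 / P - 1 / Q = β / D)
    (hw : Measurable w) (hw1 : ∫⁻ a, w a ≠ ⊤) (hw2 : ∫⁻ a, w a ^ P' ≠ ⊤) :
    ∃ K : ℝ, 0 < K ∧ ∀ g : Phase d → ENNReal, Measurable g → ∀ N : ℝ, 0 < N →
      ∫⁻ z, g z ^ P ≤ ENNReal.ofReal (N ^ P) →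
      ∫⁻ z, fracOp κ β w g (Set.Ioi 0) z ^ Q ≤ ENNReal.ofReal (K * N ^ Q) := by
  have hQ0 : 0 < Q := hPP.pos.trans hPQ'
  have hP'0 := hPP.symm.pos
  set W₁ := (∫⁻ a, w a).toReal with hW₁
  set W₂ := (∫⁻ a, w a ^ P').toReal with hW₂
  have h1 : ∫⁻ a, w a ≤ ENNReal.ofReal W₁ := (ENNReal.ofReal_toReal hw1).ge
  have h2 : ∫⁻ a, w a ^ P' ≤ ENNReal.ofReal W₂ := (ENNReal.ofReal_toReal hw2).ge
  have hW₁0 : 0 ≤ W₁ := ENNReal.toReal_nonneg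
  have hW₂0 : 0 ≤ W₂ := ENNReal.toReal_nonneg
  set C : ℝ := W₁ / β + (W₂ / (D / Q * P')) ^ (1 / P') + 1 with hC
  have hC1 : W₁ / β ≤ C := by
    have : 0 ≤ (W₂ / (D / Q * P')) ^ (1 / P') := by positivity
    linarith
  have hC2 : (W₂ / (D / Q * P')) ^ (1 / P') ≤ C := by
    have : 0 ≤ W₁ / β := by positivity
    linarith
  have hC0 : 0 < C := by positivity
  obtain ⟨K, hK, h⟩ := lintegral_rpow_le_of_split hPP.lt hPQ' rfl hC0
  refine ⟨K, hK, fun g hg N hN hgN => ?_⟩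
  have hρ : ∀ ε : ℝ, 0 < ε → 0 < ε ^ (1 / D) := fun ε hε => by positivity
  have hα : ∀ ε : ℝ, 0 < ε → ε ^ (1 / P - 1 / Q) = (ε ^ (1 / D)) ^ β := by
    intro ε hε
    rw [← Real.rpow_mul hε.le, hPQ]
    congr 1; ring
  -- The abstract scale `ε` is a volume: splitting at time `ε ^ (1 / D)` turns the near bound `ρ ^
  -- β` into `ε ^ α` and the far bound `ρ ^ (-D / Q)` into `ε ^ (-1 / Q)`.
  refine h volume _ g (measurable_fracOp hw hg) hg N hN hgN
    (fun ε g => fracOp κ β w g (Set.Ioc 0 (ε ^ (1 / D)))) ?_ ?_ ?_ ?_ ?_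
  · intro ε hε z
    have h3 : Set.Ioi (0 : ℝ) = Set.Ioc 0 (ε ^ (1 / D)) ∪ Set.Ioi (ε ^ (1 / D)) :=
      (Set.Ioc_union_Ioi_eq_Ioi (hρ ε hε).le).symm
    have h4 : fracOp κ β w g (Set.Ioi 0) z ≤ fracOp κ β w g (Set.Ioc 0 (ε ^ (1 / D))) z +
        fracOp κ β w g (Set.Ioi (ε ^ (1 / D))) z := by
      rw [h3]
      exact lintegral_union_le _ _ _
    refine h4.trans (add_le_add le_rfl ((fracOp_Ioi_le hPP hQ0 hD hD0 hPQ h2 hW₂0 hw hg hN.le hgN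
      (hρ ε hε) z).trans (ENNReal.ofReal_le_ofReal ?_)))
    have h5 : (ε ^ (1 / D)) ^ (-(D / Q)) = ε ^ (-(1 / Q)) := by
      rw [← Real.rpow_mul hε.le]
      congr 1; field_simp
    rw [h5]
    gcongr
  · exact fun ε hε g hg => measurable_fracOp hw hg
  · exact fun ε hε g₁ g₂ z hg₁ _ => fracOp_add_le hw hg₁ z
  · intro ε hε G hG g z hgG
    refine (fracOp_Ioc_le_of_le h1 hw hG.le hβ (hρ ε hε) hgG z).trans
      (ENNReal.ofReal_le_ofReal ?_)
    rw [hα ε hε]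
    have := hρ ε hε
    gcongr
  · intro ε hε g hg
    refine (lintegral_fracOp_Ioc_le h1 hw hβ (hρ ε hε) hg).trans ?_
    rw [hα ε hε]
    have := hρ ε hε
    gcongr

end fracOp

/-! ### From bounds on averages to almost everywhere bounds -/

lemma tendsto_kinShift_zero {d : ℕ} {κ : ℝ} (hκ : 0 < κ) (z : Phase d) (σ : ℝ)
    (a : Space d × Space d) {ε : ℕ → ℝ} (hε : Filter.Tendsto ε Filter.atTop (nhds 0)) :
    Filter.Tendsto (fun n => kinShift κ z (ε n * σ) a) Filter.atTop (nhds z) := by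
  have h1 : Filter.Tendsto (fun n => ε n * σ) Filter.atTop (nhds 0) := by
    simpa using hε.mul_const σ
  have h2 : ∀ e : ℝ, 0 < e →
      Filter.Tendsto (fun n => (ε n * σ) ^ e) Filter.atTop (nhds 0) := by
    intro e he
    have := (Real.continuousAt_rpow_const 0 e (Or.inr he.le)).tendsto.comp h1
    rwa [Real.zero_rpow he.ne'] at this
  have hx : Filter.Tendsto (fun n => z.2.1 - (ε n * σ) • z.2.2 + (ε n * σ) ^ (1 + κ) • a.1)
      Filter.atTop (nhds z.2.1) := by
    have := (tendsto_const_nhds (x := z.2.1)).sub (h1.smul_const z.2.2)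
    simpa using this.add ((h2 (1 + κ) (by linarith)).smul_const a.1)
  have hv : Filter.Tendsto (fun n => z.2.2 + (ε n * σ) ^ κ • (a.2 - (1 + κ) • a.1))
      Filter.atTop (nhds z.2.2) := by
    simpa using (tendsto_const_nhds (x := z.2.2)).add
      ((h2 κ hκ).smul_const (a.2 - (1 + κ) • a.1))
  have ht : Filter.Tendsto (fun n => z.1 - ε n * σ) Filter.atTop (nhds z.1) := by
    simpa using (tendsto_const_nhds (x := z.1)).sub h1
  exact ht.prodMk_nhds (hx.prodMk_nhds hv)

/-- If the averages of `|F|` over the rescaled displacements of `kinShift` are bounded by `H` at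
all scales, then so is `|F|`, up to the mass of the averaging measure. -/
theorem ae_enorm_le_of_average_le {d : ℕ} {κ : ℝ} (hκ : 0 < κ)
    (ν : Measure (ℝ × Space d × Space d)) [IsFiniteMeasure ν] {F : Phase d → ℝ}
    (hF : Measurable F) (hFi : Integrable F) {H : Phase d → ENNReal} (hH : Measurable H)
    {B : Set (Phase d)} (hB : MeasurableSet B) (hBfin : volume B ≠ ⊤)
    (hle : ∀ ε : ℝ, 0 < ε → ∀ z ∈ B, ∫⁻ b, ‖F (kinShift κ z (ε * b.1) b.2)‖ₑ ∂ν ≤ H z) :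
    ∀ᵐ z ∂(volume.restrict B), ν Set.univ * ‖F z‖ₑ ≤ H z := by
  set c := ν Set.univ with hc
  have hcfin : c ≠ ⊤ := measure_ne_top ν _
  have : IsFiniteMeasure (volume.restrict B) := ⟨by simpa using hBfin.lt_top⟩
  have hmk : ∀ ε : ℝ, Measurable fun b : Phase d × ℝ × Space d × Space d =>
      kinShift κ b.1 (ε * b.2.1) b.2.2 := fun ε =>
    (measurable_kinShift κ).comp (by fun_prop :
      Measurable fun b : Phase d × ℝ × Space d × Space d => (b.1, ε * b.2.1, b.2.2))
  have hmz : ∀ (ε : ℝ) (z : Phase d), Measurable fun b : ℝ × Space d × Space d =>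
      kinShift κ z (ε * b.1) b.2 := fun ε z => (hmk ε).comp (measurable_const.prodMk measurable_id)
  -- The truncated difference `c |F| - H` measures the failure of the claim, so it suffices that its
  -- integral vanishes. Replace `F` by a compactly supported continuous `g` within `δ` in `L^1`. The
  -- error costs `c δ` at the point and, displacements preserving measure, `c δ` after averaging.
  -- For `g` the averages converge by dominated convergence.
  have key : ∀ δ : ENNReal, δ ≠ 0 →
      ∫⁻ z in B, (c * ‖F z‖ₑ - H z) ≤ c * δ + c * δ := by
    intro δ hδ
    obtain ⟨g, hgc, hgd, hg, -⟩ := (memLp_one_iff_integrable.2 hFi).exists_hasCompactSupport_eLpNorm_sub_le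
      ENNReal.one_ne_top hδ
    rw [eLpNorm_one_eq_lintegral_enorm] at hgd
    have hgm : Measurable g := hg.measurable
    set ε : ℕ → ℝ := fun n => 1 / ((n : ℝ) + 1) with hε
    have hε0 : ∀ n, 0 < ε n := fun n => Nat.one_div_pos_of_nat
    have hεt : Filter.Tendsto ε Filter.atTop (nhds 0) := tendsto_one_div_add_atTop_nhds_zero_nat
    obtain ⟨Mg, hMg⟩ := hgc.exists_bound_of_continuous hg
    have hmid : Filter.Tendsto (fun n => ∫⁻ b, ‖g b.1 - g (kinShift κ b.1 (ε n * b.2.1) b.2.2)‖ₑ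
        ∂((volume.restrict B).prod ν)) Filter.atTop (nhds 0) := by
      have h0 : (0 : ENNReal) = ∫⁻ b : Phase d × ℝ × Space d × Space d, 0
        ∂((volume.restrict B).prod ν) := by simp
      rw [h0]
      refine tendsto_lintegral_of_dominated_convergence (fun _ => ENNReal.ofReal (Mg + Mg)) ?_ ?_
        ?_ ?_
      · exact fun n => ((hgm.comp measurable_fst).sub (hgm.comp (hmk _))).enorm
      · refine fun n => Filter.Eventually.of_forall fun b => ?_
        beta_reduce
        rw [← ofReal_norm]
        exact ENNReal.ofReal_le_ofReal ((norm_sub_le _ _).trans (add_le_add (hMg _) (hMg _)))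
      · rw [lintegral_const]
        exact ENNReal.mul_ne_top ENNReal.ofReal_ne_top (measure_ne_top _ _)
      · refine Filter.Eventually.of_forall fun b => ?_
        have h1 := (hg.tendsto b.1).comp (tendsto_kinShift_zero hκ b.1 b.2.1 b.2.2 hεt)
        have h2 := (tendsto_const_nhds (x := g b.1)).sub h1
        rw [sub_self] at h2
        simpa using h2.enorm
    have hn : ∀ n, ∫⁻ z in B, (c * ‖F z‖ₑ - H z) ≤ c * δ + c * δ +
        ∫⁻ b, ‖g b.1 - g (kinShift κ b.1 (ε n * b.2.1) b.2.2)‖ₑ ∂((volume.restrict B).prod ν) := by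
      intro n
      have hm1 : Measurable fun z => ‖(F - g) z‖ₑ := (hF.sub hgm).enorm
      have hm2 : Measurable fun b : Phase d × ℝ × Space d × Space d =>
          ‖(F - g) (kinShift κ b.1 (ε n * b.2.1) b.2.2)‖ₑ := hm1.comp (hmk _)
      have hm3 : Measurable fun b : Phase d × ℝ × Space d × Space d =>
          ‖g b.1 - g (kinShift κ b.1 (ε n * b.2.1) b.2.2)‖ₑ :=
        ((hgm.comp measurable_fst).sub (hgm.comp (hmk _))).enorm
      have hpt : ∀ z ∈ B, c * ‖F z‖ₑ - H z ≤ c * ‖(F - g) z‖ₑ +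
          ∫⁻ b, ‖(F - g) (kinShift κ z (ε n * b.1) b.2)‖ₑ ∂ν +
          ∫⁻ b, ‖g z - g (kinShift κ z (ε n * b.1) b.2)‖ₑ ∂ν := by
        intro z hz
        rw [tsub_le_iff_right]
        have hm2' : Measurable fun b : ℝ × Space d × Space d =>
          ‖(F - g) (kinShift κ z (ε n * b.1) b.2)‖ₑ := hm1.comp (hmz _ z)
        have hm3' : Measurable fun b : ℝ × Space d × Space d =>
          ‖g z - g (kinShift κ z (ε n * b.1) b.2)‖ₑ :=
          (measurable_const.sub (hgm.comp (hmz _ z))).enorm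
        calc c * ‖F z‖ₑ = ∫⁻ _, ‖F z‖ₑ ∂ν := by rw [lintegral_const, mul_comm]
          _ ≤ ∫⁻ b, (‖(F - g) z‖ₑ + ‖(F - g) (kinShift κ z (ε n * b.1) b.2)‖ₑ +
              ‖g z - g (kinShift κ z (ε n * b.1) b.2)‖ₑ + ‖F (kinShift κ z (ε n * b.1) b.2)‖ₑ)
              ∂ν := by
            refine lintegral_mono fun b => ?_
            set k := kinShift κ z (ε n * b.1) b.2
            have e1 : F z = (F - g) z + -((F - g) k) + (g z - g k) + F k := by
              simp only [Pi.sub_apply]; ring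
            calc ‖F z‖ₑ = ‖(F - g) z + -((F - g) k) + (g z - g k) + F k‖ₑ := by rw [← e1]
              _ ≤ _ := by
                refine (enorm_add_le _ _).trans ?_
                gcongr
                refine (enorm_add_le _ _).trans ?_
                gcongr
                refine (enorm_add_le _ _).trans ?_
                rw [enorm_neg]
          _ = c * ‖(F - g) z‖ₑ + ∫⁻ b, ‖(F - g) (kinShift κ z (ε n * b.1) b.2)‖ₑ ∂ν +
              ∫⁻ b, ‖g z - g (kinShift κ z (ε n * b.1) b.2)‖ₑ ∂ν +
              ∫⁻ b, ‖F (kinShift κ z (ε n * b.1) b.2)‖ₑ ∂ν := by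
            rw [lintegral_add_left (by fun_prop), lintegral_add_left (by fun_prop),
              lintegral_add_left (by fun_prop), lintegral_const, mul_comm]
          _ ≤ _ := by gcongr; exact hle _ (hε0 n) z hz
      refine (setLIntegral_mono' hB hpt).trans ?_
      rw [lintegral_add_left (by
        exact (hm1.const_mul c).add hm2.lintegral_prod_right'), lintegral_add_left (by
        exact (hm1.const_mul c)), lintegral_const_mul _ hm1, lintegral_prod _ hm3.aemeasurable]
      gcongr
      · exact (setLIntegral_le_lintegral _ _).trans hgd
      · rw [lintegral_lintegral_swap hm2.aemeasurable]
        calc _ ≤ ∫⁻ _, δ ∂ν := by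
              refine lintegral_mono fun b => ?_
              refine (setLIntegral_le_lintegral _ _).trans ?_
              rw [lintegral_kinShift κ _ _ hm1]
              exact hgd
          _ = c * δ := by rw [lintegral_const, mul_comm]
    refine ge_of_tendsto' (by simpa using hmid.const_add (c * δ + c * δ)) hn
  have hzero : ∫⁻ z in B, (c * ‖F z‖ₑ - H z) = 0 := by
    have h1 : Filter.Tendsto (fun n : ℕ => c * (n : ENNReal)⁻¹ + c * (n : ENNReal)⁻¹)
        Filter.atTop (nhds (c * 0 + c * 0)) :=
      (ENNReal.Tendsto.const_mul ENNReal.tendsto_inv_nat_nhds_zero (Or.inr hcfin)).add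
        (ENNReal.Tendsto.const_mul ENNReal.tendsto_inv_nat_nhds_zero (Or.inr hcfin))
    have := ge_of_tendsto' h1 (fun n => key _ (by simp))
    simpa using this
  rw [lintegral_eq_zero_iff (by fun_prop)] at hzero
  filter_upwards [hzero] with z hz
  exact tsub_eq_zero_iff_le.1 hz

/-! ### Calculus of the velocity gradient and the transport derivative -/

lemma hasDerivAt_congr {E : Type*} [NormedAddCommGroup E] [NormedSpace ℝ E] {f g : ℝ → E}
    {f' g' : E} {x : ℝ} (h : HasDerivAt f f' x) (hf : g = f) (hf' : g' = f') :
    HasDerivAt g g' x := by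
  rwa [hf, hf']

section gradV
variable {d : ℕ} {f g : Phase d → ℝ} {z : Phase d}

lemma inner_gradV (hf : DifferentiableAt ℝ f z) (w : Space d) :
    inner ℝ (gradV f z) w = fderiv ℝ f z (0, 0, w) := by
  unfold gradV
  have h1 : HasFDerivAt (fun w : Space d => ((z.1, z.2.1, w) : Phase d))
      ((0 : Space d →L[ℝ] ℝ).prod ((0 : Space d →L[ℝ] Space d).prod (.id ℝ (Space d)))) z.2.2 :=
    (hasFDerivAt_const _ _).prodMk ((hasFDerivAt_const _ _).prodMk (hasFDerivAt_id _))
  have h2 : HasFDerivAt (fun w : Space d => f (z.1, z.2.1, w)) _ z.2.2 :=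
    HasFDerivAt.comp (g := f) z.2.2 (by simpa using hf.hasFDerivAt) h1
  have h3 : HasGradientAt (fun w : Space d => f (z.1, z.2.1, w)) _ z.2.2 :=
    hasGradientAt_iff_hasFDerivAt.2 (h2.differentiableAt.hasGradientAt.hasFDerivAt)
  rw [← InnerProductSpace.toDual_apply_apply (𝕜 := ℝ), h3.gradient, (h3.hasFDerivAt.unique h2)]
  rfl

lemma gradV_mul (hf : DifferentiableAt ℝ f z) (hg : DifferentiableAt ℝ g z) :
    gradV (fun z => f z * g z) z = f z • gradV g z + g z • gradV f z := by
  refine ext_inner_right ℝ fun w => ?_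
  rw [inner_gradV (hf.fun_mul hg), inner_add_left, real_inner_smul_left, real_inner_smul_left,
    inner_gradV hf, inner_gradV hg, fderiv_fun_mul hf hg]
  simp

lemma transport_mul (hf : DifferentiableAt ℝ f z) (hg : DifferentiableAt ℝ g z) :
    transport (fun z => f z * g z) z = f z * transport g z + g z * transport f z := by
  simp [transport, fderiv_fun_mul hf hg]

lemma fderiv_apply_eq_of_hasDerivAt (hf : DifferentiableAt ℝ f z) {v : Phase d} {D : ℝ}
    (h : HasDerivAt (fun τ : ℝ => f (z + τ • v)) D 0) : fderiv ℝ f z v = D :=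
  (hf.hasFDerivAt.hasLineDerivAt v).unique h

lemma continuous_gradV (hf : ContDiff ℝ ∞ f) : Continuous (gradV f) := by
  have h1 : gradV f = fun z => (InnerProductSpace.toDual ℝ (Space d)).symm
      ((fderiv ℝ f z).comp ((0 : Space d →L[ℝ] ℝ).prod
        ((0 : Space d →L[ℝ] Space d).prod (.id ℝ (Space d))))) := by
    ext1 z
    refine ext_inner_right ℝ fun w => ?_
    rw [inner_gradV (hf.differentiable (by simp) z), InnerProductSpace.toDual_symm_apply]
    rfl
  rw [h1]
  exact (LinearIsometryEquiv.continuous _).comp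
    ((hf.continuous_fderiv (by simp)).clm_comp continuous_const)

lemma continuous_transport (hf : ContDiff ℝ ∞ f) : Continuous (transport f) := by
  unfold transport
  exact (hf.continuous_fderiv (by simp)).clm_apply (by fun_prop)

lemma gradV_apply (hf : DifferentiableAt ℝ f z) (i : Fin d) :
    gradV f z i = fderiv ℝ f z (0, 0, EuclideanSpace.single i 1) := by
  rw [← inner_gradV hf, real_inner_comm, EuclideanSpace.inner_single_left]
  simp

end gradV

/-! ### The kinetic Gaussian kernel and its transport identity -/

section kernel
variable {d : ℕ}

/-- The rescaled displacement in position from `z` to `z'`. -/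
noncomputable def kinY (κ : ℝ) (z z' : Phase d) : Space d :=
  (z.1 - z'.1) ^ (-(1 + κ)) • (z'.2.1 - z.2.1 + (z.1 - z'.1) • z.2.2)

/-- The rescaled displacement in velocity from `z` to `z'`, sheared by the one in position. -/
noncomputable def kinU (κ : ℝ) (z z' : Phase d) : Space d :=
  (z.1 - z'.1) ^ (-κ) • (z'.2.2 - z.2.2) + (1 + κ) • kinY κ z z'

/-- The Gaussian weight in the rescaled displacements. -/
noncomputable def gaussW (b : ℝ) (a : Space d × Space d) : ℝ :=
  Real.exp (-b * (‖a.1‖ ^ 2 + ‖a.2‖ ^ 2))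

lemma kinY_kinShift (κ : ℝ) (z : Phase d) {s : ℝ} (hs : 0 < s) (a : Space d × Space d) :
    kinY κ z (kinShift κ z s a) = a.1 := by
  have : z.1 - (z.1 - s) = s := by ring
  simp only [kinY, kinShift, this]
  have h2 : z.2.1 - s • z.2.2 + s ^ (1 + κ) • a.1 - z.2.1 + s • z.2.2 = s ^ (1 + κ) • a.1 := by
    module
  rw [h2, smul_smul, ← Real.rpow_add hs]
  simp

lemma kinU_kinShift (κ : ℝ) (z : Phase d) {s : ℝ} (hs : 0 < s) (a : Space d × Space d) :
    kinU κ z (kinShift κ z s a) = a.2 := by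
  unfold kinU
  rw [kinY_kinShift κ z hs]
  have : z.1 - (z.1 - s) = s := by ring
  simp only [kinShift, this]
  have h2 : z.2.2 + s ^ κ • (a.2 - (1 + κ) • a.1) - z.2.2 = s ^ κ • (a.2 - (1 + κ) • a.1) := by
    module
  rw [h2, smul_smul, ← Real.rpow_add hs]
  simp

variable {κ : ℝ} {z z' : Phase d}

lemma contDiffAt_kinY (h : z'.1 < z.1) : ContDiffAt ℝ ∞ (kinY κ z) z' := by
  unfold kinY
  have : z.1 - z'.1 ≠ 0 := (sub_pos.2 h).ne'
  have h1 : ContDiffAt ℝ ∞ (fun z' : Phase d => (z.1 - z'.1) ^ (-(1 + κ))) z' :=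
    ContDiffAt.rpow_const_of_ne (by fun_prop) this
  exact h1.smul (by fun_prop)

lemma contDiffAt_kinU (h : z'.1 < z.1) : ContDiffAt ℝ ∞ (kinU κ z) z' := by
  unfold kinU
  have : z.1 - z'.1 ≠ 0 := (sub_pos.2 h).ne'
  have h1 : ContDiffAt ℝ ∞ (fun z' : Phase d => (z.1 - z'.1) ^ (-κ)) z' :=
    ContDiffAt.rpow_const_of_ne (by fun_prop) this
  exact (h1.smul (by fun_prop)).add ((contDiffAt_kinY h).const_smul _)

lemma contDiff_gaussW (b : ℝ) : ContDiff ℝ ∞ (gaussW (d := d) b) := by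
  unfold gaussW
  refine Real.contDiff_exp.comp (contDiff_const.mul (ContDiff.add ?_ ?_))
  · exact contDiff_fst.norm_sq ℝ
  · exact contDiff_snd.norm_sq ℝ

lemma hasDerivAt_gaussW {y u : ℝ → Space d} {y' u' : Space d} {τ : ℝ} (b : ℝ)
    (hy : HasDerivAt y y' τ) (hu : HasDerivAt u u' τ) :
    HasDerivAt (fun τ => gaussW b (y τ, u τ))
      (-2 * b * (inner ℝ (y τ) y' + inner ℝ (u τ) u') * gaussW b (y τ, u τ)) τ := by
  refine hasDerivAt_congr ((hy.norm_sq.add hu.norm_sq).const_mul (-b)).exp rfl ?_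
  simp only [gaussW, Pi.add_apply]
  ring

/-- This is what the shear in `kinU` is for: along free transport `s` decreases at unit rate, and
the terms from the power of `s` and from the moving position add up to exactly `u / s`. -/
lemma hasDerivAt_kinY_transport (h : z'.1 < z.1) :
    HasDerivAt (fun τ : ℝ => kinY κ z (z' + τ • (1, z'.2.2, 0)))
      ((z.1 - z'.1)⁻¹ • kinU κ z z') 0 := by
  have hs : 0 < z.1 - z'.1 := sub_pos.2 h
  have h1 : HasDerivAt (fun τ : ℝ => z.1 - (z'.1 + τ)) (-1) 0 := by
    simpa using ((hasDerivAt_id (0 : ℝ)).const_add z'.1).const_sub z.1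
  have h2 := h1.rpow_const (p := -(1 + κ)) (Or.inl (by simpa using hs.ne'))
  have h3 : HasDerivAt (fun τ : ℝ => z'.2.1 + τ • z'.2.2 - z.2.1 + (z.1 - (z'.1 + τ)) • z.2.2)
      ((1 : ℝ) • z'.2.2 + (-1 : ℝ) • z.2.2) 0 :=
    ((((hasDerivAt_id (0 : ℝ)).smul_const z'.2.2).const_add _).sub_const _).add
      (h1.smul_const z.2.2)
  have h4 := h2.smul h3
  have e1 : (z.1 - z'.1) ^ (-(1 + κ)) = (z.1 - z'.1)⁻¹ * (z.1 - z'.1) ^ (-κ) := by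
    rw [← Real.rpow_neg_one, ← Real.rpow_add hs]; congr 1; ring
  have e2 : (z.1 - z'.1) ^ (-(1 + κ) - 1) = (z.1 - z'.1)⁻¹ * (z.1 - z'.1) ^ (-(1 + κ)) := by
    rw [← Real.rpow_neg_one, ← Real.rpow_add hs]; congr 1; ring
  refine hasDerivAt_congr (h4) ?_ ?_
  · ext1 τ; simp [kinY]
  · simp only [kinU, kinY, add_zero, zero_smul, e2]
    rw [e1]
    module

lemma hasDerivAt_kinU_transport (h : z'.1 < z.1) :
    HasDerivAt (fun τ : ℝ => kinU κ z (z' + τ • (1, z'.2.2, 0)))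
      ((z.1 - z'.1)⁻¹ • ((1 + 2 * κ) • kinU κ z z' - (κ * (1 + κ)) • kinY κ z z')) 0 := by
  have hs : 0 < z.1 - z'.1 := sub_pos.2 h
  have h1 : HasDerivAt (fun τ : ℝ => z.1 - (z'.1 + τ)) (-1) 0 := by
    simpa using ((hasDerivAt_id (0 : ℝ)).const_add z'.1).const_sub z.1
  have h2 := (h1.rpow_const (p := -κ) (Or.inl (by simpa using hs.ne'))).smul_const
    (z'.2.2 - z.2.2)
  have h4 := h2.add ((hasDerivAt_kinY_transport (κ := κ) h).const_smul (1 + κ))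
  have e2 : (z.1 - z'.1) ^ (-κ - 1) = (z.1 - z'.1)⁻¹ * (z.1 - z'.1) ^ (-κ) := by
    rw [← Real.rpow_neg_one, ← Real.rpow_add hs]; congr 1; ring
  refine hasDerivAt_congr (h4) ?_ ?_
  · ext1 τ; simp [kinU]
  · simp only [kinU, add_zero, e2]
    module

lemma hasDerivAt_kinY_velocity (w : Space d) :
    HasDerivAt (fun τ : ℝ => kinY κ z (z' + τ • (0, 0, w))) 0 0 := by
  have : (fun τ : ℝ => kinY κ z (z' + τ • (0, 0, w))) = fun _ => kinY κ z z' := by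
    ext1 τ; simp [kinY]
  rw [this]
  exact hasDerivAt_const _ _

lemma hasDerivAt_kinU_velocity (w : Space d) :
    HasDerivAt (fun τ : ℝ => kinU κ z (z' + τ • (0, 0, w))) ((z.1 - z'.1) ^ (-κ) • w) 0 := by
  have h1 : HasDerivAt (fun τ : ℝ => z'.2.2 + τ • w - z.2.2) ((1 : ℝ) • w) 0 :=
    (((hasDerivAt_id (0 : ℝ)).smul_const w).const_add _).sub_const _
  have h2 := (h1.const_smul ((z.1 - z'.1) ^ (-κ))).add
    ((hasDerivAt_kinY_velocity (κ := κ) (z := z) (z' := z') w).const_smul (1 + κ))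
  refine hasDerivAt_congr (h2) ?_ ?_
  · ext1 τ; simp [kinU]
  · module

/-- The Gaussian kernel with base point `z`, at scales `s = z.1 - z'.1`, damped by `ζ s`. -/
noncomputable def kinKernel (κ : ℝ) (ζ : ℝ → ℝ) (z z' : Phase d) : ℝ :=
  ζ (z.1 - z'.1) * (z.1 - z'.1) ^ (-((d : ℝ) * (1 + 2 * κ))) *
    gaussW (1 / 2) (kinY κ z z', kinU κ z z')

/-- The vector field whose velocity divergence is minus the transport derivative of the kernel. -/
noncomputable def kinFlux (κ : ℝ) (ζ : ℝ → ℝ) (z z' : Phase d) : Space d :=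
  (ζ (z.1 - z'.1) * (z.1 - z'.1) ^ (κ - 1 - (d : ℝ) * (1 + 2 * κ)) *
    gaussW (1 / 2) (kinY κ z z', kinU κ z z')) •
      ((κ * (1 + κ) - 1) • kinY κ z z' - (1 + 2 * κ) • kinU κ z z')

/-- Real powers of `s` are singular at `s = 0` and meaningless for `s < 0`. Since `ζ` vanishes up to
`ε > 0`, the kernel and the flux are identically zero near any such point, which settles smoothness
there. -/
lemma eventually_comp_sub_eq_zero {ζ : ℝ → ℝ} {ε : ℝ} (hζ : ∀ s ≤ ε, ζ s = 0) (hε : 0 < ε)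
    (h : ¬ z'.1 < z.1) : ∀ᶠ x in nhds z', ζ (z.1 - x.1) = 0 := by
  have : ∀ᶠ x in nhds z', z.1 - x.1 < ε := by
    refine ContinuousAt.eventually_lt (by fun_prop) continuousAt_const ?_
    linarith
  filter_upwards [this] with x hx
  exact hζ _ hx.le

lemma contDiff_kinKernel {ζ : ℝ → ℝ} {ε : ℝ} (hζs : ContDiff ℝ ∞ ζ) (hζ : ∀ s ≤ ε, ζ s = 0)
    (hε : 0 < ε) (z : Phase d) : ContDiff ℝ ∞ (kinKernel κ ζ z) := by
  rw [contDiff_iff_contDiffAt]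
  intro z'
  by_cases h : z'.1 < z.1
  · unfold kinKernel
    have : z.1 - z'.1 ≠ 0 := (sub_pos.2 h).ne'
    have h1 : ContDiffAt ℝ ∞ (fun z' : Phase d => (z.1 - z'.1) ^ (-((d : ℝ) * (1 + 2 * κ)))) z' :=
      ContDiffAt.rpow_const_of_ne (by fun_prop) this
    refine ((ContDiffAt.mul ?_ h1).mul ?_)
    · exact hζs.contDiffAt.comp z' (by fun_prop)
    · exact (contDiff_gaussW _).contDiffAt.comp z'
        ((contDiffAt_kinY h).prodMk (contDiffAt_kinU h))
  · refine (contDiffAt_const (c := (0 : ℝ))).congr_of_eventuallyEq ?_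
    filter_upwards [eventually_comp_sub_eq_zero hζ hε h] with x hx
    simp [kinKernel, hx]

lemma contDiff_kinFlux {ζ : ℝ → ℝ} {ε : ℝ} (hζs : ContDiff ℝ ∞ ζ) (hζ : ∀ s ≤ ε, ζ s = 0)
    (hε : 0 < ε) (z : Phase d) : ContDiff ℝ ∞ (kinFlux κ ζ z) := by
  rw [contDiff_iff_contDiffAt]
  intro z'
  by_cases h : z'.1 < z.1
  · unfold kinFlux
    have : z.1 - z'.1 ≠ 0 := (sub_pos.2 h).ne'
    have h1 : ContDiffAt ℝ ∞
        (fun z' : Phase d => (z.1 - z'.1) ^ (κ - 1 - (d : ℝ) * (1 + 2 * κ))) z' :=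
      ContDiffAt.rpow_const_of_ne (by fun_prop) this
    refine ((ContDiffAt.mul ?_ h1).mul ?_).smul
      (((contDiffAt_kinY h).const_smul _).sub ((contDiffAt_kinU h).const_smul _))
    · exact hζs.contDiffAt.comp z' (by fun_prop)
    · exact (contDiff_gaussW _).contDiffAt.comp z'
        ((contDiffAt_kinY h).prodMk (contDiffAt_kinU h))
  · refine (contDiffAt_const (c := (0 : Space d))).congr_of_eventuallyEq ?_
    filter_upwards [eventually_comp_sub_eq_zero hζ hε h] with x hx
    simp [kinFlux, hx]

lemma inner_gradV_kinKernel {ζ : ℝ → ℝ} {ε : ℝ} (hζs : ContDiff ℝ ∞ ζ) (hζ : ∀ s ≤ ε, ζ s = 0)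
    (hε : 0 < ε) (w : Space d) :
    inner ℝ (gradV (kinKernel κ ζ z) z') w =
      -(kinKernel κ ζ z z' * (z.1 - z'.1) ^ (-κ) * inner ℝ (kinU κ z z') w) := by
  have hd : DifferentiableAt ℝ (kinKernel κ ζ z) z' :=
    (contDiff_kinKernel hζs hζ hε z).differentiable (by simp) z'
  rw [inner_gradV hd]
  refine fderiv_apply_eq_of_hasDerivAt hd ?_
  have h1 := (hasDerivAt_gaussW (1 / 2) (hasDerivAt_kinY_velocity (κ := κ) (z := z) (z' := z') w)
    (hasDerivAt_kinU_velocity (κ := κ) (z := z) (z' := z') w)).const_mul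
      (ζ (z.1 - z'.1) * (z.1 - z'.1) ^ (-((d : ℝ) * (1 + 2 * κ))))
  refine hasDerivAt_congr (h1) ?_ ?_
  · ext1 τ; simp [kinKernel]
  · simp only [kinKernel, zero_smul, add_zero, inner_zero_right, zero_add, real_inner_smul_right]
    ring

/-- Varying `v'` leaves `y` fixed and moves `u` at rate `s ^ (-κ)`, so this is `s ^ (-κ)` times a
`u`-divergence. -/
lemma sum_gradV_kinFlux {ζ : ℝ → ℝ} {ε : ℝ} (hζs : ContDiff ℝ ∞ ζ) (hζ : ∀ s ≤ ε, ζ s = 0)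
    (hε : 0 < ε) :
    ∑ i, gradV (fun x => kinFlux κ ζ z x i) z' i =
      ζ (z.1 - z'.1) * (z.1 - z'.1) ^ (κ - 1 - (d : ℝ) * (1 + 2 * κ)) * (z.1 - z'.1) ^ (-κ) *
        gaussW (1 / 2) (kinY κ z z', kinU κ z z') *
        (-(κ * (1 + κ) - 1) * inner ℝ (kinY κ z z') (kinU κ z z') +
          (1 + 2 * κ) * ‖kinU κ z z'‖ ^ 2 - d * (1 + 2 * κ)) := by
  have hterm : ∀ i : Fin d, gradV (fun x => kinFlux κ ζ z x i) z' i =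
      ζ (z.1 - z'.1) * (z.1 - z'.1) ^ (κ - 1 - (d : ℝ) * (1 + 2 * κ)) * (z.1 - z'.1) ^ (-κ) *
        gaussW (1 / 2) (kinY κ z z', kinU κ z z') *
        (-(κ * (1 + κ) - 1) * (kinY κ z z' i * kinU κ z z' i) +
          (1 + 2 * κ) * (kinU κ z z' i * kinU κ z z' i) - (1 + 2 * κ)) := by
    intro i
    have hd : DifferentiableAt ℝ (fun x => kinFlux κ ζ z x i) z' :=
      ((EuclideanSpace.proj (𝕜 := ℝ) i).contDiff.comp
        (contDiff_kinFlux hζs hζ hε z)).differentiable (by simp) z'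
    rw [gradV_apply hd]
    refine fderiv_apply_eq_of_hasDerivAt hd ?_
    have h1 := (hasDerivAt_gaussW (1 / 2)
      (hasDerivAt_kinY_velocity (κ := κ) (z := z) (z' := z') (EuclideanSpace.single i 1))
      (hasDerivAt_kinU_velocity (κ := κ) (z := z) (z' := z') (EuclideanSpace.single i 1))).const_mul
        (ζ (z.1 - z'.1) * (z.1 - z'.1) ^ (κ - 1 - (d : ℝ) * (1 + 2 * κ)))
    have h2 : HasDerivAt (fun τ : ℝ => (κ * (1 + κ) - 1) * kinY κ z z' i -
        (1 + 2 * κ) * kinU κ z (z' + τ • (0, 0, EuclideanSpace.single i 1)) i)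
        (-((1 + 2 * κ) * (z.1 - z'.1) ^ (-κ))) 0 := by
      have := (((EuclideanSpace.proj (𝕜 := ℝ) i).hasFDerivAt.comp_hasDerivAt (0 : ℝ)
        (hasDerivAt_kinU_velocity (κ := κ) (z := z) (z' := z')
          (EuclideanSpace.single i 1))).const_mul (1 + 2 * κ)).const_sub
          ((κ * (1 + κ) - 1) * kinY κ z z' i)
      exact hasDerivAt_congr this rfl (by simp)
    have hY : ∀ τ : ℝ, kinY κ z (z' + (0, 0, τ • EuclideanSpace.single i 1)) = kinY κ z z' := by
      intro τ; simp [kinY]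
    refine hasDerivAt_congr (h1.mul h2) ?_ ?_
    · ext1 τ; simp [kinFlux, hY]
    · simp only [zero_smul, add_zero, inner_zero_right, zero_add, real_inner_smul_right,
        EuclideanSpace.inner_single_right]
      simp
      ring
  simp_rw [hterm]
  rw [← Finset.mul_sum, Finset.sum_sub_distrib, Finset.sum_add_distrib, ← Finset.mul_sum,
    ← Finset.mul_sum, EuclideanSpace.norm_sq_eq]
  congr 1
  simp only [PiLp.inner_apply, Finset.sum_const, Finset.card_univ, Fintype.card_fin, nsmul_eq_mul,
    Real.norm_eq_abs, sq_abs]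
  simp [mul_comm, sq]

/-- Transport acts on the Gaussian `W` by `s⁻¹ (u · ∇_y + ((1 + 2κ) u - κ (1 + κ) y) · ∇_u)`. As `W`
is radial in `(y, u)`, `u · ∇_y W = y · ∇_u W`: the position derivative becomes a velocity
derivative. The remaining term `d (1 + 2κ) W`, from the power of `s`, completes `(1 + 2κ) u · ∇_u W`
to a divergence. -/
lemma transport_kinKernel {ζ : ℝ → ℝ} {ε : ℝ} (hζs : ContDiff ℝ ∞ ζ) (hζ : ∀ s ≤ ε, ζ s = 0)
    (hε : 0 < ε) :
    transport (kinKernel κ ζ z) z' =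
      -kinKernel κ (deriv ζ) z z' - ∑ i, gradV (fun x => kinFlux κ ζ z x i) z' i := by
  have hd : DifferentiableAt ℝ (kinKernel κ ζ z) z' :=
    (contDiff_kinKernel hζs hζ hε z).differentiable (by simp) z'
  rw [sum_gradV_kinFlux hζs hζ hε]
  by_cases h : z'.1 < z.1
  · have hs : 0 < z.1 - z'.1 := sub_pos.2 h
    refine fderiv_apply_eq_of_hasDerivAt hd ?_
    have h1 : HasDerivAt (fun τ : ℝ => z.1 - (z'.1 + τ)) (-1) 0 := by
      simpa using ((hasDerivAt_id (0 : ℝ)).const_add z'.1).const_sub z.1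
    have h2 := h1.rpow_const (p := -((d : ℝ) * (1 + 2 * κ))) (Or.inl (by simpa using hs.ne'))
    have h3 : HasDerivAt (fun τ : ℝ => ζ (z.1 - (z'.1 + τ))) (deriv ζ (z.1 - z'.1) * (-1)) 0 := by
      refine HasDerivAt.comp (h₂ := ζ) 0 ?_ h1
      simpa using (hζs.differentiable (by simp) (z.1 - z'.1)).hasDerivAt
    have h4 := hasDerivAt_gaussW (1 / 2) (hasDerivAt_kinY_transport (κ := κ) h)
      (hasDerivAt_kinU_transport (κ := κ) h)
    have e1 : (z.1 - z'.1) ^ (-((d : ℝ) * (1 + 2 * κ)) - 1) =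
        (z.1 - z'.1) ^ (-((d : ℝ) * (1 + 2 * κ))) * (z.1 - z'.1)⁻¹ := by
      rw [Real.rpow_sub_one hs.ne']; rfl
    have e2 : (z.1 - z'.1) ^ (κ - 1 - (d : ℝ) * (1 + 2 * κ)) * (z.1 - z'.1) ^ (-κ) =
        (z.1 - z'.1) ^ (-((d : ℝ) * (1 + 2 * κ))) * (z.1 - z'.1)⁻¹ := by
      rw [← Real.rpow_neg_one, ← Real.rpow_add hs, ← Real.rpow_add hs]; congr 1; ring
    refine hasDerivAt_congr ((h3.mul h2).mul h4) ?_ ?_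
    · ext1 τ; simp [kinKernel]
    · rw [mul_assoc (ζ (z.1 - z'.1)), e2]
      simp only [kinKernel, Pi.mul_apply, zero_smul, add_zero, e1, real_inner_smul_right, inner_sub_right,
        real_inner_self_eq_norm_sq]
      rw [real_inner_comm (kinY κ z z') (kinU κ z z')]
      generalize (z.1 - z'.1) ^ (-((d : ℝ) * (1 + 2 * κ))) = A
      generalize (z.1 - z'.1)⁻¹ = B
      ring
  · have h0 := eventually_comp_sub_eq_zero hζ hε h
    have h1 : kinKernel κ ζ z =ᶠ[nhds z'] fun _ => 0 := by
      filter_upwards [h0] with x hx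
      simp [kinKernel, hx]
    have h2 : deriv ζ (z.1 - z'.1) = 0 := by
      have : ζ =ᶠ[nhds (z.1 - z'.1)] fun _ => 0 := by
        filter_upwards [Iio_mem_nhds (by linarith : z.1 - z'.1 < ε)] with x hx
        exact hζ x hx.le
      rw [this.deriv_eq]; simp
    rw [transport, h1.fderiv_eq]
    simp [kinKernel, h2, h0.self_of_nhds]

end kernel

/-! ### Smooth cutoffs adapted to kinetic cylinders -/

lemma deriv_smoothTransition_of_nonpos {x : ℝ} (hx : x ≤ 0) :
    deriv Real.smoothTransition x = 0 := by
  have hcl : IsClosed {x : ℝ | deriv Real.smoothTransition x = 0} :=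
    isClosed_eq (Real.smoothTransition.contDiff.continuous_deriv (n := 1) le_rfl) continuous_const
  have h1 : Set.Iio (0 : ℝ) ⊆ {x : ℝ | deriv Real.smoothTransition x = 0} := by
    intro y hy
    have : Real.smoothTransition =ᶠ[nhds y] fun _ => 0 := by
      filter_upwards [Iio_mem_nhds hy] with x hx
      exact Real.smoothTransition.zero_of_nonpos (le_of_lt hx)
    simp [this.deriv_eq]
  have h2 := hcl.closure_subset_iff.2 h1
  rw [closure_Iio] at h2
  exact h2 hx

lemma exists_deriv_smoothTransition_le :
    ∃ M : ℝ, 0 < M ∧ ∀ x, |deriv Real.smoothTransition x| ≤ M := by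
  have hc : Continuous (deriv Real.smoothTransition) :=
    Real.smoothTransition.contDiff.continuous_deriv (n := 1) le_rfl
  obtain ⟨M, hM⟩ := (isCompact_Icc (a := (0 : ℝ)) (b := 1)).exists_bound_of_continuousOn
    hc.continuousOn
  refine ⟨max M 1, by positivity, fun x => ?_⟩
  rcases le_or_gt x 0 with hx | hx
  · rw [deriv_smoothTransition_of_nonpos hx]; simp
  rcases le_or_gt x 1 with hx1 | hx1
  · exact (hM x ⟨hx.le, hx1⟩).trans (le_max_left _ _)
  · have : Real.smoothTransition =ᶠ[nhds x] fun _ => 1 := by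
      filter_upwards [Ioi_mem_nhds hx1] with y hy
      exact Real.smoothTransition.one_of_one_le (le_of_lt hy)
    simp [this.deriv_eq]

/-- A smooth cutoff, equal to `1` on the ball of radius `r` and supported in that of radius `ρ`. -/
noncomputable def ballCutoff {d : ℕ} (r ρ : ℝ) (X : Space d) : ℝ :=
  Real.smoothTransition ((ρ ^ 2 - ‖X‖ ^ 2) / (ρ ^ 2 - r ^ 2))

section ballCutoff
variable {d : ℕ} {r ρ : ℝ}

lemma contDiff_ballCutoff : ContDiff ℝ ∞ (ballCutoff (d := d) r ρ) := by
  unfold ballCutoff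
  exact Real.smoothTransition.contDiff.comp
    ((contDiff_const.sub (contDiff_id.norm_sq ℝ)).div_const _)

lemma ballCutoff_nonneg (X : Space d) : 0 ≤ ballCutoff r ρ X := Real.smoothTransition.nonneg _

lemma ballCutoff_le_one (X : Space d) : ballCutoff r ρ X ≤ 1 := Real.smoothTransition.le_one _

lemma ballCutoff_eq_one (hr : 0 ≤ r) (hρ : r < ρ) {X : Space d} (hX : ‖X‖ ≤ r) :
    ballCutoff r ρ X = 1 := by
  have h1 : 0 < ρ ^ 2 - r ^ 2 := by nlinarith
  refine Real.smoothTransition.one_of_one_le ?_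
  rw [le_div_iff₀ h1]
  nlinarith [norm_nonneg X]

lemma norm_le_of_ballCutoff_ne_zero (hr : 0 ≤ r) (hρ : r < ρ) {X : Space d}
    (hX : ballCutoff r ρ X ≠ 0) : ‖X‖ ≤ ρ := by
  by_contra hcon
  have h1 : 0 < ρ ^ 2 - r ^ 2 := by nlinarith
  refine hX (Real.smoothTransition.zero_of_nonpos ?_)
  refine div_nonpos_of_nonpos_of_nonneg ?_ h1.le
  nlinarith [norm_nonneg X]

/-- Working with `‖X‖ ^ 2` keeps the cutoff smooth at the origin. For `‖X‖ ≤ ρ` the factor `2 ρ / (ρ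
^ 2 - r ^ 2)` is at most `2 / (ρ - r)`; outside, the derivative vanishes. -/
lemma exists_hasDerivAt_ballCutoff {M : ℝ} (hM : ∀ x, |deriv Real.smoothTransition x| ≤ M)
    (hr : 0 ≤ r) (hρ : r < ρ) {X : ℝ → Space d} {X' : Space d} {τ : ℝ} (hX : HasDerivAt X X' τ) :
    ∃ D : ℝ, HasDerivAt (fun τ => ballCutoff r ρ (X τ)) D τ ∧
      |D| ≤ 2 * M / (ρ - r) * ‖X'‖ := by
  have h1 : 0 < ρ ^ 2 - r ^ 2 := by nlinarith
  have hρr : 0 < ρ - r := by linarith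
  have hM0 : 0 ≤ M := (abs_nonneg _).trans (hM 0)
  have h2 := (hX.norm_sq.const_sub (ρ ^ 2)).div_const (ρ ^ 2 - r ^ 2)
  have h3 := ((Real.smoothTransition.contDiff (n := 1)).differentiable one_ne_zero
    ((ρ ^ 2 - ‖X τ‖ ^ 2) / (ρ ^ 2 - r ^ 2))).hasDerivAt
  refine ⟨_, h3.comp τ h2, ?_⟩
  rcases le_or_gt ‖X τ‖ ρ with h | h
  · rw [abs_mul]
    have h4 : |-(2 * inner ℝ (X τ) X') / (ρ ^ 2 - r ^ 2)| ≤ 2 / (ρ - r) * ‖X'‖ := by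
      rw [abs_div, abs_neg, abs_mul, abs_of_pos h1, abs_two, div_le_iff₀ h1]
      have h5 : 2 / (ρ - r) * ‖X'‖ * (ρ ^ 2 - r ^ 2) = 2 * ((ρ + r) * ‖X'‖) := by
        have : ρ ^ 2 - r ^ 2 = (ρ - r) * (ρ + r) := by ring
        rw [this]; field_simp
      rw [h5]
      gcongr
      refine (abs_real_inner_le_norm _ _).trans ?_
      gcongr
      linarith
    calc _ ≤ M * (2 / (ρ - r) * ‖X'‖) := by
          gcongr
          exact hM _
      _ = _ := by ring
  · rw [deriv_smoothTransition_of_nonpos]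
    · simp only [zero_mul, abs_zero]; positivity
    · refine div_nonpos_of_nonpos_of_nonneg ?_ h1.le
      nlinarith

end ballCutoff

/-- Cutoff functions between two concentric kinetic cylinders. -/
theorem exists_kinetic_cutoff : ∃ C₀ : ℝ, 0 < C₀ ∧ ∀ (d : ℕ) (p θ R₁ R₂ : ℝ) (z₀ : Phase d),
    0 < p → 0 < θ → 0 < R₁ → R₁ < R₂ → ∃ (φ : Phase d → ℝ) (τ ρ σ : ℝ),
      ContDiff ℝ ∞ φ ∧ (∀ z, 0 ≤ φ z) ∧ (∀ z, φ z ≤ 1) ∧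
      (∀ z ∈ kineticCylinder p θ R₁ z₀, φ z = 1) ∧
      z₀.1 - θ * R₂ ^ p < τ ∧ ρ < θ * R₂ ^ (1 + p) ∧ σ < R₂ ∧
      (∀ z, φ z ≠ 0 → τ ≤ z.1 ∧ ‖z.2.1 - z₀.2.1 - (z.1 - z₀.1) • z.2.2‖ ≤ ρ ∧
        ‖z.2.2 - z₀.2.2‖ ≤ σ) ∧
      (∀ z, |transport φ z| ≤ C₀ * gammaT p θ R₁ R₂) ∧
      (∀ z, |z.1 - z₀.1| ≤ θ * R₂ ^ p → ‖gradV φ z‖ ≤ C₀ * gammaV p R₁ R₂) := by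
  obtain ⟨M, hM0, hM⟩ := exists_deriv_smoothTransition_le
  refine ⟨4 * M, by positivity, ?_⟩
  intro d p θ R₁ R₂ z₀ hp hθ hR₁ hR
  have hR₂ : 0 < R₂ := hR₁.trans hR
  have hRp : R₁ ^ p < R₂ ^ p := Real.rpow_lt_rpow hR₁.le hR hp
  have hRp1 : R₁ ^ (1 + p) < R₂ ^ (1 + p) := Real.rpow_lt_rpow hR₁.le hR (by linarith)
  have hRp0 : 0 < R₁ ^ p := by positivity
  have hRp10 : 0 < R₁ ^ (1 + p) := by positivity
  -- All three cutoffs complete their transition halfway between the two cylinders, which leaves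
  -- room for a compact set inside the larger one. There is no cutoff at the final time `t₀`: the
  -- kernel will provide it.
  set L : ℝ := θ * (R₂ ^ p - R₁ ^ p) / 2 with hL
  have hL0 : 0 < L := by have := sub_pos.2 hRp; positivity
  set τ : ℝ := z₀.1 - θ * R₁ ^ p - L with hτ
  set r : ℝ := θ * R₁ ^ (1 + p) with hr
  set ρ : ℝ := θ * (R₁ ^ (1 + p) + R₂ ^ (1 + p)) / 2 with hρ
  set σ : ℝ := (R₁ + R₂) / 2 with hσ
  have hr0 : 0 ≤ r := by positivity
  have hρr' : ρ - r = θ * (R₂ ^ (1 + p) - R₁ ^ (1 + p)) / 2 := by rw [hρ, hr]; ring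
  have hρr : r < ρ := by
    have : 0 < ρ - r := by rw [hρr']; have := sub_pos.2 hRp1; positivity
    linarith
  have hσr : R₁ < σ := by rw [hσ]; linarith
  set X : Phase d → Space d := fun z => z.2.1 - z₀.2.1 - (z.1 - z₀.1) • z.2.2 with hX
  set V : Phase d → Space d := fun z => z.2.2 - z₀.2.2 with hV
  set φ : Phase d → ℝ := fun z => Real.smoothTransition ((z.1 - τ) / L) *
    (ballCutoff r ρ (X z) * ballCutoff R₁ σ (V z)) with hφ
  have hφs : ContDiff ℝ ∞ φ := by
    have hXs : ContDiff ℝ ∞ X := by fun_prop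
    have hVs : ContDiff ℝ ∞ V := by fun_prop
    refine ContDiff.mul ?_ ((contDiff_ballCutoff.comp hXs).mul (contDiff_ballCutoff.comp hVs))
    exact Real.smoothTransition.contDiff.comp (by fun_prop)
  have hφd : Differentiable ℝ φ := hφs.differentiable (by simp)
  have h01 : ∀ z : Phase d, 0 ≤ ballCutoff r ρ (X z) * ballCutoff R₁ σ (V z) ∧
      ballCutoff r ρ (X z) * ballCutoff R₁ σ (V z) ≤ 1 := fun z =>
    ⟨mul_nonneg (ballCutoff_nonneg _) (ballCutoff_nonneg _),
      mul_le_one₀ (ballCutoff_le_one _) (ballCutoff_nonneg _) (ballCutoff_le_one _)⟩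
  refine ⟨φ, τ, ρ, σ, hφs, ?_, ?_, ?_, ?_, ?_, ?_, ?_, ?_, ?_⟩
  · exact fun z => mul_nonneg (Real.smoothTransition.nonneg _) (h01 z).1
  · exact fun z => mul_le_one₀ (Real.smoothTransition.le_one _) (h01 z).1 (h01 z).2
  · rintro z ⟨h1, h2, h3⟩
    rw [mem_ball_zero_iff] at h2 h3
    have e1 : Real.smoothTransition ((z.1 - τ) / L) = 1 := by
      refine Real.smoothTransition.one_of_one_le ?_
      rw [le_div_iff₀ hL0, hτ]
      linarith [h1.1]
    simp only [hφ]
    rw [e1, ballCutoff_eq_one hr0 hρr (le_of_lt h2), ballCutoff_eq_one hR₁.le hσr (le_of_lt h3)]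
    simp
  · rw [hτ, hL]
    have : 0 < θ * (R₂ ^ p - R₁ ^ p) := mul_pos hθ (sub_pos.2 hRp)
    linarith
  · rw [hρ]
    have : 0 < θ * (R₂ ^ (1 + p) - R₁ ^ (1 + p)) := mul_pos hθ (sub_pos.2 hRp1)
    linarith
  · rw [hσ]; linarith
  · intro z hz
    refine ⟨?_, norm_le_of_ballCutoff_ne_zero hr0 hρr fun h => hz (by simp only [hφ]; rw [h]; ring),
      norm_le_of_ballCutoff_ne_zero hR₁.le hσr fun h => hz (by simp only [hφ]; rw [h]; ring)⟩
    by_contra hcon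
    refine hz ?_
    have e1 : Real.smoothTransition ((z.1 - τ) / L) = 0 := by
      refine Real.smoothTransition.zero_of_nonpos ?_
      exact div_nonpos_of_nonpos_of_nonneg (by linarith) hL0.le
    simp [hφ, e1]
  · intro z
    have h1 : HasDerivAt (fun h : ℝ => (z.1 + h - τ) / L) (1 / L) 0 :=
      (((hasDerivAt_id (0 : ℝ)).const_add z.1).sub_const τ).div_const L
    have h2 := ((Real.smoothTransition.contDiff (n := 1)).differentiable one_ne_zero
      ((z.1 + 0 - τ) / L)).hasDerivAt.comp 0 h1
    have h3 := h2.mul_const (ballCutoff r ρ (X z) * ballCutoff R₁ σ (V z))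
    -- The cylinder coordinates `X` and `V` are constant along free transport, so only the time
    -- cutoff contributes to the transport derivative.
    have hXc : ∀ h : ℝ, X (z + h • (1, z.2.2, 0)) = X z := by
      intro h
      simp only [hX, Prod.fst_add, Prod.snd_add, Prod.smul_fst, Prod.smul_snd, smul_eq_mul,
        mul_one, smul_zero, add_zero]
      module
    have hVc : ∀ h : ℝ, V (z + h • (1, z.2.2, 0)) = V z := by
      intro h
      simp [hV]
    have h4 : transport φ z = _ := fderiv_apply_eq_of_hasDerivAt (hφd z)
      (hasDerivAt_congr h3 (by ext1 h; simp only [hφ, hXc, hVc]; simp) rfl)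
    rw [h4, abs_mul, abs_mul, abs_of_nonneg (h01 z).1, abs_of_pos (by positivity : 0 < 1 / L)]
    calc _ ≤ M * (1 / L) * 1 := by
          gcongr
          · exact (h01 z).1
          · exact hM _
          · exact (h01 z).2
      _ ≤ 4 * M * gammaT p θ R₁ R₂ := by
          have : 1 / L = 2 * gammaT p θ R₁ R₂ := by rw [gammaT, hL]; field_simp
          have h0 : 0 < 1 / L := by positivity
          rw [this] at h0 ⊢
          nlinarith
  · intro z hz
    have hbound : ∀ w : Space d, |inner ℝ (gradV φ z) w| ≤ 4 * M * gammaV p R₁ R₂ * ‖w‖ := by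
      intro w
      -- The slanted coordinate `X` depends on `v` with slope `t - t₀`, of size at most `θ R₂ ^ p`.
      -- Against a transition width of order `θ (R₂ ^ (1 + p) - R₁ ^ (1 + p))`, the `θ` cancels in
      -- `gammaV`.
      have hXd : HasDerivAt (fun h : ℝ => X (z + h • (0, 0, w))) (-(z.1 - z₀.1) • w) 0 := by
        have h1 := (((((hasDerivAt_id (0 : ℝ)).smul_const w).const_add z.2.2).const_smul
          (z.1 - z₀.1)).const_sub (z.2.1 - z₀.2.1))
        refine hasDerivAt_congr h1 ?_ ?_
        · ext1 h; simp [hX]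
        · module
      have hVd : HasDerivAt (fun h : ℝ => V (z + h • (0, 0, w))) w 0 := by
        have h1 := (((hasDerivAt_id (0 : ℝ)).smul_const w).const_add z.2.2).sub_const z₀.2.2
        refine hasDerivAt_congr h1 ?_ ?_
        · ext1 h; simp [hV]
        · simp
      obtain ⟨D₁, hD₁, hD₁b⟩ := exists_hasDerivAt_ballCutoff hM hr0 hρr hXd
      obtain ⟨D₂, hD₂, hD₂b⟩ := exists_hasDerivAt_ballCutoff hM hR₁.le hσr hVd
      have h3 := (hD₁.mul hD₂).const_mul (Real.smoothTransition ((z.1 - τ) / L))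
      rw [inner_gradV (hφd z), fderiv_apply_eq_of_hasDerivAt (hφd z)
        (hasDerivAt_congr h3 (by ext1 h; simp [hφ]) rfl), abs_mul,
        abs_of_nonneg (Real.smoothTransition.nonneg _)]
      have e1 : |D₁| ≤ 4 * M * (R₂ ^ p / (R₂ ^ (1 + p) - R₁ ^ (1 + p))) * ‖w‖ := by
        refine hD₁b.trans ?_
        rw [norm_smul, norm_neg, Real.norm_eq_abs, hρr']
        have := sub_pos.2 hRp1
        calc _ ≤ 2 * M / (θ * (R₂ ^ (1 + p) - R₁ ^ (1 + p)) / 2) * (θ * R₂ ^ p * ‖w‖) := by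
              gcongr
          _ = _ := by field_simp; ring
      have e2 : |D₂| ≤ 4 * M * (1 / (R₂ - R₁)) * ‖w‖ := by
        refine hD₂b.trans (le_of_eq ?_)
        have : σ - R₁ = (R₂ - R₁) / 2 := by rw [hσ]; ring
        have h0 := sub_pos.2 hR
        rw [this]; field_simp; ring
      have e3 : ∀ a b x y : ℝ, 0 ≤ x → x ≤ 1 → 0 ≤ y → y ≤ 1 → |a * y + x * b| ≤ |a| + |b| := by
        intro a b x y hx hx1 hy hy1
        refine (abs_add_le _ _).trans ?_
        rw [abs_mul, abs_mul, abs_of_nonneg hx, abs_of_nonneg hy]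
        exact add_le_add (mul_le_of_le_one_right (abs_nonneg _) hy1)
          (mul_le_of_le_one_left (abs_nonneg _) hx1)
      refine (mul_le_of_le_one_left (abs_nonneg _) (Real.smoothTransition.le_one _)).trans ?_
      refine (e3 _ _ _ _ (ballCutoff_nonneg _) (ballCutoff_le_one _) (ballCutoff_nonneg _)
        (ballCutoff_le_one _)).trans ?_
      refine (add_le_add e1 e2).trans (le_of_eq ?_)
      rw [gammaV]; ring
    have h5 := hbound (gradV φ z)
    rw [real_inner_self_eq_norm_sq, abs_of_nonneg (by positivity)] at h5
    rcases eq_or_lt_of_le (norm_nonneg (gradV φ z)) with h6 | h6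
    · rw [← h6]
      have := sub_pos.2 hRp1
      have := sub_pos.2 hR
      unfold gammaV
      positivity
    · nlinarith

/-! ### Measurability of the nonlinear flux -/

/-- Superposition with a Carathéodory vector field preserves measurability. -/
theorem IsCaratheodory.aemeasurable_comp {d : ℕ} {A : Phase d → ℝ → Space d → Space d}
    (hA : IsCaratheodory A) {μ : Measure (Phase d)} (hμ : μ ≪ volume) {f : Phase d → ℝ}
    {G : Phase d → Space d} (hf : AEMeasurable f μ) (hG : AEMeasurable G μ) :
    AEMeasurable (fun z => A z (f z) (G z)) μ := by
  obtain ⟨S, hSc, hSd⟩ := TopologicalSpace.exists_countable_dense (ℝ × Space d)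
  have h1 : ∀ᵐ z : Phase d, Continuous (fun y : ℝ × Space d => A z y.1 y.2) ∧
      ∀ y ∈ S, A z y.1 y.2 = (hA.measurable y.1 y.2).mk _ z := by
    refine hA.continuous.and ?_
    rw [ae_ball_iff hSc]
    exact fun y _ => (hA.measurable y.1 y.2).ae_eq_mk
  -- One null set serves for all `(η, ξ)`, because agreement with measurable versions is only
  -- imposed on a countable dense set. Off it, continuity reaches every `(η, ξ)` as a pointwise
  -- limit and gives joint measurability.
  obtain ⟨N, hN, hNm, hN0⟩ := exists_measurable_superset_of_null h1
  set A' : ℝ × Space d → Phase d → Space d := fun y => Nᶜ.indicator fun z => A z y.1 y.2 with hA'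
  have hgood : ∀ z ∉ N, Continuous (fun y : ℝ × Space d => A z y.1 y.2) ∧
      ∀ y ∈ S, A z y.1 y.2 = (hA.measurable y.1 y.2).mk _ z := by
    intro z hz
    by_contra hcon
    exact hz (hN hcon)
  have hcont : ∀ z, Continuous fun y => A' y z := by
    intro z
    by_cases hz : z ∈ N
    · simpa [hA', hz] using continuous_const
    · simpa [hA', hz] using (hgood z hz).1
  have hS : ∀ y ∈ S, Measurable (A' y) := by
    intro y hy
    have : A' y = Nᶜ.indicator ((hA.measurable y.1 y.2).mk _) := by
      ext1 z
      by_cases hz : z ∈ N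
      · simp [hA', hz]
      · simp [hA', hz, (hgood z hz).2 y hy]
    rw [this]
    exact (hA.measurable y.1 y.2).measurable_mk.indicator hNm.compl
  have hall : ∀ y, Measurable (A' y) := by
    intro y
    obtain ⟨u, hu, hlim⟩ := mem_closure_iff_seq_limit.1 (hSd y)
    refine measurable_of_tendsto_metrizable (fun n => hS (u n) (hu n)) ?_
    rw [tendsto_pi_nhds]
    exact fun z => ((hcont z).tendsto y).comp hlim
  have hjoint := measurable_uncurry_of_continuous_of_measurable (u := A') hcont hall
  refine ⟨fun z => A' (hf.mk f z, hG.mk G z) z,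
    hjoint.comp ((hf.measurable_mk.prodMk hG.measurable_mk).prodMk measurable_id), ?_⟩
  filter_upwards [hf.ae_eq_mk, hG.ae_eq_mk, hμ.ae_le (compl_mem_ae_iff.2 hN0)] with z h2 h3 h4
  simp only [hA']
  rw [Set.indicator_of_mem h4, ← h2, ← h3]

/-! ### Testing the weak formulation with the kernel -/

section weak
variable {d : ℕ} {Ω K : Set (Phase d)}

lemma exists_norm_le_of_compact_support {E : Type*} [NormedAddCommGroup E] {h : Phase d → E}
    (hK : IsCompact K) (hc : Continuous h) (hs : ∀ z, h z ≠ 0 → z ∈ K) :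
    ∃ M, ∀ z, ‖h z‖ ≤ M := by
  obtain ⟨M, hM⟩ := hK.exists_bound_of_continuousOn hc.continuousOn
  refine ⟨max M 0, fun z => ?_⟩
  by_cases hz : h z = 0
  · simp [hz]
  · exact (hM z (hs z hz)).trans (le_max_left _ _)

lemma isTestFunction_of_compact {h : Phase d → ℝ} (hK : IsCompact K) (hKΩ : K ⊆ Ω)
    (hc : ContDiff ℝ ∞ h) (hs : ∀ z, h z ≠ 0 → z ∈ K) : IsTestFunction Ω h where
  smooth := hc
  compact := HasCompactSupport.intro hK fun z hz => by
    by_contra hcon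
    exact hz (hs z hcon)
  support_subset := (closure_minimal hs hK.isClosed).trans hKΩ

lemma Integrable.mul_compact {f h : Phase d → ℝ} {μ : Measure (Phase d)} (hf : Integrable f μ)
    (hK : IsCompact K) (hc : Continuous h) (hs : ∀ z, h z ≠ 0 → z ∈ K) :
    Integrable (fun z => f z * h z) μ := by
  obtain ⟨M, hM⟩ := exists_norm_le_of_compact_support hK hc hs
  exact hf.mul_bdd (c := M) hc.aestronglyMeasurable (Filter.Eventually.of_forall hM)

lemma Integrable.inner_compact {f h : Phase d → Space d} {μ : Measure (Phase d)}
    (hf : Integrable f μ) (hK : IsCompact K) (hc : Continuous h) (hs : ∀ z, h z ≠ 0 → z ∈ K) :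
    Integrable (fun z => inner ℝ (f z) (h z)) μ := by
  obtain ⟨M, hM⟩ := exists_norm_le_of_compact_support hK hc hs
  refine (hf.norm.mul_const M).mono' (hf.aestronglyMeasurable.inner hc.aestronglyMeasurable) ?_
  refine Filter.Eventually.of_forall fun z => (norm_inner_le_norm _ _).trans ?_
  gcongr
  exact hM z

lemma gradV_eq_zero_of_notMem_tsupport {φ : Phase d → ℝ} {z : Phase d} (hφ : ContDiff ℝ ∞ φ)
    (hz : z ∉ tsupport φ) : gradV φ z = 0 := by
  refine ext_inner_right ℝ fun w => ?_
  rw [inner_gradV (hφ.differentiable (by simp) z),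
    (notMem_tsupport_iff_eventuallyEq.1 hz).fderiv_eq]
  simp

lemma transport_eq_zero_of_notMem_tsupport {φ : Phase d → ℝ} {z : Phase d}
    (hz : z ∉ tsupport φ) : transport φ z = 0 := by
  rw [transport, (notMem_tsupport_iff_eventuallyEq.1 hz).fderiv_eq]
  simp

/-- Testing the weak gradient against the components of a vector field. -/
lemma HasWeakGradV.integral_mul_sum_gradV {f : Phase d → ℝ} {G : Phase d → Space d}
    (h : HasWeakGradV Ω f G) (hf : Integrable f (volume.restrict Ω))
    (hG : Integrable G (volume.restrict Ω)) (hK : IsCompact K) (hKΩ : K ⊆ Ω)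
    {V : Phase d → Space d} (hV : ContDiff ℝ ∞ V) (hVK : ∀ z, V z ≠ 0 → z ∈ K) :
    Integrable (fun z => f z * ∑ i, gradV (fun x => V x i) z i) (volume.restrict Ω) ∧
    ∫ z in Ω, f z * ∑ i, gradV (fun x => V x i) z i = -∫ z in Ω, inner ℝ (G z) (V z) := by
  have hVi : ∀ i, ContDiff ℝ ∞ fun x => V x i := fun i =>
    (EuclideanSpace.proj (𝕜 := ℝ) i).contDiff.comp hV
  have hVKi : ∀ i z, V z i ≠ 0 → z ∈ K := fun i z hz => hVK z fun h0 => hz (by simp [h0])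
  have hgK : ∀ i z, gradV (fun x => V x i) z ≠ 0 → z ∈ K := by
    intro i z hz
    by_contra hcon
    refine hz (gradV_eq_zero_of_notMem_tsupport (hVi i) fun hmem => hcon ?_)
    exact (closure_minimal (hVKi i) hK.isClosed) hmem
  have hint : ∀ i, Integrable (fun z => f z * gradV (fun x => V x i) z i) (volume.restrict Ω) :=
    fun i => Integrable.mul_compact hf hK
      ((EuclideanSpace.proj (𝕜 := ℝ) i).continuous.comp (continuous_gradV (hVi i)))
      fun z hz => hgK i z fun h0 => hz (by simp [h0])
  have hint2 : ∀ i, Integrable (fun z => V z i * G z i) (volume.restrict Ω) := by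
    intro i
    have := Integrable.mul_compact ((EuclideanSpace.proj (𝕜 := ℝ) i).integrable_comp hG) hK
      (hVi i).continuous (hVKi i)
    refine this.congr (Filter.Eventually.of_forall fun z => ?_)
    simp [mul_comm]
  have hi : ∀ i, ∫ z in Ω, f z * gradV (fun x => V x i) z i = -∫ z in Ω, V z i * G z i := by
    intro i
    -- The definition tests with scalars and gives a vector identity; its `i`-th component, tested
    -- with the `i`-th component of `V`, sums to the divergence formula.
    have h1 := h.integral_eq _ (isTestFunction_of_compact hK hKΩ (hVi i) (hVKi i))
    obtain ⟨M, hM⟩ := exists_norm_le_of_compact_support hK (continuous_gradV (hVi i)) (hgK i)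
    obtain ⟨M', hM'⟩ := exists_norm_le_of_compact_support hK (hVi i).continuous (hVKi i)
    have e1 := (EuclideanSpace.proj (𝕜 := ℝ) i).integral_comp_comm
      (hf.smul_bdd M (continuous_gradV (hVi i)).aestronglyMeasurable
        (Filter.Eventually.of_forall hM))
    have e2 := (EuclideanSpace.proj (𝕜 := ℝ) i).integral_comp_comm
      (hG.bdd_smul M' (hVi i).continuous.aestronglyMeasurable
        (Filter.Eventually.of_forall hM'))
    have e3 := congrArg (EuclideanSpace.proj (𝕜 := ℝ) i) h1
    rw [map_neg] at e3
    simpa [e1.symm, e2.symm] using (e1.trans e3).trans (congrArg Neg.neg e2.symm)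
  simp_rw [Finset.mul_sum]
  refine ⟨integrable_finsetSum _ fun i _ => hint i, ?_⟩
  rw [integral_finsetSum _ fun i _ => hint i]
  simp_rw [hi]
  rw [Finset.sum_neg_distrib, ← integral_finsetSum _ fun i _ => hint2 i]
  simp [PiLp.inner_apply]

/-- The weak inequality of a localized subsolution, tested with the kinetic kernel. -/
theorem IsWeakSubsolution.integral_kinKernel_le {p κ ε : ℝ}
    {A : Phase d → ℝ → Space d → Space d} {f φ : Phase d → ℝ} {G : Phase d → Space d}
    (h : IsWeakSubsolution p A Ω f G) (hf : Integrable f (volume.restrict Ω))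
    (hG : Integrable G (volume.restrict Ω))
    (hA : Integrable (fun z => A z (f z) (G z)) (volume.restrict Ω))
    (hK : IsCompact K) (hKΩ : K ⊆ Ω) (hφs : ContDiff ℝ ∞ φ) (hφ0 : ∀ z, 0 ≤ φ z)
    {ζ : ℝ → ℝ} (hζs : ContDiff ℝ ∞ ζ) (hζ : ∀ s ≤ ε, ζ s = 0) (hζ0 : ∀ s, 0 ≤ ζ s) (hε : 0 < ε)
    (z : Phase d) (hφK : ∀ z' ∈ tsupport φ, z'.1 ≤ z.1 - ε → z' ∈ K) :
    ∫ z' in Ω, f z' * (φ z' * kinKernel κ (deriv ζ) z z') ≤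
      ∫ z' in Ω, (φ z' * inner ℝ (G z') (kinFlux κ ζ z z') -
        inner ℝ (A z' (f z') (G z')) (φ z' • gradV (kinKernel κ ζ z) z' +
          kinKernel κ ζ z z' • gradV φ z') +
        f z' * (kinKernel κ ζ z z' * transport φ z') +
        f z' * inner ℝ (gradV φ z') (kinFlux κ ζ z z')) := by
  have hζ' : ∀ s ≤ ε, deriv ζ s = 0 := by
    have hcl : IsClosed {s | deriv ζ s = 0} :=
      isClosed_eq (hζs.continuous_deriv (by simp)) continuous_const
    have h1 : Set.Iio ε ⊆ {s | deriv ζ s = 0} := by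
      intro s hs
      have : ζ =ᶠ[nhds s] fun _ => 0 := by
        filter_upwards [Iio_mem_nhds hs] with x hx
        exact hζ x (le_of_lt hx)
      simp [this.deriv_eq]
    have h2 := hcl.closure_subset_iff.2 h1
    rw [closure_Iio] at h2
    exact fun s hs => h2 hs
  have hζs' : ContDiff ℝ ∞ (deriv ζ) := hζs.iterate_deriv 1
  have hk : ContDiff ℝ ∞ (kinKernel κ ζ z) := contDiff_kinKernel hζs hζ hε z
  have hk' : ContDiff ℝ ∞ (kinKernel κ (deriv ζ) z) := contDiff_kinKernel hζs' hζ' hε z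
  have hJ : ContDiff ℝ ∞ (kinFlux κ ζ z) := contDiff_kinFlux hζs hζ hε z
  have hkd : Differentiable ℝ (kinKernel κ ζ z) := hk.differentiable (by simp)
  have hφd : Differentiable ℝ φ := hφs.differentiable (by simp)
  have htime : ∀ (ξ : ℝ → ℝ) (_ : ∀ s ≤ ε, ξ s = 0) (z' : Phase d), ξ (z.1 - z'.1) ≠ 0 →
      z'.1 ≤ z.1 - ε := by
    intro ξ hξ z' hz'
    by_contra hcon
    exact hz' (hξ _ (by linarith))
  -- The cutoff does not vanish near the final time. Compact support comes from the kernel, which is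
  -- zero unless `t' ≤ t - ε`.
  have hkK : ∀ z', φ z' * kinKernel κ ζ z z' ≠ 0 → z' ∈ K := by
    intro z' hz'
    exact hφK z' (subset_tsupport φ (left_ne_zero_of_mul hz'))
      (htime ζ hζ z' fun h0 => hz' (by simp [kinKernel, h0]))
  have hkK' : ∀ z', φ z' * kinKernel κ (deriv ζ) z z' ≠ 0 → z' ∈ K := by
    intro z' hz'
    exact hφK z' (subset_tsupport φ (left_ne_zero_of_mul hz'))
      (htime _ hζ' z' fun h0 => hz' (by simp [kinKernel, h0]))
  have hJK : ∀ z', φ z' • kinFlux κ ζ z z' ≠ 0 → z' ∈ K := by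
    intro z' hz'
    exact hφK z' (subset_tsupport φ fun h0 => hz' (by simp [h0]))
      (htime ζ hζ z' fun h0 => hz' (by simp [kinFlux, h0]))
  have hθs : ContDiff ℝ ∞ fun z' => φ z' * kinKernel κ ζ z z' := hφs.mul hk
  have hθ : IsTestFunction Ω fun z' => φ z' * kinKernel κ ζ z z' :=
    isTestFunction_of_compact hK hKΩ hθs hkK
  have hweak := h.weak_ineq _ hθ fun z' => mul_nonneg (hφ0 z') (by
    unfold kinKernel gaussW
    by_cases hs : z.1 - z'.1 ≤ ε
    · simp [hζ _ hs]
    · have : 0 < z.1 - z'.1 := by linarith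
      have := hζ0 (z.1 - z'.1)
      positivity)
  have hVs : ContDiff ℝ ∞ fun z' => φ z' • kinFlux κ ζ z z' := hφs.smul hJ
  obtain ⟨hX3, hX34⟩ := h.hasWeakGradV.integral_mul_sum_gradV hf hG hK hKΩ hVs hJK
  have hX4 := Integrable.inner_compact hG hK hVs.continuous hJK
  have htsub : tsupport (fun z' => φ z' * kinKernel κ ζ z z') ⊆ K :=
    closure_minimal hkK hK.isClosed
  have hX1 : Integrable (fun z' => -f z' * transport (fun z' => φ z' * kinKernel κ ζ z z') z' +
      inner ℝ (A z' (f z') (G z')) (gradV (fun z' => φ z' * kinKernel κ ζ z z') z'))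
      (volume.restrict Ω) := by
    refine (Integrable.mul_compact hf.neg hK (continuous_transport hθs) ?_).add
      (Integrable.inner_compact hA hK (continuous_gradV hθs) ?_)
    · intro z' hz'
      by_contra hcon
      exact hz' (transport_eq_zero_of_notMem_tsupport fun hm => hcon (htsub hm))
    · intro z' hz'
      by_contra hcon
      exact hz' (gradV_eq_zero_of_notMem_tsupport hθs fun hm => hcon (htsub hm))
  have hX0 := Integrable.mul_compact hf hK (hφs.mul hk').continuous hkK'
  -- Pointwise, the claimed right-hand integrand is the left-hand one, minus the weak inequality's
  -- integrand, plus an expression that integrates to zero by the definition of `∇_v f` tested with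
  -- `φ J`.
  have hRid : ∀ z', φ z' * inner ℝ (G z') (kinFlux κ ζ z z') -
        inner ℝ (A z' (f z') (G z')) (φ z' • gradV (kinKernel κ ζ z) z' +
          kinKernel κ ζ z z' • gradV φ z') +
        f z' * (kinKernel κ ζ z z' * transport φ z') +
        f z' * inner ℝ (gradV φ z') (kinFlux κ ζ z z') =
      f z' * (φ z' * kinKernel κ (deriv ζ) z z') -
      (-f z' * transport (fun z' => φ z' * kinKernel κ ζ z z') z' +
      inner ℝ (A z' (f z') (G z')) (gradV (fun z' => φ z' * kinKernel κ ζ z z') z')) +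
      (f z' * ∑ i, gradV (fun x => (φ x • kinFlux κ ζ z x) i) z' i +
        inner ℝ (G z') (φ z' • kinFlux κ ζ z z')) := by
    intro z'
    have e1 : ∑ i, gradV (fun x => (φ x • kinFlux κ ζ z x) i) z' i =
        φ z' * ∑ i, gradV (fun x => kinFlux κ ζ z x i) z' i +
          inner ℝ (gradV φ z') (kinFlux κ ζ z z') := by
      rw [PiLp.inner_apply, Finset.mul_sum, ← Finset.sum_add_distrib]
      refine Finset.sum_congr rfl fun i _ => ?_
      have hJi : DifferentiableAt ℝ (fun x => kinFlux κ ζ z x i) z' :=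
        ((EuclideanSpace.proj (𝕜 := ℝ) i).contDiff.comp hJ).differentiable (by simp) z'
      have := congrArg (fun w : Space d => w i) (gradV_mul (hφd z') hJi)
      simpa using this
    rw [e1, transport_mul (hφd z') (hkd z'), gradV_mul (hφd z') (hkd z'),
      transport_kinKernel hζs hζ hε, real_inner_smul_right]
    ring
  simp_rw [hRid]
  have e1 := integral_add (hX0.sub hX1) (hX3.add hX4)
  have e2 := integral_sub hX0 hX1
  have e3 := integral_add hX3 hX4
  simp only [Pi.add_apply, Pi.sub_apply] at e1 e2 e3
  rw [e1, e2, e3, hX34]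
  linarith

end weak

/-! ### Size of the kernel, its velocity gradient and its flux -/

section bounds
variable {d : ℕ} {κ : ℝ} {z z' : Phase d} {ζ : ℝ → ℝ}

lemma gaussW_nonneg (b : ℝ) (a : Space d × Space d) : 0 ≤ gaussW b a := (Real.exp_pos _).le

lemma gaussW_half_le (a : Space d × Space d) : gaussW (1 / 2) a ≤ gaussW (1 / 4) a := by
  unfold gaussW
  refine Real.exp_le_exp.2 ?_
  nlinarith [sq_nonneg ‖a.1‖, sq_nonneg ‖a.2‖]

/-- Half of the Gaussian exponent absorbs a linear factor: `r ≤ 1 + r ^ 2 / 4 ≤ exp (r ^ 2 / 4)`. -/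
lemma gaussW_half_mul_le (a : Space d × Space d) {r : ℝ}
    (hr : r ^ 2 ≤ ‖a.1‖ ^ 2 + ‖a.2‖ ^ 2) : gaussW (1 / 2) a * r ≤ gaussW (1 / 4) a := by
  unfold gaussW
  set x := ‖a.1‖ ^ 2 + ‖a.2‖ ^ 2
  have h1 : r ≤ Real.exp (x / 4) := by
    have := Real.add_one_le_exp (x / 4)
    nlinarith [sq_nonneg (r - 2)]
  calc Real.exp (-(1 / 2) * x) * r ≤ Real.exp (-(1 / 2) * x) * Real.exp (x / 4) := by gcongr
    _ = Real.exp (-(1 / 4) * x) := by rw [← Real.exp_add]; congr 1; ring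

lemma kinKernel_nonneg (hζ0 : ∀ s, 0 ≤ ζ s) (hs : 0 ≤ z.1 - z'.1) : 0 ≤ kinKernel κ ζ z z' :=
  mul_nonneg (mul_nonneg (hζ0 _) (Real.rpow_nonneg hs _)) (gaussW_nonneg _ _)

lemma kinKernel_le (hζ1 : ∀ s, ζ s ≤ 1) (hs : 0 ≤ z.1 - z'.1) :
    kinKernel κ ζ z z' ≤ (z.1 - z'.1) ^ (1 - 1 - (d : ℝ) * (1 + 2 * κ)) *
      gaussW (1 / 4) (kinY κ z z', kinU κ z z') := by
  unfold kinKernel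
  rw [sub_self, zero_sub]
  have := Real.rpow_nonneg hs (-((d : ℝ) * (1 + 2 * κ)))
  refine mul_le_mul ?_ (gaussW_half_le _) (gaussW_nonneg _ _) this
  exact mul_le_of_le_one_left this (hζ1 _)

lemma norm_kinFlux_le (hζ0 : ∀ s, 0 ≤ ζ s) (hζ1 : ∀ s, ζ s ≤ 1) (hs : 0 ≤ z.1 - z'.1) :
    ‖kinFlux κ ζ z z'‖ ≤ (|κ * (1 + κ) - 1| + |1 + 2 * κ|) *
      ((z.1 - z'.1) ^ (κ - 1 - (d : ℝ) * (1 + 2 * κ)) *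
      gaussW (1 / 4) (kinY κ z z', kinU κ z z')) := by
  unfold kinFlux
  set y := kinY κ z z'
  set u := kinU κ z z'
  set S := (z.1 - z'.1) ^ (κ - 1 - (d : ℝ) * (1 + 2 * κ))
  have hS : 0 ≤ S := Real.rpow_nonneg hs _
  have hw := gaussW_nonneg (1 / 2) (y, u)
  have h1 : gaussW (1 / 2) (y, u) * ‖y‖ ≤ gaussW (1 / 4) (y, u) :=
    gaussW_half_mul_le _ (by simp only; nlinarith [sq_nonneg ‖u‖])
  have h2 : gaussW (1 / 2) (y, u) * ‖u‖ ≤ gaussW (1 / 4) (y, u) :=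
    gaussW_half_mul_le _ (by simp only; nlinarith [sq_nonneg ‖y‖])
  rw [norm_smul, Real.norm_eq_abs, abs_mul, abs_mul, abs_of_nonneg (hζ0 _), abs_of_nonneg hS,
    abs_of_nonneg hw]
  calc _ ≤ 1 * S * gaussW (1 / 2) (y, u) *
        (|κ * (1 + κ) - 1| * ‖y‖ + |1 + 2 * κ| * ‖u‖) := by
        gcongr
        · exact hζ1 _
        · refine (norm_sub_le _ _).trans ?_
          rw [norm_smul, norm_smul, Real.norm_eq_abs, Real.norm_eq_abs]
    _ = S * (|κ * (1 + κ) - 1| * (gaussW (1 / 2) (y, u) * ‖y‖) +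
          |1 + 2 * κ| * (gaussW (1 / 2) (y, u) * ‖u‖)) := by ring
    _ ≤ S * (|κ * (1 + κ) - 1| * gaussW (1 / 4) (y, u) +
          |1 + 2 * κ| * gaussW (1 / 4) (y, u)) := by gcongr
    _ = _ := by ring

lemma norm_gradV_kinKernel_le {ε : ℝ} (hζs : ContDiff ℝ ∞ ζ) (hζ : ∀ s ≤ ε, ζ s = 0) (hε : 0 < ε)
    (hζ0 : ∀ s, 0 ≤ ζ s) (hζ1 : ∀ s, ζ s ≤ 1) (hs : 0 < z.1 - z'.1) :
    ‖gradV (kinKernel κ ζ z) z'‖ ≤ (z.1 - z'.1) ^ (1 - κ - 1 - (d : ℝ) * (1 + 2 * κ)) *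
      gaussW (1 / 4) (kinY κ z z', kinU κ z z') := by
  have h1 : gradV (kinKernel κ ζ z) z' =
      -(kinKernel κ ζ z z' * (z.1 - z'.1) ^ (-κ)) • kinU κ z z' := by
    refine ext_inner_right ℝ fun w => ?_
    rw [inner_gradV_kinKernel hζs hζ hε, real_inner_smul_left]
    ring
  rw [h1, norm_smul, norm_neg, Real.norm_eq_abs, abs_mul,
    abs_of_nonneg (kinKernel_nonneg hζ0 hs.le), abs_of_pos (by positivity)]
  unfold kinKernel
  set y := kinY κ z z'
  set u := kinU κ z z'
  have hw := gaussW_nonneg (1 / 2) (y, u)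
  have h2 : gaussW (1 / 2) (y, u) * ‖u‖ ≤ gaussW (1 / 4) (y, u) :=
    gaussW_half_mul_le _ (by simp only; nlinarith [sq_nonneg ‖y‖])
  have h3 : (z.1 - z'.1) ^ (1 - κ - 1 - (d : ℝ) * (1 + 2 * κ)) =
      (z.1 - z'.1) ^ (-((d : ℝ) * (1 + 2 * κ))) * (z.1 - z'.1) ^ (-κ) := by
    rw [← Real.rpow_add hs]; congr 1; ring
  rw [h3]
  calc _ = ζ (z.1 - z'.1) * ((z.1 - z'.1) ^ (-((d : ℝ) * (1 + 2 * κ))) *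
        (z.1 - z'.1) ^ (-κ)) * (gaussW (1 / 2) (y, u) * ‖u‖) := by ring
    _ ≤ 1 * ((z.1 - z'.1) ^ (-((d : ℝ) * (1 + 2 * κ))) *
        (z.1 - z'.1) ^ (-κ)) * gaussW (1 / 4) (y, u) := by
        gcongr
        exact hζ1 _
    _ = _ := by ring

end bounds

/-- Sorts the tested integrand by kernel: `m₁`, `m₂`, `m₃` stand for the sizes of the flux, the
velocity gradient and the kernel, and each collects the data it acts on. These become the three
fractional integrals. -/
lemma abs_kernel_remainder_le {E : Type*} [NormedAddCommGroup E] [InnerProductSpace ℝ E]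
    {φ f k T α γt γv c m₁ m₂ m₃ : ℝ} {G J a g D : E} (hφ0 : 0 ≤ φ) (hφ1 : φ ≤ 1)
    (hk0 : 0 ≤ k) (ha : ‖a‖ ≤ α) (hT : |T| ≤ γt) (hD : ‖D‖ ≤ γv) (hJ : ‖J‖ ≤ c * m₁)
    (hg : ‖g‖ ≤ m₂) (hk : k ≤ m₃) (hc : 0 ≤ c) (hm₁ : 0 ≤ m₁) :
    |φ * inner ℝ G J - inner ℝ a (φ • g + k • D) + f * (k * T) + f * inner ℝ D J| ≤
      (c + 1) * (m₁ * (‖G‖ + γv * |f|) + m₂ * α + m₃ * (γt * |f| + γv * α)) := by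
  have hα : 0 ≤ α := (norm_nonneg _).trans ha
  have hγv : 0 ≤ γv := (norm_nonneg _).trans hD
  have hγt : 0 ≤ γt := (abs_nonneg _).trans hT
  have hm₂ : 0 ≤ m₂ := (norm_nonneg _).trans hg
  have hm₃ : 0 ≤ m₃ := hk0.trans hk
  have e1 : |φ * inner ℝ G J| ≤ ‖G‖ * (c * m₁) := by
    rw [abs_mul, abs_of_nonneg hφ0]
    refine (mul_le_of_le_one_left (abs_nonneg _) hφ1).trans ?_
    exact (abs_real_inner_le_norm _ _).trans (by gcongr)
  have e2 : |inner ℝ a (φ • g + k • D)| ≤ α * (m₂ + m₃ * γv) := by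
    refine (abs_real_inner_le_norm _ _).trans ?_
    gcongr
    refine (norm_add_le _ _).trans ?_
    rw [norm_smul, norm_smul, Real.norm_eq_abs, Real.norm_eq_abs, abs_of_nonneg hφ0,
      abs_of_nonneg hk0]
    gcongr
    exact (mul_le_of_le_one_left (norm_nonneg _) hφ1).trans hg
  have e3 : |f * (k * T)| ≤ |f| * (m₃ * γt) := by
    rw [abs_mul, abs_mul, abs_of_nonneg hk0]; gcongr
  have e4 : |f * inner ℝ D J| ≤ |f| * (γv * (c * m₁)) := by
    rw [abs_mul]
    gcongr
    refine (abs_real_inner_le_norm _ _).trans ?_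
    gcongr
  have h5 := abs_add_le (φ * inner ℝ G J - inner ℝ a (φ • g + k • D) + f * (k * T))
    (f * inner ℝ D J)
  have h6 := abs_add_le (φ * inner ℝ G J - inner ℝ a (φ • g + k • D)) (f * (k * T))
  have h7 := abs_sub (φ * inner ℝ G J) (inner ℝ a (φ • g + k • D))
  have p1 : 0 ≤ m₁ * (‖G‖ + γv * |f|) := by positivity
  have p2 : 0 ≤ c * (m₂ * α + m₃ * (γt * |f| + γv * α)) := by positivity
  nlinarith

/-! ### Gaussian masses and the averaging measure -/

/-- The Gaussian weight with values in `ℝ≥0∞`. -/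
noncomputable def gaussENN {d : ℕ} (b : ℝ) (a : Space d × Space d) : ENNReal :=
  ENNReal.ofReal (gaussW b a)

section gaussENN
variable {d : ℕ}

lemma measurable_gaussW (b : ℝ) : Measurable (gaussW (d := d) b) :=
  (contDiff_gaussW b).continuous.measurable

lemma measurable_gaussENN (b : ℝ) : Measurable (gaussENN (d := d) b) :=
  (measurable_gaussW b).ennreal_ofReal

lemma lintegral_gaussENN_ne_top {b : ℝ} (hb : 0 < b) : ∫⁻ a, gaussENN (d := d) b a ≠ ⊤ := by
  have h1 : Integrable fun v : Space d => Real.exp (-b * ‖v‖ ^ 2) := by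
    have := (GaussianFourier.integrable_cexp_neg_mul_sq_norm_add (b := (b : ℂ)) (V := Space d)
      (by simpa using hb) 0 0).norm
    refine this.congr (Filter.Eventually.of_forall fun v => ?_)
    simp only [Complex.norm_exp]
    congr 1
    simp [← Complex.ofReal_pow]
  have h2 : Integrable (gaussW (d := d) b) := by
    refine (h1.mul_prod h1).congr (Filter.Eventually.of_forall fun a => ?_)
    simp only [gaussW, ← Real.exp_add]
    congr 1; ring
  exact h2.lintegral_lt_top.ne

lemma gaussENN_rpow (b : ℝ) {P : ℝ} (a : Space d × Space d) :
    gaussENN b a ^ P = gaussENN (b * P) a := by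
  unfold gaussENN gaussW
  rw [ENNReal.ofReal_rpow_of_pos (Real.exp_pos _), ← Real.exp_mul]
  congr 2; ring

lemma lintegral_gaussENN_ne_zero (b : ℝ) : ∫⁻ a, gaussENN (d := d) b a ≠ 0 := by
  rw [Ne, lintegral_eq_zero_iff (measurable_gaussENN b)]
  intro h
  have : (Set.univ : Set (Space d × Space d)) ⊆ {a | ¬ gaussENN b a = 0} := by
    intro a _
    simp [gaussENN, gaussW, Real.exp_pos]
  have h0 : volume {a : Space d × Space d | ¬ gaussENN b a = 0} = 0 := h
  exact (NeZero.ne (volume : Measure (Space d × Space d)))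
    (Measure.measure_univ_eq_zero.1 (measure_mono_null this h0))

end gaussENN

lemma measurable_kinY {d : ℕ} (κ : ℝ) (z : Phase d) : Measurable (kinY κ z) := by
  unfold kinY; fun_prop

lemma measurable_kinU {d : ℕ} (κ : ℝ) (z : Phase d) : Measurable (kinU κ z) := by
  have := measurable_kinY κ z
  unfold kinU; fun_prop

lemma measurable_kinKernel {d : ℕ} (κ : ℝ) {ζ : ℝ → ℝ} (hζ : Measurable ζ) (z : Phase d) :
    Measurable (kinKernel κ ζ z) := by
  have h1 := measurable_kinY κ z
  have h2 := measurable_kinU κ z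
  have h3 := measurable_gaussW (d := d) (1 / 2)
  unfold kinKernel
  fun_prop

/-- The Jacobian `s ^ (d (1 + 2κ))` of the displacements cancels the singular power in the kernel
and leaves the weight `s ^ (β - 1)`. -/
lemma lintegral_kernel_eq_fracOp {d : ℕ} (κ β b : ℝ) (z : Phase d) {g : Phase d → ENNReal}
    (hg : Measurable g) :
    ∫⁻ z' in {z' : Phase d | z'.1 < z.1},
      ENNReal.ofReal ((z.1 - z'.1) ^ (β - 1 - (d : ℝ) * (1 + 2 * κ)) *
        gaussW b (kinY κ z z', kinU κ z z')) * g z' =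
      fracOp κ β (gaussENN b) g (Set.Ioi 0) z := by
  have h1 := measurable_kinY κ z
  have h2 := measurable_kinU κ z
  have h3 := measurable_gaussW (d := d) b
  rw [lintegral_past_eq κ z (by fun_prop)]
  unfold fracOp
  refine setLIntegral_congr_fun measurableSet_Ioi fun s hs => ?_
  have hs : 0 < s := hs
  have hk : Measurable fun a : Space d × Space d => g (kinShift κ z s a) :=
    hg.comp ((measurable_kinShift κ).comp (by fun_prop :
      Measurable fun a : Space d × Space d => (z, s, a)))
  have hsub : ∀ a, z.1 - (kinShift κ z s a).1 = s := fun a => by simp [kinShift]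
  have hw := measurable_gaussENN (d := d) b
  simp only [kinY_kinShift κ z hs, kinU_kinShift κ z hs, hsub]
  rw [← lintegral_const_mul _ (by
      exact (by fun_prop : Measurable fun a : Space d × Space d =>
        ENNReal.ofReal (s ^ (β - 1 - (d : ℝ) * (1 + 2 * κ)) * gaussW b (a.1, a.2))).mul hk),
    ← lintegral_const_mul _ (by exact hk.mul hw)]
  refine lintegral_congr fun a => ?_
  rw [← mul_assoc, ← ENNReal.ofReal_mul (by positivity), ← mul_assoc, ← Real.rpow_add hs]
  have e1 : (d : ℝ) * (1 + 2 * κ) + (β - 1 - (d : ℝ) * (1 + 2 * κ)) = β - 1 := by ring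
  rw [e1, ENNReal.ofReal_mul (by positivity), gaussENN]
  ring

/-- The averaging measure of the displacements. -/
noncomputable def avgMeasure (d : ℕ) : Measure (ℝ × Space d × Space d) :=
  ((volume.restrict (Set.Ioi 0)).withDensity
    fun σ => ENNReal.ofReal (deriv Real.smoothTransition (σ - 1))).prod
  (volume.withDensity (gaussENN (1 / 2)))

section average
variable {d : ℕ}

lemma deriv_smoothTransition_nonneg (x : ℝ) : 0 ≤ deriv Real.smoothTransition x :=
  Real.smoothTransition.monotone.deriv_nonneg

lemma continuous_deriv_smoothTransition : Continuous (deriv Real.smoothTransition) :=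
  Real.smoothTransition.contDiff.continuous_deriv (n := 1) le_rfl

lemma deriv_smoothTransition_of_one_lt {x : ℝ} (hx : 1 < x) :
    deriv Real.smoothTransition x = 0 := by
  have : Real.smoothTransition =ᶠ[nhds x] fun _ => 1 := by
    filter_upwards [Ioi_mem_nhds hx] with y hy
    exact Real.smoothTransition.one_of_one_le (le_of_lt hy)
  simp [this.deriv_eq]

/-- The time density lives on `1 ≤ σ ≤ 2`, where the transition climbs from `0` to `1`. With the
positive Gaussian mass, this makes the averaging measure finite and nonzero. -/
lemma lintegral_deriv_smoothTransition :
    ∫⁻ σ in Set.Ioi (0 : ℝ), ENNReal.ofReal (deriv Real.smoothTransition (σ - 1)) = 1 := by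
  have hc : Continuous fun σ : ℝ => deriv Real.smoothTransition (σ - 1) :=
    continuous_deriv_smoothTransition.comp (by fun_prop)
  have h1 : ∫⁻ σ in Set.Ioi (0 : ℝ), ENNReal.ofReal (deriv Real.smoothTransition (σ - 1)) =
      ∫⁻ σ in Set.Ioc (0 : ℝ) 2, ENNReal.ofReal (deriv Real.smoothTransition (σ - 1)) := by
    rw [← lintegral_indicator measurableSet_Ioi, ← lintegral_indicator measurableSet_Ioc]
    refine lintegral_congr fun σ => ?_
    by_cases h0 : 0 < σ
    · by_cases h2 : σ ≤ 2
      · simp [h0, h2]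
      · have : deriv Real.smoothTransition (σ - 1) = 0 :=
          deriv_smoothTransition_of_one_lt (by linarith [not_le.1 h2])
        simp [Set.indicator, this]
    · simp [h0]
  rw [h1, ← ofReal_integral_eq_lintegral_ofReal]
  · rw [← intervalIntegral.integral_of_le (by norm_num),
      intervalIntegral.integral_eq_sub_of_hasDerivAt
        (f := fun σ => Real.smoothTransition (σ - 1)) ?_ (hc.intervalIntegrable _ _)]
    · rw [Real.smoothTransition.one_of_one_le (by norm_num),
        Real.smoothTransition.zero_of_nonpos (by norm_num)]
      simp
    · intro σ _
      have := ((Real.smoothTransition.contDiff (n := 1)).differentiable one_ne_zero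
        (σ - 1)).hasDerivAt.comp σ ((hasDerivAt_id σ).sub_const 1)
      simpa [Function.comp_def] using this
  · exact (hc.integrableOn_Icc (a := 0) (b := 2)).mono_set Set.Ioc_subset_Icc_self
  · exact Filter.Eventually.of_forall fun σ => deriv_smoothTransition_nonneg _

instance isFiniteMeasure_gaussENN :
    IsFiniteMeasure ((volume : Measure (Space d × Space d)).withDensity (gaussENN (1 / 2))) :=
  isFiniteMeasure_withDensity (lintegral_gaussENN_ne_top (by norm_num))

instance isFiniteMeasure_deriv_smoothTransition :
    IsFiniteMeasure (((volume : Measure ℝ).restrict (Set.Ioi 0)).withDensity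
      fun σ => ENNReal.ofReal (deriv Real.smoothTransition (σ - 1))) :=
  isFiniteMeasure_withDensity (by rw [lintegral_deriv_smoothTransition]; simp)

instance isFiniteMeasure_avgMeasure : IsFiniteMeasure (avgMeasure d) := by
  unfold avgMeasure; infer_instance

lemma avgMeasure_univ_ne_zero : avgMeasure d Set.univ ≠ 0 := by
  rw [avgMeasure, ← Set.univ_prod_univ, Measure.prod_prod, withDensity_apply _ .univ,
    withDensity_apply _ .univ, Measure.restrict_univ, Measure.restrict_univ,
    lintegral_deriv_smoothTransition, one_mul]
  exact lintegral_gaussENN_ne_zero _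

lemma lintegral_Ioi_comp_mul {ε : ℝ} (hε : 0 < ε) {g : ℝ → ENNReal} (hg : Measurable g) :
    ∫⁻ σ in Set.Ioi (0 : ℝ), g (ε * σ) = ENNReal.ofReal ε⁻¹ * ∫⁻ s in Set.Ioi (0 : ℝ), g s := by
  rw [← lintegral_indicator measurableSet_Ioi, ← lintegral_indicator measurableSet_Ioi]
  have h1 : ∀ σ, (Set.Ioi (0 : ℝ)).indicator (fun σ => g (ε * σ)) σ =
      (Set.Ioi (0 : ℝ)).indicator g (ε * σ) := by
    intro σ
    simp [Set.indicator, hε]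
  simp_rw [h1]
  rw [← lintegral_map (f := (Set.Ioi (0 : ℝ)).indicator g) (hg.indicator measurableSet_Ioi)
    (by fun_prop : Measurable fun σ : ℝ => ε * σ), Real.map_volume_mul_left hε.ne',
    lintegral_smul_measure, abs_of_pos (by positivity), smul_eq_mul]

/-- Identifies integration against the `ζ'` kernel as an average over displacements at scale `ε`:
substitute `s = ε σ`, and cancel the Jacobian against the power of `s`. Hence the mass of the
average does not depend on `ε`. -/
lemma lintegral_avgMeasure (κ : ℝ) {ε : ℝ} (hε : 0 < ε) (z : Phase d) {F : Phase d → ENNReal}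
    (hF : Measurable F) :
    ∫⁻ b, F (kinShift κ z (ε * b.1) b.2) ∂(avgMeasure d) =
      ∫⁻ z' in {z' : Phase d | z'.1 < z.1}, ENNReal.ofReal
        (kinKernel κ (deriv fun s => Real.smoothTransition (s / ε - 1)) z z') * F z' := by
  have hder : (deriv fun s => Real.smoothTransition (s / ε - 1)) =
      fun s => deriv Real.smoothTransition (s / ε - 1) * ε⁻¹ := by
    ext1 s
    have := ((Real.smoothTransition.contDiff (n := 1)).differentiable one_ne_zero
      (s / ε - 1)).hasDerivAt.comp s (((hasDerivAt_id s).div_const ε).sub_const 1)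
    simpa [Function.comp_def] using this.deriv
  have hdc := continuous_deriv_smoothTransition.measurable
  rw [hder]
  have hkm : Measurable (kinKernel κ (fun s => deriv Real.smoothTransition (s / ε - 1) * ε⁻¹) z) :=
    measurable_kinKernel κ (by fun_prop) z
  have hks : Measurable fun b : ℝ × Space d × Space d => F (kinShift κ z b.1 b.2) :=
    hF.comp ((measurable_kinShift κ).comp (by fun_prop :
      Measurable fun b : ℝ × Space d × Space d => (z, b)))
  have hkε : Measurable fun b : ℝ × Space d × Space d => F (kinShift κ z (ε * b.1) b.2) :=
    hks.comp (by fun_prop : Measurable fun b : ℝ × Space d × Space d => (ε * b.1, b.2))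
  have hgm := measurable_gaussENN (d := d) (1 / 2)
  have hkF : Measurable fun z' => ENNReal.ofReal (kinKernel κ
      (fun s => deriv Real.smoothTransition (s / ε - 1) * ε⁻¹) z z') * F z' :=
    hkm.ennreal_ofReal.mul hF
  rw [lintegral_past_eq κ z hkF, avgMeasure,
    lintegral_prod _ hkε.aemeasurable,
    lintegral_withDensity_eq_lintegral_mul _ (by fun_prop) (by exact hkε.lintegral_prod_right')]
  have hkv : Measurable fun b : ℝ × Space d × Space d =>
      gaussENN (1 / 2) b.2 * F (kinShift κ z b.1 b.2) := (hgm.comp measurable_snd).mul hks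
  have hinner : ∀ s : ℝ, ∫⁻ a, F (kinShift κ z s a) ∂((volume :
      Measure (Space d × Space d)).withDensity (gaussENN (1 / 2))) =
      ∫⁻ a, gaussENN (1 / 2) a * F (kinShift κ z s a) := by
    intro s
    rw [lintegral_withDensity_eq_lintegral_mul _ hgm (by
      exact hks.comp (measurable_const.prodMk measurable_id))]
    rfl
  simp only [Pi.mul_apply, hinner]
  have hscale := lintegral_Ioi_comp_mul hε (g := fun s =>
    ENNReal.ofReal (deriv Real.smoothTransition (s / ε - 1)) *
      ∫⁻ a, gaussENN (1 / 2) a * F (kinShift κ z s a))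
    ((by fun_prop : Measurable fun s : ℝ =>
      ENNReal.ofReal (deriv Real.smoothTransition (s / ε - 1))).mul hkv.lintegral_prod_right')
  simp only [mul_div_cancel_left₀ _ hε.ne'] at hscale
  rw [hscale, ← lintegral_const_mul _ (by
    exact (by fun_prop : Measurable fun s : ℝ =>
      ENNReal.ofReal (deriv Real.smoothTransition (s / ε - 1))).mul hkv.lintegral_prod_right')]
  refine setLIntegral_congr_fun measurableSet_Ioi fun s hs => ?_
  have hs : 0 < s := hs
  have hks' : Measurable fun a : Space d × Space d => F (kinShift κ z s a) :=
    hks.comp (measurable_const.prodMk measurable_id)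
  have hsub : ∀ a, z.1 - (kinShift κ z s a).1 = s := fun a => by simp [kinShift]
  simp only [kinKernel, kinY_kinShift κ z hs, kinU_kinShift κ z hs, hsub]
  have hgw := measurable_gaussW (d := d) (1 / 2)
  rw [← mul_assoc, ← lintegral_const_mul _ (by exact hgm.mul hks'), ← lintegral_const_mul _ (by
    exact (by fun_prop : Measurable fun a : Space d × Space d =>
      ENNReal.ofReal (deriv Real.smoothTransition (s / ε - 1) * ε⁻¹ *
        s ^ (-((d : ℝ) * (1 + 2 * κ))) * gaussW (1 / 2) (a.1, a.2))).mul hks')]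
  refine lintegral_congr fun a => ?_
  have hd0 := deriv_smoothTransition_nonneg (s / ε - 1)
  rw [← mul_assoc, ← mul_assoc, gaussENN, ← ENNReal.ofReal_mul (by positivity),
    ← ENNReal.ofReal_mul (by positivity), ← ENNReal.ofReal_mul (by positivity)]
  congr 2
  rw [Real.rpow_neg hs.le]
  field_simp

end average

/-! ### Averages of a subsolution bounded by fractional integrals -/

lemma ofReal_sum_three_mul_le {a b c x y z : ℝ} (ha : 0 ≤ a) (hb : 0 ≤ b) (hc : 0 ≤ c) :
    ENNReal.ofReal (a * x + b * y + c * z) ≤ ENNReal.ofReal a * ENNReal.ofReal x +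
      ENNReal.ofReal b * ENNReal.ofReal y + ENNReal.ofReal c * ENNReal.ofReal z := by
  rw [← ENNReal.ofReal_mul ha, ← ENNReal.ofReal_mul hb, ← ENNReal.ofReal_mul hc]
  exact ENNReal.ofReal_add_le.trans (by gcongr; exact ENNReal.ofReal_add_le)

section average
variable {d : ℕ} {Ω K : Set (Phase d)}

/-- Averages of a localized subsolution are controlled by fractional integrals of its velocity
gradient and of the terms created by the cutoff. -/
theorem IsWeakSubsolution.average_le {p κ γt γv : ℝ}
    {A : Phase d → ℝ → Space d → Space d} {f φ α : Phase d → ℝ} {G : Phase d → Space d}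
    (h : IsWeakSubsolution p A Ω f G) (hΩ : MeasurableSet Ω)
    (hf0 : ∀ᵐ z ∂(volume.restrict Ω), 0 ≤ f z) (hf : Integrable f (volume.restrict Ω))
    (hG : Integrable G (volume.restrict Ω))
    (hA : Integrable (fun z => A z (f z) (G z)) (volume.restrict Ω))
    (hAα : ∀ᵐ z ∂(volume.restrict Ω), ‖A z (f z) (G z)‖ ≤ α z)
    (hφs : ContDiff ℝ ∞ φ) (hφ0 : ∀ z, 0 ≤ φ z) (hφ1 : ∀ z, φ z ≤ 1)
    (hT : ∀ z ∈ Ω, |transport φ z| ≤ γt) (hD : ∀ z ∈ Ω, ‖gradV φ z‖ ≤ γv)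
    {F : Phase d → ℝ} (hFm : Measurable F) (hF : ∀ᵐ z ∂(volume.restrict Ω), F z = f z * φ z)
    (hF0 : ∀ z ∉ Ω, F z = 0)
    {g₁ g₂ g₃ : Phase d → ENNReal} (hg₁ : Measurable g₁) (hg₂ : Measurable g₂)
    (hg₃ : Measurable g₃)
    (hg₁G : ∀ᵐ z ∂(volume.restrict Ω), ENNReal.ofReal (‖G z‖ + γv * |f z|) ≤ g₁ z)
    (hg₂α : ∀ᵐ z ∂(volume.restrict Ω), ENNReal.ofReal (α z) ≤ g₂ z)
    (hg₃f : ∀ᵐ z ∂(volume.restrict Ω), ENNReal.ofReal (γt * |f z| + γv * α z) ≤ g₃ z)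
    (z : Phase d) {ε : ℝ} (hε : 0 < ε) (hK : IsCompact K) (hKΩ : K ⊆ Ω)
    (hφK : ∀ z' ∈ tsupport φ, z'.1 ≤ z.1 - ε → z' ∈ K) :
    ∫⁻ b, ‖F (kinShift κ z (ε * b.1) b.2)‖ₑ ∂(avgMeasure d) ≤
      ENNReal.ofReal (|κ * (1 + κ) - 1| + |1 + 2 * κ| + 1) *
        (fracOp κ κ (gaussENN (1 / 4)) g₁ (Set.Ioi 0) z +
          fracOp κ (1 - κ) (gaussENN (1 / 4)) g₂ (Set.Ioi 0) z +
          fracOp κ 1 (gaussENN (1 / 4)) g₃ (Set.Ioi 0) z) := by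
  -- Rises from `0` to `1` between `s = ε` and `s = 2ε`. The bounds below only use `0 ≤ ζ ≤ 1`, so
  -- they are uniform in `ε`.
  set ζ : ℝ → ℝ := fun s => Real.smoothTransition (s / ε - 1) with hζdef
  have hζs : ContDiff ℝ ∞ ζ := Real.smoothTransition.contDiff.comp (by fun_prop)
  have hζ : ∀ s ≤ ε, ζ s = 0 := by
    intro s hs
    refine Real.smoothTransition.zero_of_nonpos ?_
    rw [sub_nonpos, div_le_one hε]
    exact hs
  have hζ0 : ∀ s, 0 ≤ ζ s := fun s => Real.smoothTransition.nonneg _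
  have hζ1 : ∀ s, ζ s ≤ 1 := fun s => Real.smoothTransition.le_one _
  have hζ'0 : ∀ s, 0 ≤ deriv ζ s := by
    intro s
    refine (Real.smoothTransition.monotone.comp ?_).deriv_nonneg
    intro a b hab
    simp only
    gcongr
  have hζ'Z : ∀ s ≤ 0, deriv ζ s = 0 := by
    intro s hs
    have : ζ =ᶠ[nhds s] fun _ => 0 := by
      filter_upwards [Iio_mem_nhds (lt_of_le_of_lt hs hε)] with x hx
      exact hζ x (le_of_lt hx)
    simp [this.deriv_eq]
  set c : ℝ := |κ * (1 + κ) - 1| + |1 + 2 * κ| with hc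
  have hc0 : 0 ≤ c := by positivity
  have hpast : MeasurableSet {z' : Phase d | z'.1 < z.1} :=
    measurableSet_lt measurable_fst measurable_const
  set R : Phase d → ℝ := fun z' => φ z' * inner ℝ (G z') (kinFlux κ ζ z z') -
        inner ℝ (A z' (f z') (G z')) (φ z' • gradV (kinKernel κ ζ z) z' +
          kinKernel κ ζ z z' • gradV φ z') +
        f z' * (kinKernel κ ζ z z' * transport φ z') +
        f z' * inner ℝ (gradV φ z') (kinFlux κ ζ z z') with hR
  have hmain := h.integral_kinKernel_le (κ := κ) hf hG hA hK hKΩ hφs hφ0 hζs hζ hζ0 hε z hφK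
  have hdm : Measurable (deriv ζ) := measurable_deriv ζ
  have hkm : Measurable (kinKernel κ (deriv ζ) z) := measurable_kinKernel κ hdm z
  have hk0 : ∀ z', 0 ≤ kinKernel κ (deriv ζ) z z' := by
    intro z'
    rcases le_or_gt (z.1 - z'.1) 0 with hs | hs
    · simp [kinKernel, hζ'Z _ hs]
    · exact kinKernel_nonneg hζ'0 hs.le
  have hleft : ∫⁻ b, ‖F (kinShift κ z (ε * b.1) b.2)‖ₑ ∂(avgMeasure d) ≤
      ENNReal.ofReal (∫ z' in Ω, f z' * (φ z' * kinKernel κ (deriv ζ) z z')) := by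
    rw [lintegral_avgMeasure κ hε z (F := fun z => ‖F z‖ₑ) hFm.enorm]
    have hnn : 0 ≤ᵐ[volume.restrict Ω] fun z' => f z' * (φ z' * kinKernel κ (deriv ζ) z z') := by
      filter_upwards [hf0] with z' hz'
      exact mul_nonneg hz' (mul_nonneg (hφ0 _) (hk0 _))
    have hζs' : ContDiff ℝ ∞ (deriv ζ) := hζs.iterate_deriv 1
    -- Any positive threshold below `ε` would do: it only serves the smoothness of the `ζ'` kernel.
    have hζ'e : ∀ s ≤ ε / 2, deriv ζ s = 0 := by
      intro s hs
      have : ζ =ᶠ[nhds s] fun _ => 0 := by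
        filter_upwards [Iio_mem_nhds (by linarith : s < ε)] with x hx
        exact hζ x (le_of_lt hx)
      simp [this.deriv_eq]
    have hk' : ContDiff ℝ ∞ (kinKernel κ (deriv ζ) z) :=
      contDiff_kinKernel hζs' hζ'e (by positivity) z
    have hζ'E : ∀ s, s < ε → deriv ζ s = 0 := by
      intro s hs
      have : ζ =ᶠ[nhds s] fun _ => 0 := by
        filter_upwards [Iio_mem_nhds hs] with x hx
        exact hζ x (le_of_lt hx)
      simp [this.deriv_eq]
    have hint : Integrable (fun z' => f z' * (φ z' * kinKernel κ (deriv ζ) z z'))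
        (volume.restrict Ω) := by
      refine Integrable.mul_compact hf hK (hφs.mul hk').continuous fun z' hz' => ?_
      refine hφK z' (subset_tsupport φ (left_ne_zero_of_mul hz')) ?_
      by_contra hcon
      exact hz' (by simp [kinKernel, hζ'E _ (by linarith : z.1 - z'.1 < ε)])
    rw [ofReal_integral_eq_lintegral_ofReal hint hnn]
    calc _ ≤ ∫⁻ z', ENNReal.ofReal (kinKernel κ (deriv ζ) z z') * ‖F z'‖ₑ :=
          setLIntegral_le_lintegral _ _
      _ = ∫⁻ z' in Ω, ENNReal.ofReal (kinKernel κ (deriv ζ) z z') * ‖F z'‖ₑ := by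
          rw [← lintegral_indicator hΩ]
          refine lintegral_congr fun z' => ?_
          by_cases hz' : z' ∈ Ω
          · simp [hz']
          · simp [hz', hF0 z' hz']
      _ ≤ _ := by
          refine lintegral_mono_ae ?_
          filter_upwards [hF, hf0] with z' h1 h2
          rw [h1, Real.enorm_of_nonneg (mul_nonneg h2 (hφ0 _)), ← ENNReal.ofReal_mul (hk0 _)]
          exact ENNReal.ofReal_le_ofReal (le_of_eq (by ring))
  have hRzero : ∀ z', ¬ z'.1 < z.1 → R z' = 0 := by
    intro z' hz'
    have h0 := eventually_comp_sub_eq_zero hζ hε hz'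
    have h1 : kinKernel κ ζ z =ᶠ[nhds z'] fun _ => 0 := by
      filter_upwards [h0] with x hx
      simp [kinKernel, hx]
    have h2 : gradV (kinKernel κ ζ z) z' = 0 := by
      refine ext_inner_right ℝ fun w => ?_
      rw [inner_gradV ((contDiff_kinKernel hζs hζ hε z).differentiable (by simp) z'),
        h1.fderiv_eq]
      simp
    have h3 : kinFlux κ ζ z z' = 0 := by simp [kinFlux, h0.self_of_nhds]
    simp [hR, h2, h1.self_of_nhds, h3]
  set w : Phase d → ℝ := fun z' => gaussW (1 / 4) (kinY κ z z', kinU κ z z') with hw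
  set S : ℝ → Phase d → ENNReal := fun β z' =>
    ENNReal.ofReal ((z.1 - z'.1) ^ (β - 1 - (d : ℝ) * (1 + 2 * κ)) * w z') with hS
  have hSm : ∀ β, Measurable (S β) := by
    intro β
    have h1 := measurable_kinY κ z
    have h2 := measurable_kinU κ z
    have h3 := measurable_gaussW (d := d) (1 / 4)
    simp only [hS, hw]
    fun_prop
  have hRle : ∀ᵐ z' ∂(volume.restrict Ω), ‖R z'‖ₑ ≤ {z' : Phase d | z'.1 < z.1}.indicator
      (fun z' => ENNReal.ofReal (c + 1) * (S κ z' * g₁ z' + S (1 - κ) z' * g₂ z' +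
        S 1 z' * g₃ z')) z' := by
    filter_upwards [hAα, hg₁G, hg₂α, hg₃f, ae_restrict_mem hΩ] with z' h1 h2 h3 h4 hz'
    by_cases hs : z'.1 < z.1
    · rw [Set.indicator_of_mem (by exact hs)]
      have hs' : 0 < z.1 - z'.1 := sub_pos.2 hs
      have hw0 : 0 ≤ w z' := gaussW_nonneg _ _
      have hb := abs_kernel_remainder_le (f := f z') (G := G z') (hφ0 z') (hφ1 z')
        (kinKernel_nonneg (κ := κ) hζ0 hs'.le) h1 (hT z' hz') (hD z' hz')
        (norm_kinFlux_le (κ := κ) hζ0 hζ1 hs'.le)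
        (norm_gradV_kinKernel_le (κ := κ) hζs hζ hε hζ0 hζ1 hs')
        (kinKernel_le (κ := κ) hζ1 hs'.le) hc0 (by positivity)
      have hα0 : 0 ≤ α z' := (norm_nonneg _).trans h1
      have hγt : 0 ≤ γt := (abs_nonneg _).trans (hT z' hz')
      have hγv : 0 ≤ γv := (norm_nonneg _).trans (hD z' hz')
      rw [Real.enorm_eq_ofReal_abs]
      refine (ENNReal.ofReal_le_ofReal hb).trans ?_
      rw [ENNReal.ofReal_mul (by positivity)]
      gcongr ENNReal.ofReal (c + 1) * ?_
      refine (ofReal_sum_three_mul_le (mul_nonneg (by positivity) hw0)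
        (mul_nonneg (by positivity) hw0) (mul_nonneg (by positivity) hw0)).trans ?_
      simp only [hS]
      gcongr
    · rw [Set.indicator_of_notMem (by exact hs), hRzero z' hs]
      simp
  have hright : ENNReal.ofReal (∫ z' in Ω, R z') ≤ ENNReal.ofReal (c + 1) *
        (fracOp κ κ (gaussENN (1 / 4)) g₁ (Set.Ioi 0) z +
          fracOp κ (1 - κ) (gaussENN (1 / 4)) g₂ (Set.Ioi 0) z +
          fracOp κ 1 (gaussENN (1 / 4)) g₃ (Set.Ioi 0) z) := by
    have e1 : ENNReal.ofReal (∫ z' in Ω, R z') ≤ ‖∫ z' in Ω, R z'‖ₑ := by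
      rw [Real.enorm_eq_ofReal_abs]
      exact ENNReal.ofReal_le_ofReal (le_abs_self _)
    refine e1.trans ((enorm_integral_le_lintegral_enorm _).trans ((lintegral_mono_ae hRle).trans ?_))
    refine (setLIntegral_le_lintegral _ _).trans (le_of_eq ?_)
    have m1 := hSm κ
    have m2 := hSm (1 - κ)
    have m3 := hSm 1
    rw [lintegral_indicator hpast, lintegral_const_mul _ (by fun_prop),
      lintegral_add_left (by fun_prop), lintegral_add_left (by fun_prop),
      ← lintegral_kernel_eq_fracOp κ κ (1 / 4) z hg₁,
      ← lintegral_kernel_eq_fracOp κ (1 - κ) (1 / 4) z hg₂,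
      ← lintegral_kernel_eq_fracOp κ 1 (1 / 4) z hg₃]
  exact hleft.trans ((ENNReal.ofReal_le_ofReal hmain).trans hright)

end average

/-! ### Operator norm of the Gaussian fractional integrals and measurable majorants -/

lemma exists_eLpNorm_fracOp_le {d : ℕ} {κ β P Q D : ℝ} (hP : 1 < P) (hPQ' : P < Q)
    (hD : D = 1 + d * (1 + 2 * κ)) (hD0 : 0 < D) (hβ : 0 < β) (hPQ : 1 / P - 1 / Q = β / D)
    {b : ℝ} (hb : 0 < b) :
    ∃ C : ℝ, 0 < C ∧ ∀ g : Phase d → ENNReal, Measurable g →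
      eLpNorm (fracOp κ β (gaussENN b) g (Set.Ioi 0)) (ENNReal.ofReal Q) volume ≤
        ENNReal.ofReal C * eLpNorm g (ENNReal.ofReal P) volume := by
  have hP0 : 0 < P := by linarith
  have hQ0 : 0 < Q := hP0.trans hPQ'
  have hPP : P.HolderConjugate (P / (P - 1)) := Real.HolderConjugate.conjExponent hP
  obtain ⟨K, hK, h⟩ := exists_lintegral_fracOp_le (d := d) hPP hPQ' hD hD0 hβ hPQ
    (measurable_gaussENN b) (lintegral_gaussENN_ne_top hb) (by
      simp_rw [gaussENN_rpow]
      exact lintegral_gaussENN_ne_top (mul_pos hb hPP.symm.pos))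
  refine ⟨K ^ (1 / Q), by positivity, fun g hg => ?_⟩
  have hnorm : ∀ (h : Phase d → ENNReal) {s : ℝ}, 0 < s →
      eLpNorm h (ENNReal.ofReal s) volume = (∫⁻ z, h z ^ s) ^ (1 / s) := by
    intro h s hs
    rw [eLpNorm_eq_lintegral_rpow_enorm_toReal (by simpa using hs) ENNReal.ofReal_ne_top,
      ENNReal.toReal_ofReal hs.le]
    simp
  by_cases htop : eLpNorm g (ENNReal.ofReal P) volume = ⊤
  · rw [htop, ENNReal.mul_top (by simpa using by positivity)]
    exact le_top
  set n := (eLpNorm g (ENNReal.ofReal P) volume).toReal with hn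
  have hgn : eLpNorm g (ENNReal.ofReal P) volume = ENNReal.ofReal n :=
    (ENNReal.ofReal_toReal htop).symm
  have hn0 : 0 ≤ n := ENNReal.toReal_nonneg
  -- The integral form needs a strictly positive bound on the norm; `δ` provides it when `g`
  -- vanishes almost everywhere, and is then sent to `0`.
  have key : ∀ δ : ℝ, 0 < δ → eLpNorm (fracOp κ β (gaussENN b) g (Set.Ioi 0)) (ENNReal.ofReal Q)
      volume ≤ ENNReal.ofReal (K ^ (1 / Q) * (n + δ)) := by
    intro δ hδ
    have hN : 0 < n + δ := by linarith
    have h1 : ∫⁻ z, g z ^ P ≤ ENNReal.ofReal ((n + δ) ^ P) := by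
      have e1 : ∫⁻ z, g z ^ P = eLpNorm g (ENNReal.ofReal P) volume ^ P := by
        rw [hnorm g hP0, ← ENNReal.rpow_mul]
        have : 1 / P * P = 1 := by field_simp
        rw [this, ENNReal.rpow_one]
      rw [e1, hgn, ENNReal.ofReal_rpow_of_nonneg hn0 hP0.le]
      apply ENNReal.ofReal_le_ofReal
      gcongr
      linarith
    rw [hnorm _ hQ0]
    calc _ ≤ ENNReal.ofReal (K * (n + δ) ^ Q) ^ (1 / Q) := by
          gcongr
          exact h g hg _ hN h1
      _ = _ := by
          rw [ENNReal.ofReal_rpow_of_nonneg (by positivity) (by positivity),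
            Real.mul_rpow hK.le (by positivity), ← Real.rpow_mul hN.le]
          have : Q * (1 / Q) = 1 := by field_simp
          rw [this, Real.rpow_one]
  rw [hgn, ← ENNReal.ofReal_mul (by positivity)]
  have hlim : Filter.Tendsto (fun δ : ℝ => ENNReal.ofReal (K ^ (1 / Q) * (n + δ)))
      (nhdsWithin 0 (Set.Ioi 0)) (nhds (ENNReal.ofReal (K ^ (1 / Q) * (n + 0)))) := by
    refine Filter.Tendsto.mono_left ?_ nhdsWithin_le_nhds
    exact (ENNReal.continuous_ofReal.comp
      (by fun_prop : Continuous fun δ : ℝ => K ^ (1 / Q) * (n + δ))).tendsto 0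
  rw [add_zero] at hlim
  exact ge_of_tendsto hlim (by
    filter_upwards [self_mem_nhdsWithin] with δ hδ
    exact key δ hδ)

/-- Fractional integrals act on Borel functions on the whole space. A Borel representative, extended
by zero outside `Ω`, has the same norms. -/
lemma exists_measurable_ofReal_le {d : ℕ} {Ω : Set (Phase d)} (hΩ : MeasurableSet Ω)
    {h : Phase d → ℝ} (hm : AEMeasurable h (volume.restrict Ω)) (h0 : ∀ z, 0 ≤ h z) :
    ∃ g : Phase d → ENNReal, Measurable g ∧
      (∀ᵐ z ∂(volume.restrict Ω), ENNReal.ofReal (h z) ≤ g z) ∧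
      ∀ P, eLpNorm g P volume = eLpNorm h P (volume.restrict Ω) := by
  refine ⟨Ω.indicator fun z => ENNReal.ofReal (hm.mk h z),
    hm.measurable_mk.ennreal_ofReal.indicator hΩ, ?_, fun P => ?_⟩
  · filter_upwards [hm.ae_eq_mk, ae_restrict_mem hΩ] with z h1 hz
    rw [Set.indicator_of_mem hz, h1]
  · rw [eLpNorm_indicator_eq_eLpNorm_restrict hΩ]
    refine eLpNorm_congr_enorm_ae ?_
    filter_upwards [hm.ae_eq_mk] with z h1
    rw [← h1, enorm_eq_self, Real.enorm_of_nonneg (h0 z)]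

/-! ### Choice of the scaling exponent -/

/-- The scaling exponents of the kinetic embedding. -/
lemma kinetic_exponents {d : ℕ} (hd : 1 ≤ d) {p q r : ℝ}
    (hp : p ∈ Set.Ioo (2 - 2 / (3 * (d : ℝ) + 2)) (2 + 2 / (d : ℝ)))
    (hq : q = p * ((4 * (d : ℝ) + 2) / ((d : ℝ) * (p + 2))))
    (hr : r = p * ((4 * (d : ℝ) + 2) / (p * (3 * (d : ℝ) + 2) - 2 * (d : ℝ)))) :
    1 < p ∧ p < q ∧ p / (p - 1) < q ∧ 1 < r ∧ r < q ∧ r ≤ p ∧ r ≤ p / (p - 1) ∧ r ≤ 2 ∧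
    ∃ κ D : ℝ, 0 < κ ∧ κ < 1 ∧ D = 1 + d * (1 + 2 * κ) ∧ 0 < D ∧ 1 / p - 1 / q = κ / D ∧
      1 / (p / (p - 1)) - 1 / q = (1 - κ) / D ∧ 1 / r - 1 / q = 1 / D := by
  obtain ⟨h1, h2⟩ := hp
  have hn : (1 : ℝ) ≤ d := by exact_mod_cast hd
  generalize (d : ℝ) = n at *
  have hn0 : 0 < n := by linarith
  -- The endpoints of the range of `p`, cleared of denominators; they will say `κ < 1` and `0 < κ`
  -- respectively.
  have e1 : 6 * n + 2 < p * (3 * n + 2) := by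
    have h3 : 0 < 3 * n + 2 := by linarith
    have h4 : (2 - 2 / (3 * n + 2)) * (3 * n + 2) < p * (3 * n + 2) := by gcongr
    have h5 : (2 - 2 / (3 * n + 2)) * (3 * n + 2) = 6 * n + 2 := by field_simp; ring
    linarith
  have e2 : p * n < 2 * n + 2 := by
    have h4 : p * n < (2 + 2 / n) * n := by gcongr
    have h5 : (2 + 2 / n) * n = 2 * n + 2 := by field_simp
    linarith
  have hp1 : 1 < p := by
    by_contra hcon
    nlinarith
  have hp0 : 0 < p := by linarith
  have hp10 : 0 < p - 1 := by linarith
  have hm : 0 < 2 * (n + 1) * p - 4 * n := by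
    by_contra hcon
    nlinarith
  have hm2 : 0 < p * (3 * n + 2) - 2 * n := by nlinarith
  have hk : 0 < 2 * n + 2 - p * n := by linarith
  have hq1 : 1 / q = n * (p + 2) / (p * (4 * n + 2)) := by rw [hq]; field_simp
  have hr1 : 1 / r = (p * (3 * n + 2) - 2 * n) / (p * (4 * n + 2)) := by rw [hr]; field_simp
  have hq0 : 0 < q := by rw [hq]; positivity
  have hr0 : 0 < r := by rw [hr]; positivity
  have hp'0 : 0 < p / (p - 1) := by positivity
  obtain ⟨m, hmdef⟩ : ∃ m, m = 2 * (n + 1) * p - 4 * n := ⟨_, rfl⟩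
  rw [← hmdef] at hm
  -- Obtained by eliminating `q` between `1/p - 1/q = κ/D` and `1/p' - 1/q = (1 - κ)/D`.
  set κ : ℝ := (2 * n + 2 - p * n) / m with hκ
  set D : ℝ := 1 + n * (1 + 2 * κ) with hD
  have hD' : D = p * (4 * n + 2) / m := by
    rw [hD, hκ]; field_simp; rw [hmdef]; ring
  have hκ0 : 0 < κ := by positivity
  have hκ1 : κ < 1 := by rw [hκ, div_lt_one hm]; nlinarith
  have hD0 : 0 < D := by rw [hD']; positivity
  have i1 : 1 / p - 1 / q = κ / D := by rw [hq1, hD', hκ]; field_simp; ring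
  have i2 : 1 / (p / (p - 1)) - 1 / q = (1 - κ) / D := by
    rw [hq1, hD', hκ]; field_simp; rw [hmdef]; ring
  have i3 : 1 / r - 1 / q = 1 / D := by
    rw [hq1, hr1, hD']; field_simp; rw [hmdef]; ring
  have hlt : ∀ x y : ℝ, 0 < x → 0 < y → 0 < 1 / x - 1 / y → x < y := fun x y hx hy h =>
    (one_div_lt_one_div hy hx).1 (by linarith)
  have hle : ∀ x y : ℝ, 0 < x → 0 < y → 0 ≤ 1 / x - 1 / y → x ≤ y := fun x y hx hy h =>
    (one_div_le_one_div hy hx).1 (by linarith)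
  refine ⟨hp1, hlt _ _ hp0 hq0 (by rw [i1]; positivity), hlt _ _ hp'0 hq0 ?_, ?_,
    hlt _ _ hr0 hq0 (by rw [i3]; positivity), hle _ _ hr0 hp0 ?_, hle _ _ hr0 hp'0 ?_,
    hle _ _ hr0 two_pos ?_, κ, D, hκ0, hκ1, rfl, hD0, i1, i2, i3⟩
  · rw [i2]
    have := sub_pos.2 hκ1
    positivity
  · rw [hr, ← mul_div_assoc, lt_div_iff₀ hm2]
    nlinarith
  · have : 1 / r - 1 / p = (p * (3 * n + 2) - (6 * n + 2)) / (p * (4 * n + 2)) := by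
      rw [hr1]; field_simp; ring
    rw [this]
    have := sub_pos.2 e1
    positivity
  · have : 1 / r - 1 / (p / (p - 1)) = (2 * n + 2 - p * n) / (p * (4 * n + 2)) := by
      rw [hr1]; field_simp; ring
    rw [this]
    positivity
  · have : 1 / r - 1 / 2 = m / (2 * (p * (4 * n + 2))) := by
      rw [hr1]; field_simp; rw [hmdef]; ring
    rw [this]
    positivity

/-! ### Geometry of kinetic cylinders -/

section cylinder
variable {d : ℕ} {p θ R : ℝ} {z₀ : Phase d}

/-- The cylinder coordinates. -/
noncomputable def cylMap (z₀ z : Phase d) : Phase d :=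
  (z.1, z₀.2.1 + z.2.1 + (z.1 - z₀.1) • (z₀.2.2 + z.2.2), z₀.2.2 + z.2.2)

lemma continuous_cylMap (z₀ : Phase d) : Continuous (cylMap z₀) := by
  unfold cylMap; fun_prop

/-- Slanted closed cylinders are continuous images of products, hence compact when `T` is; this
yields the finite volume and the compact sets for the test functions. -/
lemma mem_image_cylMap {T : Set ℝ} {ρ σ : ℝ} {z : Phase d} :
    z ∈ cylMap z₀ '' (T ×ˢ (Metric.closedBall 0 ρ ×ˢ Metric.closedBall 0 σ)) ↔
      z.1 ∈ T ∧ ‖z.2.1 - z₀.2.1 - (z.1 - z₀.1) • z.2.2‖ ≤ ρ ∧ ‖z.2.2 - z₀.2.2‖ ≤ σ := by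
  constructor
  · rintro ⟨⟨t, X, V⟩, ⟨h1, h2, h3⟩, rfl⟩
    simp only [mem_closedBall_zero_iff] at h2 h3
    have e1 : (cylMap z₀ (t, X, V)).2.1 - z₀.2.1 -
        ((cylMap z₀ (t, X, V)).1 - z₀.1) • (cylMap z₀ (t, X, V)).2.2 = X := by
      simp only [cylMap]; module
    have e2 : (cylMap z₀ (t, X, V)).2.2 - z₀.2.2 = V := by
      simp only [cylMap]; module
    rw [e1, e2]
    exact ⟨h1, h2, h3⟩
  · rintro ⟨h1, h2, h3⟩
    refine ⟨(z.1, z.2.1 - z₀.2.1 - (z.1 - z₀.1) • z.2.2, z.2.2 - z₀.2.2),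
      ⟨h1, by simpa using h2, by simpa using h3⟩, ?_⟩
    refine Prod.ext rfl (Prod.ext ?_ ?_)
    · simp only [cylMap]; module
    · simp only [cylMap]; module

lemma isCompact_image_cylMap (z₀ : Phase d) (a b ρ σ : ℝ) :
    IsCompact (cylMap z₀ '' (Set.Icc a b ×ˢ (Metric.closedBall 0 ρ ×ˢ Metric.closedBall 0 σ))) :=
  (isCompact_Icc.prod ((isCompact_closedBall _ _).prod (isCompact_closedBall _ _))).image
    (continuous_cylMap z₀)

lemma measurableSet_kineticCylinder : MeasurableSet (kineticCylinder p θ R z₀) := by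
  unfold kineticCylinder
  refine MeasurableSet.inter ?_ (MeasurableSet.inter ?_ ?_)
  · exact measurableSet_Ico.preimage measurable_fst
  · exact Metric.isOpen_ball.measurableSet.preimage (by fun_prop : Measurable fun z : Phase d =>
      z.2.1 - z₀.2.1 - (z.1 - z₀.1) • z.2.2)
  · exact Metric.isOpen_ball.measurableSet.preimage (by fun_prop : Measurable fun z : Phase d =>
      z.2.2 - z₀.2.2)

lemma volume_kineticCylinder_ne_top : volume (kineticCylinder p θ R z₀) ≠ ⊤ := by
  refine ((measure_mono ?_).trans_lt (isCompact_image_cylMap z₀ (z₀.1 - θ * R ^ p) z₀.1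
    (θ * R ^ (1 + p)) R).measure_lt_top).ne
  rintro z ⟨h1, h2, h3⟩
  rw [mem_ball_zero_iff] at h2 h3
  exact mem_image_cylMap.2 ⟨⟨h1.1, h1.2.le⟩, h2.le, h3.le⟩

lemma mem_interior_kineticCylinder {z : Phase d} (h1 : z₀.1 - θ * R ^ p < z.1) (h2 : z.1 < z₀.1)
    (h3 : ‖z.2.1 - z₀.2.1 - (z.1 - z₀.1) • z.2.2‖ < θ * R ^ (1 + p)) (h4 : ‖z.2.2 - z₀.2.2‖ < R) :
    z ∈ interior (kineticCylinder p θ R z₀) := by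
  rw [mem_interior]
  refine ⟨{z | z₀.1 - θ * R ^ p < z.1 ∧ z.1 < z₀.1 ∧
    ‖z.2.1 - z₀.2.1 - (z.1 - z₀.1) • z.2.2‖ < θ * R ^ (1 + p) ∧ ‖z.2.2 - z₀.2.2‖ < R}, ?_, ?_,
    ⟨h1, h2, h3, h4⟩⟩
  · rintro z ⟨h1, h2, h3, h4⟩
    exact ⟨⟨h1.le, h2⟩, mem_ball_zero_iff.2 h3, mem_ball_zero_iff.2 h4⟩
  · have c1 : Continuous fun z : Phase d => ‖z.2.1 - z₀.2.1 - (z.1 - z₀.1) • z.2.2‖ := by fun_prop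
    have c2 : Continuous fun z : Phase d => ‖z.2.2 - z₀.2.2‖ := by fun_prop
    exact (isOpen_lt continuous_const continuous_fst).inter
      ((isOpen_lt continuous_fst continuous_const).inter
      ((isOpen_lt c1 continuous_const).inter (isOpen_lt c2 continuous_const)))

lemma kineticCylinder_subset_interior {R₁ R₂ : ℝ} (hp : 0 < p) (hθ : 0 < θ) (hR₁ : 0 < R₁)
    (hR : R₁ < R₂) : kineticCylinder p θ R₁ z₀ ⊆ interior (kineticCylinder p θ R₂ z₀) := by
  rintro z ⟨h1, h2, h3⟩
  rw [mem_ball_zero_iff] at h2 h3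
  have e1 : R₁ ^ p < R₂ ^ p := Real.rpow_lt_rpow hR₁.le hR hp
  have e2 : R₁ ^ (1 + p) < R₂ ^ (1 + p) := Real.rpow_lt_rpow hR₁.le hR (by linarith)
  refine mem_interior_kineticCylinder ?_ h1.2 (h2.trans ?_) (h3.trans hR)
  · have := mul_lt_mul_of_pos_left e1 hθ
    linarith [h1.1]
  · exact mul_lt_mul_of_pos_left e2 hθ

end cylinder

/-! ### Pointwise bound on the smaller cylinder -/

lemma gammaT_nonneg {p θ R₁ R₂ : ℝ} (hp : 0 < p) (hθ : 0 < θ) (hR₁ : 0 < R₁) (hR : R₁ < R₂) :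
    0 ≤ gammaT p θ R₁ R₂ := by
  have e1 : 0 < R₂ ^ p - R₁ ^ p := sub_pos.2 (Real.rpow_lt_rpow hR₁.le hR hp)
  unfold gammaT
  positivity

lemma gammaV_nonneg {p R₁ R₂ : ℝ} (hp : 0 < p) (hR₁ : 0 < R₁) (hR : R₁ < R₂) :
    0 ≤ gammaV p R₁ R₂ := by
  have e1 : 0 < R₂ ^ (1 + p) - R₁ ^ (1 + p) :=
    sub_pos.2 (Real.rpow_lt_rpow hR₁.le hR (by linarith))
  have e2 : 0 < R₂ - R₁ := sub_pos.2 hR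
  have e3 : 0 < R₂ := hR₁.trans hR
  unfold gammaV
  positivity

/-- A nonnegative subsolution is pointwise controlled on the smaller cylinder by fractional
integrals of its velocity gradient and of the errors of the cutoff. -/
theorem exists_ae_enorm_le_fracOp : ∃ C₀ : ℝ, 0 < C₀ ∧
    ∀ {d : ℕ} {p κ θ R₁ R₂ lam Lam : ℝ} {z₀ : Phase d} {A : Phase d → ℝ → Space d → Space d}
      {f : Phase d → ℝ} {G : Phase d → Space d}, 1 < p → 0 < κ → 0 < Lam → 0 < θ → 0 < R₁ →
      R₁ < R₂ → IsCaratheodory A → HasPGrowth p lam Lam A →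
      (∀ᵐ z ∂(volume.restrict (interior (kineticCylinder p θ R₂ z₀))), 0 ≤ f z) →
      IsWeakSubsolution p A (interior (kineticCylinder p θ R₂ z₀)) f G →
      ∃ g₁ g₂ g₃ : Phase d → ENNReal, Measurable g₁ ∧ Measurable g₂ ∧ Measurable g₃ ∧
        (∀ P, eLpNorm g₁ P volume = eLpNorm (fun z => ‖G z‖ + C₀ * gammaV p R₁ R₂ * |f z|) P
          (volume.restrict (interior (kineticCylinder p θ R₂ z₀)))) ∧
        (∀ P, eLpNorm g₂ P volume = eLpNorm (fun z => Lam * ‖G z‖ ^ (p - 1)) P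
          (volume.restrict (interior (kineticCylinder p θ R₂ z₀)))) ∧
        (∀ P, eLpNorm g₃ P volume = eLpNorm (fun z => C₀ * gammaT p θ R₁ R₂ * |f z| +
          C₀ * gammaV p R₁ R₂ * (Lam * ‖G z‖ ^ (p - 1))) P
          (volume.restrict (interior (kineticCylinder p θ R₂ z₀)))) ∧
        ∀ᵐ z ∂(volume.restrict (kineticCylinder p θ R₁ z₀)),
          avgMeasure d Set.univ * ‖f z‖ₑ ≤ ENNReal.ofReal (|κ * (1 + κ) - 1| + |1 + 2 * κ| + 1) *
          (fracOp κ κ (gaussENN (1 / 4)) g₁ (Set.Ioi 0) z +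
            fracOp κ (1 - κ) (gaussENN (1 / 4)) g₂ (Set.Ioi 0) z +
            fracOp κ 1 (gaussENN (1 / 4)) g₃ (Set.Ioi 0) z) := by
  obtain ⟨C₀, hC₀, hcut⟩ := exists_kinetic_cutoff
  refine ⟨C₀, hC₀, ?_⟩
  intro d p κ θ R₁ R₂ lam Lam z₀ A f G hp hκ hLam hθ hR₁ hR hA hgrow hf0 hsol
  have hp0 : 0 < p := by linarith
  obtain ⟨φ, τ, ρ, σ, hφs, hφ0, hφ1, hφQ, hτ, hρ, hσ, hφsupp, hφT, hφD⟩ :=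
    hcut d p θ R₁ R₂ z₀ hp0 hθ hR₁ hR
  have hQ1Ω : kineticCylinder p θ R₁ z₀ ⊆ interior (kineticCylinder p θ R₂ z₀) :=
    kineticCylinder_subset_interior hp0 hθ hR₁ hR
  have hΩfin : volume (interior (kineticCylinder p θ R₂ z₀)) ≠ ⊤ :=
    ((measure_mono interior_subset).trans_lt volume_kineticCylinder_ne_top.lt_top).ne
  have hΩQ : interior (kineticCylinder p θ R₂ z₀) ⊆ kineticCylinder p θ R₂ z₀ := interior_subset
  have hΩ : MeasurableSet (interior (kineticCylinder p θ R₂ z₀)) := isOpen_interior.measurableSet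
  set Ω := interior (kineticCylinder p θ R₂ z₀) with hΩdef
  have : IsFiniteMeasure (volume.restrict Ω) := ⟨by
    rw [Measure.restrict_apply_univ]; exact hΩfin.lt_top⟩
  have hp1 : 1 ≤ ENNReal.ofReal p := by simpa using hp.le
  have hf : Integrable f (volume.restrict Ω) := hsol.memLp.integrable hp1
  have hG : Integrable G (volume.restrict Ω) := hsol.memLp_grad.integrable hp1
  set α : Phase d → ℝ := fun z => Lam * ‖G z‖ ^ (p - 1) with hα
  have hα0 : ∀ z, 0 ≤ α z := fun z => by positivity
  have hAα : ∀ᵐ z ∂(volume.restrict Ω), ‖A z (f z) (G z)‖ ≤ α z := by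
    filter_upwards [ae_restrict_of_ae hgrow] with z hz
    exact (hz (f z) (G z)).2
  have hαm : AEMeasurable α (volume.restrict Ω) := by
    have := hG.aestronglyMeasurable.aemeasurable.norm
    exact (this.pow_const _).const_mul _
  have hαi : Integrable α (volume.restrict Ω) := by
    have h1 : Integrable (fun z => ‖G z‖ ^ p) (volume.restrict Ω) := by
      have := hsol.memLp_grad.integrable_norm_rpow (by simpa using hp0) ENNReal.ofReal_ne_top
      rwa [ENNReal.toReal_ofReal hp0.le] at this
    refine Integrable.mono' ((h1.add (integrable_const 1)).const_mul Lam)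
      hαm.aestronglyMeasurable (Filter.Eventually.of_forall fun z => ?_)
    rw [Real.norm_of_nonneg (hα0 z)]
    simp only [hα, Pi.add_apply]
    gcongr
    rcases le_total ‖G z‖ 1 with h | h
    · have := Real.rpow_le_one (norm_nonneg (G z)) h (by linarith : 0 ≤ p - 1)
      have : 0 ≤ ‖G z‖ ^ p := by positivity
      linarith
    · have := Real.rpow_le_rpow_of_exponent_le h (by linarith : p - 1 ≤ p)
      linarith
  have hAi : Integrable (fun z => A z (f z) (G z)) (volume.restrict Ω) :=
    hαi.mono' (hA.aemeasurable_comp Measure.absolutelyContinuous_restrict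
      hf.aestronglyMeasurable.aemeasurable
      hG.aestronglyMeasurable.aemeasurable).aestronglyMeasurable hAα
  have hγv : 0 ≤ C₀ * gammaV p R₁ R₂ := mul_nonneg hC₀.le (gammaV_nonneg hp0 hR₁ hR)
  have hγt : 0 ≤ C₀ * gammaT p θ R₁ R₂ := mul_nonneg hC₀.le (gammaT_nonneg hp0 hθ hR₁ hR)
  have hfm := hf.aestronglyMeasurable.aemeasurable
  obtain ⟨g₁, hg₁, hg₁G, hg₁n⟩ := exists_measurable_ofReal_le hΩ
    (h := fun z => ‖G z‖ + C₀ * gammaV p R₁ R₂ * |f z|)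
    (hG.aestronglyMeasurable.aemeasurable.norm.add (hfm.norm.const_mul _))
    (fun z => by positivity)
  obtain ⟨g₂, hg₂, hg₂α, hg₂n⟩ := exists_measurable_ofReal_le hΩ hαm hα0
  obtain ⟨g₃, hg₃, hg₃f, hg₃n⟩ := exists_measurable_ofReal_le hΩ
    (h := fun z => C₀ * gammaT p θ R₁ R₂ * |f z| + C₀ * gammaV p R₁ R₂ * α z)
    ((hfm.norm.const_mul _).add (hαm.const_mul _))
    (fun z => add_nonneg (by positivity) (mul_nonneg hγv (hα0 z)))
  refine ⟨g₁, g₂, g₃, hg₁, hg₂, hg₃, hg₁n, hg₂n, hg₃n, ?_⟩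
  -- A Borel version of the localized function `f φ`, extended by zero; on the smaller cylinder it
  -- equals `f` almost everywhere.
  set F : Phase d → ℝ := Ω.indicator fun z => hfm.mk f z * φ z with hFdef
  have hFm : Measurable F := (hfm.measurable_mk.mul hφs.continuous.measurable).indicator hΩ
  have hF : ∀ᵐ z ∂(volume.restrict Ω), F z = f z * φ z := by
    filter_upwards [hfm.ae_eq_mk, ae_restrict_mem hΩ] with z h1 hz
    rw [hFdef, Set.indicator_of_mem hz, h1]
  have hF0 : ∀ z ∉ Ω, F z = 0 := fun z hz => Set.indicator_of_notMem hz _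
  have hFi : Integrable F := by
    rw [hFdef, integrable_indicator_iff hΩ]
    refine hf.norm.mono' (hfm.measurable_mk.mul hφs.continuous.measurable).aestronglyMeasurable ?_
    filter_upwards [hfm.ae_eq_mk] with z h1
    rw [← h1, norm_mul, Real.norm_of_nonneg (hφ0 z)]
    exact mul_le_of_le_one_right (norm_nonneg _) (hφ1 z)
  have hT : ∀ z ∈ Ω, |transport φ z| ≤ C₀ * gammaT p θ R₁ R₂ := fun z _ => hφT z
  have hD : ∀ z ∈ Ω, ‖gradV φ z‖ ≤ C₀ * gammaV p R₁ R₂ := by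
    intro z hz
    obtain ⟨⟨h1, h2⟩, -⟩ := hΩQ hz
    refine hφD z ?_
    rw [abs_le]
    constructor <;> linarith
  have hts : tsupport φ ⊆ {z | τ ≤ z.1 ∧ ‖z.2.1 - z₀.2.1 - (z.1 - z₀.1) • z.2.2‖ ≤ ρ ∧
      ‖z.2.2 - z₀.2.2‖ ≤ σ} := by
    have c1 : Continuous fun z : Phase d => ‖z.2.1 - z₀.2.1 - (z.1 - z₀.1) • z.2.2‖ := by fun_prop
    have c2 : Continuous fun z : Phase d => ‖z.2.2 - z₀.2.2‖ := by fun_prop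
    exact closure_minimal (fun z hz => hφsupp z hz)
      ((isClosed_le continuous_const continuous_fst).inter
      ((isClosed_le c1 continuous_const).inter (isClosed_le c2 continuous_const)))
  have hmf := fun (β : ℝ) (g : Phase d → ENNReal) (hg : Measurable g) =>
    measurable_fracOp (κ := κ) (β := β) (S := Set.Ioi 0) (measurable_gaussENN (d := d) (1 / 4)) hg
  have hmain := ae_enorm_le_of_average_le hκ (avgMeasure d) hFm hFi
    (((hmf κ g₁ hg₁).add (hmf (1 - κ) g₂ hg₂)).add (hmf 1 g₃ hg₃) |>.const_mul
      (ENNReal.ofReal (|κ * (1 + κ) - 1| + |1 + 2 * κ| + 1)))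
    (measurableSet_kineticCylinder (p := p) (θ := θ) (R := R₁) (z₀ := z₀))
    -- The compact set depends on `z` and `ε`: it is the support region of the cutoff truncated at
    -- time `t - ε`. It lies inside the open cylinder because `t < t₀`.
    volume_kineticCylinder_ne_top (fun ε hε z hz => by
      refine hsol.average_le hΩ hf0 hf hG hAi hAα hφs hφ0 hφ1 hT hD hFm hF hF0 hg₁ hg₂ hg₃
        hg₁G hg₂α hg₃f z hε (isCompact_image_cylMap z₀ τ (z.1 - ε) ρ σ) ?_ ?_
      · intro z' hz'
        obtain ⟨⟨h1, h2⟩, h3, h4⟩ := mem_image_cylMap.1 hz'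
        have := hz.1.2
        exact mem_interior_kineticCylinder (by linarith) (by linarith) (h3.trans_lt hρ)
          (h4.trans_lt hσ)
      · intro z' hz' hz'ε
        obtain ⟨h1, h2, h3⟩ := hts hz'
        exact mem_image_cylMap.2 ⟨⟨h1, hz'ε⟩, h2, h3⟩)
  filter_upwards [hmain, ae_mono (Measure.restrict_mono hQ1Ω le_rfl) hF,
    ae_restrict_mem measurableSet_kineticCylinder] with z h1 h2 h3
  rw [h2, hφQ z h3, mul_one] at h1
  exact h1

/-! ### Norm estimates and conclusion -/

section norms
variable {d : ℕ} {Q : Set (Phase d)} {E : Type*} [NormedAddCommGroup E] {g : Phase d → E}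

lemma eLpNorm_eq_ofReal_normLpOn {s : ℝ} (h : MemLp g (ENNReal.ofReal s) (volume.restrict Q)) :
    eLpNorm g (ENNReal.ofReal s) (volume.restrict Q) = ENNReal.ofReal (normLpOn s Q g) :=
  (ENNReal.ofReal_toReal h.2.ne).symm

lemma normLpOn_nonneg {s : ℝ} : 0 ≤ normLpOn s Q g := ENNReal.toReal_nonneg

/-- Hölder on a set of finite volume; every power of `|Q_{θ,R₂}|` in the final estimate comes from
here. -/
lemma eLpNorm_le_ofReal_normLpOn_mul {s t : ℝ} (hs : 0 < s) (hst : s ≤ t) (hQ : volume Q ≠ ⊤)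
    (h : MemLp g (ENNReal.ofReal t) (volume.restrict Q)) :
    eLpNorm g (ENNReal.ofReal s) (volume.restrict Q) ≤
      ENNReal.ofReal (normLpOn t Q g * (volume Q).toReal ^ (1 / s - 1 / t)) := by
  have ht : 0 < t := hs.trans_le hst
  refine (eLpNorm_le_eLpNorm_mul_rpow_measure_univ (ENNReal.ofReal_le_ofReal hst) h.1).trans ?_
  have e : 0 ≤ 1 / s - 1 / t := sub_nonneg.2 (one_div_le_one_div_of_le hs hst)
  rw [ENNReal.toReal_ofReal hs.le, ENNReal.toReal_ofReal ht.le, eLpNorm_eq_ofReal_normLpOn h,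
    Measure.restrict_apply_univ, ENNReal.ofReal_mul normLpOn_nonneg,
    ← ENNReal.ofReal_rpow_of_nonneg ENNReal.toReal_nonneg e, ENNReal.ofReal_toReal hQ]

lemma memLp_normLpOn_rpow {p : ℝ} (hp : 1 < p)
    (h : MemLp g (ENNReal.ofReal p) (volume.restrict Q)) :
    MemLp (fun z => ‖g z‖ ^ (p - 1)) (ENNReal.ofReal (p / (p - 1))) (volume.restrict Q) ∧
      normLpOn (p / (p - 1)) Q (fun z => ‖g z‖ ^ (p - 1)) = normLpOn p Q g ^ (p - 1) := by
  have hp1 : 0 < p - 1 := by linarith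
  have e : eLpNorm (fun z => ‖g z‖ ^ (p - 1)) (ENNReal.ofReal (p / (p - 1)))
      (volume.restrict Q) = eLpNorm g (ENNReal.ofReal p) (volume.restrict Q) ^ (p - 1) := by
    rw [eLpNorm_norm_rpow _ hp1, ← ENNReal.ofReal_mul (by positivity), div_mul_cancel₀ _ hp1.ne']
  refine ⟨⟨(h.1.norm.aemeasurable.pow_const _).aestronglyMeasurable, ?_⟩, ?_⟩
  · rw [e]
    exact ENNReal.rpow_lt_top_of_nonneg hp1.le h.2.ne
  · rw [normLpOn, e, normLpOn, ENNReal.toReal_rpow]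

lemma eLpNorm_add_mul_le {α : Type*} [MeasurableSpace α] {μ : Measure α} {u w : α → ℝ}
    {P : ENNReal} {a b : ℝ} (hP : 1 ≤ P) (ha : 0 ≤ a) (hb : 0 ≤ b)
    (hu : AEStronglyMeasurable u μ) (hw : AEStronglyMeasurable w μ) :
    eLpNorm (fun z => a * u z + b * w z) P μ ≤
      ENNReal.ofReal a * eLpNorm u P μ + ENNReal.ofReal b * eLpNorm w P μ := by
  refine (eLpNorm_add_le (hu.const_mul a) (hw.const_mul b) hP).trans (le_of_eq ?_)
  have h1 := eLpNorm_const_smul a u P μ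
  have h2 := eLpNorm_const_smul b w P μ
  rw [Real.enorm_of_nonneg ha] at h1
  rw [Real.enorm_of_nonneg hb] at h2
  rw [← h1, ← h2]
  rfl

end norms

/-- The gain of integrability, with the lower-order term measured in any bound for `f` in `L^r`. -/
theorem exists_eLpNorm_le {d : ℕ} (hd : 1 ≤ d) {p q r : ℝ}
    (hp : p ∈ Set.Ioo (2 - 2 / (3 * (d : ℝ) + 2)) (2 + 2 / (d : ℝ)))
    (hq : q = p * ((4 * (d : ℝ) + 2) / ((d : ℝ) * (p + 2))))
    (hr : r = p * ((4 * (d : ℝ) + 2) / (p * (3 * (d : ℝ) + 2) - 2 * (d : ℝ))))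
    {Lam : ℝ} (hLam : 0 < Lam) :
    ∃ C : ℝ, 0 < C ∧ ∀ {lam θ R₁ R₂ : ℝ} {z₀ : Phase d} {A : Phase d → ℝ → Space d → Space d}
      {Q₁ Q₂ : Set (Phase d)} {f : Phase d → ℝ} {G : Phase d → Space d}, 0 < θ → 0 < R₁ →
      R₁ < R₂ → IsCaratheodory A → HasPGrowth p lam Lam A →
      Q₁ = kineticCylinder p θ R₁ z₀ → Q₂ = kineticCylinder p θ R₂ z₀ →
      (∀ᵐ z ∂(volume.restrict Q₂), 0 ≤ f z) → IsWeakSubsolution p A (interior Q₂) f G →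
      MemLp G (ENNReal.ofReal p) (volume.restrict Q₂) →
      MemLp f (ENNReal.ofReal p) (volume.restrict Q₂) →
      ∀ N : ℝ, 0 ≤ N → eLpNorm f (ENNReal.ofReal r) (volume.restrict Q₂) ≤ ENNReal.ofReal N →
      eLpNorm f (ENNReal.ofReal q) (volume.restrict Q₁) ≤ ENNReal.ofReal (C * (normLpOn p Q₂ G
          + (1 + gammaV p R₁ R₂ * (volume Q₂).toReal ^ (1 / r - (p - 1) / p))
              * normLpOn p Q₂ G ^ (p - 1)
          + gammaV p R₁ R₂ * normLpOn p Q₂ f + gammaT p θ R₁ R₂ * N)) := by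
  obtain ⟨hp1, hpq, hp'q, hr1, hrq, hrp, hrp', hr2, κ, D, hκ, hκ1, hD, hD0, i1, i2, i3⟩ :=
    kinetic_exponents hd hp hq hr
  obtain ⟨C₀, hC₀, hpt⟩ := exists_ae_enorm_le_fracOp
  have hp0 : 0 < p := by linarith
  have hpm : 0 < p - 1 := by linarith
  have hp'1 : 1 < p / (p - 1) := by rw [lt_div_iff₀ hpm]; linarith
  obtain ⟨K₁, hK₁, hk₁⟩ := exists_eLpNorm_fracOp_le hp1 hpq hD hD0 hκ i1
    (b := 1 / 4) (by norm_num)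
  obtain ⟨K₂, hK₂, hk₂⟩ := exists_eLpNorm_fracOp_le hp'1 hp'q hD hD0 (sub_pos.2 hκ1) i2
    (b := 1 / 4) (by norm_num)
  obtain ⟨K₃, hK₃, hk₃⟩ := exists_eLpNorm_fracOp_le hr1 hrq hD hD0 one_pos i3
    (b := 1 / 4) (by norm_num)
  set c : ℝ := |κ * (1 + κ) - 1| + |1 + 2 * κ| + 1 with hc
  have hc0 : 0 < c := by positivity
  have hν0 := avgMeasure_univ_ne_zero (d := d)
  have hνt : avgMeasure d Set.univ ≠ ⊤ := measure_ne_top _ _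
  set ν : ℝ := (avgMeasure d Set.univ).toReal with hν
  have hνpos : 0 < ν := ENNReal.toReal_pos hν0 hνt
  -- `K₁`, `K₂`, `K₃` are the operator norms at orders `κ`, `1 - κ` and `1`, `C₀` is the cutoff
  -- constant, `c` bounds the kernels, and `ν` is the mass of the averaging measure.
  refine ⟨c / ν * (K₁ * (1 + C₀) + K₂ * Lam + K₃ * (C₀ + C₀ * Lam)), by positivity, ?_⟩
  intro lam θ R₁ R₂ z₀ A Q₁ Q₂ f G hθ hR₁ hR hA hgrow hQ₁ hQ₂ hf0 hsol hG hf N hN hfN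
  have hΓv : 0 ≤ gammaV p R₁ R₂ := gammaV_nonneg hp0 hR₁ hR
  have hΓt : 0 ≤ gammaT p θ R₁ R₂ := gammaT_nonneg hp0 hθ hR₁ hR
  have hQfin : volume Q₂ ≠ ⊤ := by rw [hQ₂]; exact volume_kineticCylinder_ne_top
  have hle : volume.restrict (interior Q₂) ≤ volume.restrict Q₂ :=
    Measure.restrict_mono interior_subset le_rfl
  obtain ⟨g₁, g₂, g₃, hg₁, hg₂, hg₃, n₁, n₂, n₃, hbound⟩ := hpt (κ := κ) (lam := lam) (z₀ := z₀)
    (f := f) (G := G) hp1 hκ hLam hθ hR₁ hR hA hgrow (by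
      rw [← hQ₂]; exact ae_mono hle hf0) (by rw [← hQ₂]; exact hsol)
  rw [← hQ₂] at n₁ n₂ n₃
  rw [← hQ₁] at hbound
  set Γv := gammaV p R₁ R₂
  set Γt := gammaT p θ R₁ R₂
  set V := (volume Q₂).toReal ^ (1 / r - (p - 1) / p)
  have hV : 0 ≤ V := by positivity
  set a := normLpOn p Q₂ G with ha
  set b := normLpOn p Q₂ f with hb
  have ha0 : 0 ≤ a := normLpOn_nonneg
  have hb0 : 0 ≤ b := normLpOn_nonneg
  obtain ⟨hGp, hGpn⟩ := memLp_normLpOn_rpow hp1 hG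
  have one_le : ∀ {s : ℝ}, 1 < s → 1 ≤ ENNReal.ofReal s := fun hs => by simpa using hs.le
  have b₁ : eLpNorm g₁ (ENNReal.ofReal p) volume ≤ ENNReal.ofReal (a + C₀ * Γv * b) := by
    rw [n₁]
    refine (eLpNorm_mono_measure _ hle).trans ?_
    have := eLpNorm_add_mul_le (one_le hp1) zero_le_one (mul_nonneg hC₀.le hΓv) hG.1.norm hf.1.norm
    simp only [one_mul, Real.norm_eq_abs, ENNReal.ofReal_one] at this
    refine this.trans (le_of_eq ?_)
    have e1 : eLpNorm (fun z => ‖G z‖) (ENNReal.ofReal p) (volume.restrict Q₂) = _ := eLpNorm_norm G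
    have e2 : eLpNorm (fun z => |f z|) (ENNReal.ofReal p) (volume.restrict Q₂) = _ := eLpNorm_norm f
    rw [e1, e2, eLpNorm_eq_ofReal_normLpOn hG, eLpNorm_eq_ofReal_normLpOn hf,
      ← ENNReal.ofReal_mul (by positivity), ← ENNReal.ofReal_add (by positivity) (by positivity)]
  have b₂ : eLpNorm g₂ (ENNReal.ofReal (p / (p - 1))) volume ≤
      ENNReal.ofReal (Lam * a ^ (p - 1)) := by
    rw [n₂]
    refine (eLpNorm_mono_measure _ hle).trans (le_of_eq ?_)
    have e1 := eLpNorm_const_smul Lam (fun z => ‖G z‖ ^ (p - 1)) (ENNReal.ofReal (p / (p - 1)))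
      (volume.restrict Q₂)
    rw [Real.enorm_of_nonneg hLam.le, eLpNorm_eq_ofReal_normLpOn hGp, hGpn,
      ← ENNReal.ofReal_mul hLam.le] at e1
    exact e1
  have b₃ : eLpNorm g₃ (ENNReal.ofReal r) volume ≤
      ENNReal.ofReal (C₀ * Γt * N + C₀ * Γv * Lam * (a ^ (p - 1) * V)) := by
    rw [n₃]
    refine (eLpNorm_mono_measure _ hle).trans ?_
    have := eLpNorm_add_mul_le (one_le hr1) (mul_nonneg hC₀.le hΓt)
      (mul_nonneg (mul_nonneg hC₀.le hΓv) hLam.le) hf.1.norm hGp.1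
    simp only [Real.norm_eq_abs, mul_assoc] at this
    simp only [mul_assoc]
    refine this.trans ?_
    have e2 : eLpNorm (fun z => |f z|) (ENNReal.ofReal r) (volume.restrict Q₂) = _ := eLpNorm_norm f
    have e3 := eLpNorm_le_ofReal_normLpOn_mul (by linarith) hrp' hQfin hGp
    rw [hGpn, one_div_div] at e3
    rw [e2]
    calc _ ≤ ENNReal.ofReal (C₀ * Γt) * ENNReal.ofReal N +
          ENNReal.ofReal (C₀ * (Γv * Lam)) * ENNReal.ofReal (a ^ (p - 1) * V) := by gcongr
      _ = _ := by
          rw [← ENNReal.ofReal_mul (by positivity), ← ENNReal.ofReal_mul (by positivity),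
            ← ENNReal.ofReal_add (by positivity) (by positivity)]
          congr 1
          ring
  have hmf := fun (β : ℝ) (g : Phase d → ENNReal) (hg : Measurable g) =>
    (measurable_fracOp (κ := κ) (β := β) (S := Set.Ioi 0) (measurable_gaussENN (d := d) (1 / 4))
      hg).aestronglyMeasurable (μ := volume)
  have hq1 : 1 ≤ ENNReal.ofReal q := one_le (hp1.trans hpq)
  set T₁ := fracOp κ κ (gaussENN (1 / 4)) g₁ (Set.Ioi 0)
  set T₂ := fracOp κ (1 - κ) (gaussENN (1 / 4)) g₂ (Set.Ioi 0)
  set T₃ := fracOp κ 1 (gaussENN (1 / 4)) g₃ (Set.Ioi 0)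
  have hTsum : eLpNorm (T₁ + T₂ + T₃) (ENNReal.ofReal q) volume ≤
      ENNReal.ofReal (K₁ * (a + C₀ * Γv * b) + K₂ * (Lam * a ^ (p - 1)) +
        K₃ * (C₀ * Γt * N + C₀ * Γv * Lam * (a ^ (p - 1) * V))) := by
    refine (eLpNorm_add_le ((hmf _ _ hg₁).add (hmf _ _ hg₂)) (hmf _ _ hg₃) hq1).trans ?_
    refine (add_le_add_left (eLpNorm_add_le (hmf _ _ hg₁) (hmf _ _ hg₂) hq1) _).trans ?_
    rw [ENNReal.ofReal_add (by positivity) (by positivity),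
      ENNReal.ofReal_add (by positivity) (by positivity), ENNReal.ofReal_mul hK₁.le,
      ENNReal.ofReal_mul hK₂.le, ENNReal.ofReal_mul hK₃.le]
    gcongr
    · exact (hk₁ g₁ hg₁).trans (by gcongr)
    · exact (hk₂ g₂ hg₂).trans (by gcongr)
    · exact (hk₃ g₃ hg₃).trans (by gcongr)
  have hfT : eLpNorm f (ENNReal.ofReal q) (volume.restrict Q₁) ≤
      ENNReal.ofReal (c / ν) * eLpNorm (T₁ + T₂ + T₃) (ENNReal.ofReal q) volume := by
    refine le_trans (eLpNorm_le_mul_eLpNorm_of_ae_le_mul'' (g := T₁ + T₂ + T₃)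
      (c := ENNReal.ofReal (c / ν)) _ ?_ ?_) ?_
    · exact (((hmf _ _ hg₁).add (hmf _ _ hg₂)).add (hmf _ _ hg₃)).restrict
    · filter_upwards [hbound] with z hz
      rw [enorm_eq_self, ENNReal.ofReal_div_of_pos hνpos, hν, ENNReal.ofReal_toReal hνt,
        ← ENNReal.mul_div_right_comm, ENNReal.le_div_iff_mul_le (.inl hν0) (.inl hνt), mul_comm]
      exact hz
    · gcongr
      exact Measure.restrict_le_self
  refine (hfT.trans (mul_le_mul' le_rfl hTsum)).trans ?_
  rw [← ENNReal.ofReal_mul (by positivity)]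
  refine ENNReal.ofReal_le_ofReal ?_
  rw [mul_assoc (c / ν)]
  have hA1 : 0 ≤ a ^ (p - 1) := by positivity
  refine mul_le_mul_of_nonneg_left ?_ (by positivity : 0 ≤ c / ν)
  set x := a ^ (p - 1)
  have m1 : 0 ≤ Γv * b := by positivity
  have m2 : 0 ≤ Γt * N := by positivity
  have m3 : 0 ≤ Γv * V * x := by positivity
  -- The target, expanded, contains every term of the bound; `e1` to `e5` are the surplus cross
  -- terms, all nonnegative.
  have e1 : 0 ≤ K₁ * (x + Γv * V * x + Γv * b + Γt * N) := by positivity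
  have e2 : 0 ≤ K₁ * C₀ * (a + x + Γv * V * x + Γt * N) := by positivity
  have e3 : 0 ≤ K₂ * Lam * (a + Γv * V * x + Γv * b + Γt * N) := by positivity
  have e4 : 0 ≤ K₃ * C₀ * (a + x + Γv * V * x + Γv * b) := by positivity
  have e5 : 0 ≤ K₃ * C₀ * Lam * (a + x + Γv * b + Γt * N) := by positivity
  linarith

theorem lemma5p3 (d : ℕ) (hd : 1 ≤ d) (p q r : ℝ)
    (hp : p ∈ Set.Ioo (2 - 2 / (3 * (d : ℝ) + 2)) (2 + 2 / (d : ℝ)))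
    (hq : q = p * ((4 * (d : ℝ) + 2) / ((d : ℝ) * (p + 2))))
    (hr : r = p * ((4 * (d : ℝ) + 2) / (p * (3 * (d : ℝ) + 2) - 2 * (d : ℝ))))
    (lam Lam : ℝ) (hlam : 0 < lam) (hLam : 0 < Lam) :
    ∃ C : ℝ, 0 < C ∧
      ∀ (θ R₁ R₂ : ℝ) (z₀ : Phase d), 0 < θ → 0 < R₁ → R₁ < R₂ →
      ∀ A : Phase d → ℝ → Space d → Space d, IsCaratheodory A → HasPGrowth p lam Lam A →
      ∀ (Q₁ Q₂ : Set (Phase d)),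
        Q₁ = kineticCylinder p θ R₁ z₀ → Q₂ = kineticCylinder p θ R₂ z₀ →
      ∀ (f : Phase d → ℝ) (gradf : Phase d → Space d),
        (∀ᵐ z ∂(volume.restrict Q₂), 0 ≤ f z) →
        IsWeakSubsolution p A (interior Q₂) f gradf →
        MemLp gradf (ENNReal.ofReal p) (volume.restrict Q₂) →
        MemLp f (ENNReal.ofReal p) (volume.restrict Q₂) →
        MemLp f 2 (volume.restrict Q₂) →
        MemLp f (ENNReal.ofReal q) (volume.restrict Q₁) ∧
        normLpOn q Q₁ f ≤ C * (normLpOn p Q₂ gradf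
          + (1 + gammaV p R₁ R₂ * (volume Q₂).toReal ^ (1 / r - (p - 1) / p))
              * normLpOn p Q₂ gradf ^ (p - 1)
          + gammaV p R₁ R₂ * normLpOn p Q₂ f
          + gammaT p θ R₁ R₂ * (volume Q₂).toReal ^ (1 / r - 1 / p) * normLpOn p Q₂ f) ∧
        (2 ≤ p →
          normLpOn q Q₁ f ≤ C * (normLpOn p Q₂ gradf
            + (1 + gammaV p R₁ R₂ * (volume Q₂).toReal ^ (1 / r - (p - 1) / p))
                * normLpOn p Q₂ gradf ^ (p - 1)
            + gammaV p R₁ R₂ * normLpOn p Q₂ f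
            + gammaT p θ R₁ R₂ * (volume Q₂).toReal ^ (1 / r - 1 / 2) * normLpOn 2 Q₂ f)) := by
  obtain ⟨hp1, hpq, hp'q, hr1, hrq, hrp, hrp', hr2, -⟩ := kinetic_exponents hd hp hq hr
  obtain ⟨C, hC, hmain⟩ := exists_eLpNorm_le hd hp hq hr hLam
  refine ⟨C, hC, ?_⟩
  intro θ R₁ R₂ z₀ hθ hR₁ hR A hA hgrow Q₁ Q₂ hQ₁ hQ₂ f gradf hf0 hsol hG hf hf2
  have hr0 : 0 < r := by linarith
  have hp0 : 0 < p := by linarith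
  have hΓv : 0 ≤ gammaV p R₁ R₂ := gammaV_nonneg hp0 hR₁ hR
  have hΓt : 0 ≤ gammaT p θ R₁ R₂ := gammaT_nonneg hp0 hθ hR₁ hR
  have hQfin : volume Q₂ ≠ ⊤ := by rw [hQ₂]; exact volume_kineticCylinder_ne_top
  have hQ : Q₁ ⊆ Q₂ := by
    rw [hQ₁, hQ₂]
    exact (kineticCylinder_subset_interior hp0 hθ hR₁ hR).trans interior_subset
  have hf2' : MemLp f (ENNReal.ofReal 2) (volume.restrict Q₂) := by simpa using hf2
  have hest := hmain hθ hR₁ hR hA hgrow hQ₁ hQ₂ hf0 hsol hG hf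
  have hG0 : 0 ≤ normLpOn p Q₂ gradf := normLpOn_nonneg
  have hf0' : 0 ≤ normLpOn p Q₂ f := normLpOn_nonneg
  have hf20 : 0 ≤ normLpOn 2 Q₂ f := normLpOn_nonneg
  -- The two estimates differ only in how `f` is bounded in `L^r` for the time cutoff term: from
  -- `L^p` since `r ≤ p`, or from `L^2` since `r ≤ 2`.
  have h1 := hest _ (by positivity) (eLpNorm_le_ofReal_normLpOn_mul hr0 hrp hQfin hf)
  have h2 := hest _ (by positivity) (eLpNorm_le_ofReal_normLpOn_mul hr0 hr2 hQfin hf2')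
  refine ⟨⟨hf.1.mono_measure (Measure.restrict_mono hQ le_rfl),
    h1.trans_lt ENNReal.ofReal_lt_top⟩, ?_, fun _ => ?_⟩
  · refine (ENNReal.toReal_le_of_le_ofReal (by positivity) h1).trans (le_of_eq ?_)
    ring
  · refine (ENNReal.toReal_le_of_le_ofReal (by positivity) h2).trans (le_of_eq ?_)
    ring
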